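/- Let $g:\mathbb R\to\mathbb R$ be an orientation-preserving $C^\infty$ diffeomorphism and let $F$ be a smooth probability density on $\mathbb R$ for which there is $\beta_+\in(0,\infty]$ such that $x\mapsto e^{\beta x}F(g^{-1}(x))$ is a Schwartz function for all real $\beta<\beta_+$ (B2). Write $G_s(x)=(2\pi s^2)^{-1/2}e^{-x^2/(2s^2)}$, $\bar F(0)=\int F(g^{-1}(x))\,dx$, $$a(0)=\frac{1}{\bar F(0)}\int xF(g^{-1}(x))\,dx,\qquad b^2(0)=\frac1{\bar F(0)}\int (x-a(0))^2F(g^{-1}(x))\,dx,$$ $$F_\Lambda(E)=\int F(g^{-1}(y))\,G_\Lambda(g(E)-y)\,dy .$$ By a system we mean a self-adjoint operator $H$ on a complex Hilbert space with discrete spectrum and finite degeneracies, i.e. with an orthonormal basis of eigenvectors $\psi_i$, $H\psi_i=E_i\psi_i$, such that $\{i: |E_i|\le R\}$ is finite for all $R$, together with a positive self-adjoint (possibly unbounded) operator $A$. Here $f(H)=\sum_i f(E_i)|\psi_i\rangle\langle\psi_i|$ and $\mathrm{Tr}(Af(H))=\sum_i\langle\psi_i,Af(H)\psi_i\rangle$.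 Put $$\bar g(\beta)=\frac{\mathrm{Tr}(Ae^{-\beta g(H)}g(H))}{\mathrm{Tr}(Ae^{-\beta g(H)})},\quad \sigma^2(\beta)=\frac{\mathrm{Tr}(Ae^{-\beta g(H)}[g(H)-\bar g(\beta)]^2)}{\mathrm{Tr}(Ae^{-\beta g(H)})},\quad \bar g(0)=\lim_{\beta\to0^+}\bar g(\beta)\in[-\infty,\infty].$$ Assume that $\beta_-\in[-\infty,0]$ and $\mathrm{Tr}(Ae^{-\beta g(H)})<\infty$ for all real $\beta>\beta_-$ (B1). For $c\ge0$, consider the conditions: (G1) $a(0)<\bar g(0)$; (G2) $\beta^{1+2c}\bar g(\beta)$ stays bounded as $\beta\to0^+$; (G3) $\beta\sigma^2(\beta)/\bar g(\beta)$ stays bounded as $\beta\to0^+$. For $L\in\mathbb R$, $\lambda^2\ge0$, $s>0$ let $(\ast)_{L,\lambda^2,s}$ be the statement $$\mathrm{Tr}(AF_\Lambda(H))=\bar F(0)\,\mathrm{Tr}\big[A\,G_{\sqrt{\lambda^2+\Lambda^2}}(L-g(H))\big]\,\big(1+O(\Lambda^{-s})\big)\qquad(\Lambda\to\infty).$$ **Guaranteed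 rates.** For all $\Lambda>0$, $L\in\mathbb R$ and $\lambda^2\ge0$ the two traces in $(\ast)$ are finite. If $\beta_-<0$ put $c=0$; otherwise let $c\ge0$ be any number such that G1–G3 hold. Then: 1. $(\ast)$ holds with $L=a(0)$, $\lambda^2=b^2(0)$ and $s=3/(1+c)$. 2. $(\ast)$ holds with $L=a(0)$, any $\lambda^2\ge0$ and $s=2/(1+c)$. 3. $(\ast)$ holds with any $\lambda^2\ge0$, any $L$ such that $\beta_-<0$ or $L<\bar g(0)$, and $s=1/(1+c)$. **For any other choice of $L$ or $\lambda^2$ only a slower convergence can be guaranteed.** Let $L\in\mathbb R$ and $\lambda^2\ge0$ with $(L,\lambda^2)\ne(a(0),b^2(0))$. 4. For every $c\ge0$ there is a system on $\ell^2(\mathbb N)$ with $0<\mathrm{Tr}\,F(H)<\infty$ such that $\mathrm{Tr}(Ae^{-\beta g(H)})$ is finite for $\beta>0$ and infinite for $\beta<0$ (so the optimal $\beta_-$ is $0$), G1–G3 hold with this $c$, $L<\bar g(0)$, and the relation in $(\ast)$ fails even with $1+o(\Lambda^{-k/(1+c)})$ in place of $1+O(\Lambda^{-s})$, where $k=1$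 if $L\ne a(0)$ and $k=2$ if $L=a(0)$, $\lambda^2\neq b^2(0)$. 5. There is a system on $\ell^2(\mathbb N)$ with $0<\mathrm{Tr}\,F(H)<\infty$ satisfying B1 for some $\beta_-<0$ for which the relation in $(\ast)$ fails with $1+o(\Lambda^{-2})$, so that in particular $(\ast)_{L,\lambda^2,3}$ fails. -/

import Mathlib

open Filter Topology Asymptotics MeasureTheory
open scoped ContDiff InnerProductSpace

noncomputable section

namespace GaussConv

/-! ### Operators with a discrete energy spectrum -/

section Operators

universe u v

variable {𝓗 : Type u} [NormedAddCommGroup 𝓗] [InnerProductSpace ℂ 𝓗]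

/-- A complete orthonormal system `ψ` of eigenvectors of the (possibly unbounded) operator `H`,
with eigenvalues `E`, where every bounded interval contains only finitely many eigenvalues counted
with multiplicity: the energy spectrum is discrete, with finite degeneracies. -/
structure EnergyEigenbasis (H : 𝓗 →ₗ.[ℂ] 𝓗) (ι : Type v) where
  /-- the energy eigenvectors -/
  ψ : HilbertBasis ι ℂ 𝓗
  /-- the energy eigenvalues -/
  E : ι → ℝ
  mem_domain : ∀ i, ψ i ∈ H.domain
  eigen : ∀ i, H ⟨ψ i, mem_domain i⟩ = (E i : ℂ) • ψ i
  discrete : ∀ R : ℝ, {i | |E i| ≤ R}.Finite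

/-- A positive observable: a positive self-adjoint operator, not necessarily bounded. -/
structure IsPositiveObservable [CompleteSpace 𝓗] (A : 𝓗 →ₗ.[ℂ] 𝓗) : Prop where
  selfAdjoint : IsSelfAdjoint A
  nonneg : ∀ v : A.domain, 0 ≤ (⟪(v : 𝓗), A v⟫_ℂ).re

/-- The product `A B` of two partially defined operators, on its natural domain
`{v ∈ dom B | B v ∈ dom A}`. -/
def opMul (A B : 𝓗 →ₗ.[ℂ] 𝓗) : 𝓗 →ₗ.[ℂ] 𝓗 where
  domain := (A.domain.comap B.toFun).map B.domain.subtype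
  toFun :=
    { toFun := fun v => A ⟨B ⟨v, by
          obtain ⟨w, -, hw⟩ := v.2
          exact hw ▸ w.2⟩, by
          obtain ⟨v, w, hw, rfl⟩ := v
          exact hw⟩
      map_add' := fun v w => by
        rw [← LinearPMap.map_add]
        congr 1
        apply Subtype.ext
        exact LinearPMap.map_add B ⟨(v : 𝓗), _⟩ ⟨(w : 𝓗), _⟩
      map_smul' := fun c v => by
        rw [RingHom.id_apply, ← LinearPMap.map_smul]
        congr 1
        apply Subtype.ext
        exact LinearPMap.map_smul B c ⟨(v : 𝓗), _⟩ }

variable {H : 𝓗 →ₗ.[ℂ] 𝓗} {ι : Type v}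

namespace EnergyEigenbasis

/-- The maximal domain `{v | ∑ᵢ |f(Eᵢ) ⟨ψᵢ, v⟩|² < ∞}` of the operator `f(H)`. -/
def fnDomain (b : EnergyEigenbasis H ι) (f : ℝ → ℝ) : Submodule ℂ 𝓗 where
  carrier := {v | Memℓp (fun i => (f (b.E i) : ℂ) * b.ψ.repr v i) 2}
  add_mem' := fun {v w} hv hw => by
    have h := Memℓp.add hv hw
    refine (congrArg (fun s => Memℓp s 2) (funext fun i => ?_)).mp h
    simp [mul_add]
  zero_mem' := by
    refine (congrArg (fun s => Memℓp s 2) (funext fun i => ?_)).mp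
      (zero_memℓp (E := fun _ : ι => ℂ) (p := 2))
    simp
  smul_mem' := fun c v hv => by
    have h := Memℓp.const_smul hv c
    refine (congrArg (fun s => Memℓp s 2) (funext fun i => ?_)).mp h
    simp [mul_left_comm]

/-- The coefficients `i ↦ f(Eᵢ) ⟨ψᵢ, v⟩` of `f(H) v`. -/
def fnCoeff (b : EnergyEigenbasis H ι) (f : ℝ → ℝ) :
    b.fnDomain f →ₗ[ℂ] lp (fun _ : ι => ℂ) 2 where
  toFun := fun v => ⟨fun i => (f (b.E i) : ℂ) * b.ψ.repr (v : 𝓗) i, v.2⟩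
  map_add' := fun v w => by
    apply lp.ext
    funext i
    rw [lp.coeFn_add, Pi.add_apply]
    simp [mul_add]
  map_smul' := fun c v => by
    apply lp.ext
    funext i
    rw [lp.coeFn_smul, Pi.smul_apply]
    simp [mul_left_comm]

/-- The operator `f(H) = ∑ᵢ f(Eᵢ) |ψᵢ⟩⟨ψᵢ|` on its maximal domain. -/
def fn (b : EnergyEigenbasis H ι) (f : ℝ → ℝ) : 𝓗 →ₗ.[ℂ] 𝓗 where
  domain := b.fnDomain f
  toFun := b.ψ.repr.symm.toLinearEquiv.toLinearMap ∘ₗ b.fnCoeff f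

open Classical in
/-- The diagonal elements `⟨ψᵢ, T ψᵢ⟩`. -/
def diag (b : EnergyEigenbasis H ι) (T : 𝓗 →ₗ.[ℂ] 𝓗) (i : ι) : ℂ :=
  if h : b.ψ i ∈ T.domain then ⟪b.ψ i, T ⟨b.ψ i, h⟩⟫_ℂ else 0

/-- The trace of `T`, evaluated in the energy eigenbasis, is well defined and finite. -/
def HasTrace (b : EnergyEigenbasis H ι) (T : 𝓗 →ₗ.[ℂ] 𝓗) : Prop :=
  (∀ i, b.ψ i ∈ T.domain) ∧ Summable (b.diag T)

/-- The trace of `T`, evaluated in the energy eigenbasis. -/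
def trace (b : EnergyEigenbasis H ι) (T : 𝓗 →ₗ.[ℂ] 𝓗) : ℂ := ∑' i, b.diag T i

/-- `Tr (A f(H)) < ∞`. -/
def FiniteTr (b : EnergyEigenbasis H ι) (A : 𝓗 →ₗ.[ℂ] 𝓗) (f : ℝ → ℝ) : Prop :=
  b.HasTrace (opMul A (b.fn f))

/-- `Tr (A f(H))`. For a symmetric operator `A` and a real function `f` all the diagonal elements
`⟨ψᵢ, A f(H) ψᵢ⟩ = f(Eᵢ) ⟨ψᵢ, A ψᵢ⟩` are real, and so is the trace. -/
def Tr (b : EnergyEigenbasis H ι) (A : 𝓗 →ₗ.[ℂ] 𝓗) (f : ℝ → ℝ) : ℝ :=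
  (b.trace (opMul A (b.fn f))).re

end EnergyEigenbasis

end Operators

/-! ### The fluctuation spectrum -/

/-- A smooth probability density on the real line. -/
structure IsSmoothDensity (F : ℝ → ℝ) : Prop where
  smooth : ContDiff ℝ ∞ F
  nonneg : ∀ x, 0 ≤ F x
  integral_eq_one : ∫ x, F x = 1

/-- Rapidly decreasing functions, i.e. Schwartz functions. -/
def IsRapidlyDecreasing (f : ℝ → ℝ) : Prop := ∃ φ : SchwartzMap ℝ ℝ, ⇑φ = f

/-- The Gaussian density with mean `0` and standard deviation `s`. -/
def gaussian (s x : ℝ) : ℝ :=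
  1 / Real.sqrt (2 * Real.pi * s ^ 2) * Real.exp (-x ^ 2 / (2 * s ^ 2))

/-- The `g`-transform `F̄(β) = ∫ e^{β x} F(g⁻¹(x)) dx` on the real axis. -/
def Fbar (g : ℝ ≃o ℝ) (F : ℝ → ℝ) (β : ℝ) : ℝ :=
  ∫ x, Real.exp (β * x) * F (g.symm x)

/-- The reparametrized mean `a(β)`. -/
def mean (g : ℝ ≃o ℝ) (F : ℝ → ℝ) (β : ℝ) : ℝ :=
  (∫ x, F (g.symm x) * Real.exp (β * x) * x) / ∫ x, F (g.symm x) * Real.exp (β * x)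

/-- The reparametrized variance `b²(β)`. -/
def variance (g : ℝ ≃o ℝ) (F : ℝ → ℝ) (β : ℝ) : ℝ :=
  (∫ x, F (g.symm x) * Real.exp (β * x) * (x - mean g F β) ^ 2) /
    ∫ x, F (g.symm x) * Real.exp (β * x)

/-- Coarse graining in the reparametrized variable:
`F_Λ(E) = ∫ F(g⁻¹(y)) G_Λ(g(E) - y) dy`. -/
def coarse (g : ℝ ≃o ℝ) (F : ℝ → ℝ) (Λ E : ℝ) : ℝ :=
  ∫ y, F (g.symm y) * gaussian Λ (g E - y)

/-- The reparametrized Gaussian `E ↦ G_{√(v + Λ²)}(L - g(E))`. -/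
def gaussEnsemble (g : ℝ ≃o ℝ) (L v Λ E : ℝ) : ℝ :=
  gaussian (Real.sqrt (v + Λ ^ 2)) (L - g E)

/-! ### The reparametrized canonical ensemble -/

section Canonical

universe u v

variable {𝓗 : Type u} [NormedAddCommGroup 𝓗] [InnerProductSpace ℂ 𝓗]
  {H : 𝓗 →ₗ.[ℂ] 𝓗} {ι : Type v}

/-- `A` is `g`-bounded at `β`: `Tr (A e^{-β g(H)}) < ∞`. -/
def GBounded (b : EnergyEigenbasis H ι) (A : 𝓗 →ₗ.[ℂ] 𝓗) (g : ℝ ≃o ℝ) (β : ℝ) : Prop :=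
  b.FiniteTr A fun x => Real.exp (-β * g x)

/-- The mean `ḡ(β)` of `g(H)`, weighted with `A`, in the reparametrized canonical ensemble. -/
def gbar (b : EnergyEigenbasis H ι) (A : 𝓗 →ₗ.[ℂ] 𝓗) (g : ℝ ≃o ℝ) (β : ℝ) : ℝ :=
  b.Tr A (fun x => Real.exp (-β * g x) * g x) / b.Tr A (fun x => Real.exp (-β * g x))

/-- The corresponding variance `σ²(β)` of `g(H)`. -/
def sigmaSq (b : EnergyEigenbasis H ι) (A : 𝓗 →ₗ.[ℂ] 𝓗) (g : ℝ ≃o ℝ) (β : ℝ) : ℝ :=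
  b.Tr A (fun x => Real.exp (-β * g x) * (g x - gbar b A g β) ^ 2) /
    b.Tr A (fun x => Real.exp (-β * g x))

/-- `L < ḡ(0)`, where `ḡ(0) ∈ [-∞, ∞]` is the limit of `ḡ(β)` as `β → 0⁺`. -/
def BelowGbarZero (b : EnergyEigenbasis H ι) (A : 𝓗 →ₗ.[ℂ] 𝓗) (g : ℝ ≃o ℝ) (L : ℝ) : Prop :=
  ∃ ℓ : EReal, Tendsto (fun β => (gbar b A g β : EReal)) (𝓝[>] 0) (𝓝 ℓ) ∧ (L : EReal) < ℓ

/-- The conditions on the behaviour of the canonical ensemble as `β → 0⁺`, with constant `c`. -/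
structure GConditions (b : EnergyEigenbasis H ι) (A : 𝓗 →ₗ.[ℂ] 𝓗) (g : ℝ ≃o ℝ) (F : ℝ → ℝ)
    (c : ℝ) : Prop where
  mean_lt : BelowGbarZero b A g (mean g F 0)
  gbar_bdd : (fun β : ℝ => β ^ (1 + 2 * c) * gbar b A g β) =O[𝓝[>] 0] fun _ => (1 : ℝ)
  sigmaSq_bdd : (fun β : ℝ => β * sigmaSq b A g β / gbar b A g β) =O[𝓝[>] 0] fun _ => (1 : ℝ)

/-- `r` is the relative error, for all large `Λ`, of the Gaussian approximation with parameters
`L` and `v = λ²`: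
`Tr (A F_Λ(H)) = F̄(0) Tr [A G_{√(v + Λ²)}(L - g(H))] (1 + r(Λ))`. -/
def IsRelError (b : EnergyEigenbasis H ι) (A : 𝓗 →ₗ.[ℂ] 𝓗) (g : ℝ ≃o ℝ) (F : ℝ → ℝ)
    (L v : ℝ) (r : ℝ → ℝ) : Prop :=
  ∀ᶠ Λ in atTop,
    b.Tr A (coarse g F Λ) = Fbar g F 0 * b.Tr A (gaussEnsemble g L v Λ) * (1 + r Λ)

/-- The Gaussian approximation with parameters `L`, `v = λ²` holds up to a factor
`1 + O(Λ^{-s})`. -/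
def ApproxBigO (b : EnergyEigenbasis H ι) (A : 𝓗 →ₗ.[ℂ] 𝓗) (g : ℝ ≃o ℝ) (F : ℝ → ℝ)
    (L v s : ℝ) : Prop :=
  ∃ r : ℝ → ℝ, IsRelError b A g F L v r ∧ r =O[atTop] fun Λ : ℝ => Λ ^ (-s)

/-- The Gaussian approximation with parameters `L`, `v = λ²` holds up to a factor
`1 + o(Λ^{-s})`. -/
def ApproxLittleO (b : EnergyEigenbasis H ι) (A : 𝓗 →ₗ.[ℂ] 𝓗) (g : ℝ ≃o ℝ) (F : ℝ → ℝ)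
    (L v s : ℝ) : Prop :=
  ∃ r : ℝ → ℝ, IsRelError b A g F L v r ∧ r =o[atTop] fun Λ : ℝ => Λ ^ (-s)

/-- A quantum system for which `F` is a fluctuation spectrum: `H` and `A ≥ 0` are self-adjoint, and
`F(H)` has a finite, strictly positive trace, so that `F(H) / Tr F(H)` is a density operator. -/
structure IsSystem [CompleteSpace 𝓗] (b : EnergyEigenbasis H ι) (A : 𝓗 →ₗ.[ℂ] 𝓗) (F : ℝ → ℝ) :
    Prop where
  selfAdjoint : IsSelfAdjoint H
  observable : IsPositiveObservable A
  hasTrace : b.HasTrace (b.fn F)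
  trace_pos : 0 < (b.trace (b.fn F)).re

end Canonical

/-- The separable Hilbert space `ℓ²(ℕ, ℂ)`. -/
abbrev HilbertSeq : Type := lp (fun _ : ℕ => ℂ) 2

end GaussConv

end

noncomputable section

namespace GaussConv

/-! ### Matrix elements in the energy eigenbasis -/

section Reduction

universe u v

variable {𝓗 : Type u} [NormedAddCommGroup 𝓗] [InnerProductSpace ℂ 𝓗]
  {H : 𝓗 →ₗ.[ℂ] 𝓗} {ι : Type v}

/-! In the energy eigenbasis every trace is a sum over levels `x i = g (E i)` with nonnegative
weights `⟨ψ i, A ψ i⟩`, so the theorem compares two functions of `y = x i - L` under one positive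
weight.

Pointwise comparison. Put `θ = y / Λ²` and `τ = 1 / Λ`. After the Gaussian `exp (-y² / (2 Λ²))` is
factored out, the smoothed density is an exponential integral in `θ` and `τ`, and a Taylor expansion
shows that it differs from `F̄(0)` times the widened Gaussian by `θ m₁ + (θ² - τ²) / 2 * (m₂ - v
m₀)` plus an error of order `(|θ| + τ)³`, where `mₖ` are the moments about `L`. The first term
vanishes for `L = a(0)`, the second one then for `v = b²(0)`: this is the source of the orders 1, 2,
3 (`ExpDecay.relOrder_deviation`). The expansion is valid for `|θ| ≤ δ`; beyond that a tangent
exponential of the Gaussian bounds everything (`RelOrder`).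

Summation. If `β₋ < 0`, all moments of the levels are finite and each order is worth a factor `1 /
Λ` (`sumOrder_of_summable_neg`). Otherwise let `β` solve the saddle point equation `ḡ(β) - L = β
Λ²`. The canonical weight `exp (-β y + β² Λ² / 2)` is tangent to the Gaussian at `y = β Λ²`, so a
remainder of order `k` is at most `max (β, 1 / Λ) ^ k` times this weight, up to a constant
(`RelOrder.le_canonical`). Jensen's inequality bounds the canonical sum by `exp (σ² / (2 Λ²))` times
the Gaussian sum (`tsum_exp_le_gaussSum`). G2 gives `β = O(Λ^(-1/(1+c)))` and G3 gives `σ² = O(Λ²)`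
(`exists_saddle`).

Optimality. It suffices to bound the leading term from below along a sequence of scales
(`not_approxLittleO`). For `β₋ < 0`, equidistant levels with weights `exp (-2 n)` work, since the
leading term times `Λ²` has a limit that is nonzero for a suitable lowest level. For `β₋ = 0`, the
levels are so sparse that a single one dominates the canonical ensemble up to constants; the gaps
are tuned so that `ḡ(β)` grows like `β^(-(1+2c))`. At the scales `Λ² = 2 (x N - L) t N` at least
half of the Gaussian weight lies on levels with `θ ≥ 1 / (2 t N)`, and `1 / t N` is at least
`Λ^(-1/(1+c))`. -/

theorem inner_map_comm [CompleteSpace 𝓗] {A : 𝓗 →ₗ.[ℂ] 𝓗} (hA : IsSelfAdjoint A)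
    (v w : A.domain) : ⟪A v, (w : 𝓗)⟫_ℂ = ⟪(v : 𝓗), A w⟫_ℂ := by
  have h := LinearPMap.adjoint_isFormalAdjoint hA.dense_domain
  rw [LinearPMap.isSelfAdjoint_def.mp hA] at h
  exact h v w

namespace EnergyEigenbasis

theorem ψ_mem_fnDomain (b : EnergyEigenbasis H ι) (f : ℝ → ℝ) (i : ι) :
    b.ψ i ∈ b.fnDomain f := by
  classical
  change Memℓp (fun j => (f (b.E j) : ℂ) * b.ψ.repr (b.ψ i) j) 2
  rw [b.ψ.repr_self]
  have h := lp.memℓp (lp.single (E := fun _ : ι => ℂ) 2 i ((f (b.E i) : ℂ)))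
  refine (congrArg (fun s => Memℓp s 2) (funext fun j => ?_)).mp h
  by_cases hj : j = i
  · subst hj; simp
  · simp [hj]

theorem fn_apply_ψ (b : EnergyEigenbasis H ι) (f : ℝ → ℝ) (i : ι) :
    b.fn f ⟨b.ψ i, b.ψ_mem_fnDomain f i⟩ = (f (b.E i) : ℂ) • b.ψ i := by
  classical
  change b.ψ.repr.symm (b.fnCoeff f ⟨b.ψ i, b.ψ_mem_fnDomain f i⟩) = _
  rw [LinearIsometryEquiv.symm_apply_eq, map_smul, b.ψ.repr_self]
  apply lp.ext
  funext j
  change (f (b.E j) : ℂ) * b.ψ.repr (b.ψ i) j = _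
  rw [b.ψ.repr_self, lp.coeFn_smul, Pi.smul_apply]
  by_cases hj : j = i
  · subst hj; simp
  · simp [hj]

/-- The weight `⟨ψᵢ, A ψᵢ⟩` of the `i`-th energy level. -/
def weight (b : EnergyEigenbasis H ι) (A : 𝓗 →ₗ.[ℂ] 𝓗) (i : ι) : ℝ := (b.diag A i).re

theorem mem_domain_opMul_fn_iff (b : EnergyEigenbasis H ι) (A : 𝓗 →ₗ.[ℂ] 𝓗) (f : ℝ → ℝ)
    (i : ι) : b.ψ i ∈ (opMul A (b.fn f)).domain ↔ (f (b.E i) : ℂ) • b.ψ i ∈ A.domain := by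
  constructor
  · rintro ⟨w, hw, hwi⟩
    have h : w = ⟨b.ψ i, b.ψ_mem_fnDomain f i⟩ := Subtype.ext hwi
    rw [← b.fn_apply_ψ, ← h]
    exact hw
  · intro h
    refine ⟨⟨b.ψ i, b.ψ_mem_fnDomain f i⟩, ?_, rfl⟩
    rw [← b.fn_apply_ψ] at h
    exact h

theorem diag_opMul_fn (b : EnergyEigenbasis H ι) {A : 𝓗 →ₗ.[ℂ] 𝓗} (f : ℝ → ℝ)
    {i : ι} (hi : b.ψ i ∈ A.domain) :
    b.diag (opMul A (b.fn f)) i = f (b.E i) * b.diag A i := by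
  have h1 : b.ψ i ∈ (opMul A (b.fn f)).domain :=
    (b.mem_domain_opMul_fn_iff A f i).mpr (A.domain.smul_mem _ hi)
  rw [diag, dif_pos h1, diag, dif_pos hi]
  have : opMul A (b.fn f) ⟨b.ψ i, h1⟩ = (f (b.E i) : ℂ) • A ⟨b.ψ i, hi⟩ := by
    rw [← LinearPMap.map_smul]
    change A _ = A _
    congr 1
    apply Subtype.ext
    exact b.fn_apply_ψ f i
  rw [this, inner_smul_right]

theorem diag_eq_weight [CompleteSpace 𝓗] (b : EnergyEigenbasis H ι) {A : 𝓗 →ₗ.[ℂ] 𝓗}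
    (hA : IsSelfAdjoint A) (i : ι) : b.diag A i = b.weight A i := by
  rw [weight]
  by_cases h : b.ψ i ∈ A.domain
  · rw [diag, dif_pos h]
    have h1 := inner_map_comm hA ⟨b.ψ i, h⟩ ⟨b.ψ i, h⟩
    have h2 : (starRingEnd ℂ) ⟪b.ψ i, A ⟨b.ψ i, h⟩⟫_ℂ = ⟪b.ψ i, A ⟨b.ψ i, h⟩⟫_ℂ := by
      rw [inner_conj_symm]
      exact h1
    exact (Complex.conj_eq_iff_re.mp h2).symm
  · simp [diag, h]

theorem weight_nonneg [CompleteSpace 𝓗] (b : EnergyEigenbasis H ι) {A : 𝓗 →ₗ.[ℂ] 𝓗}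
    (hA : IsPositiveObservable A) (i : ι) : 0 ≤ b.weight A i := by
  rw [weight]
  by_cases h : b.ψ i ∈ A.domain
  · rw [diag, dif_pos h]
    exact hA.nonneg ⟨b.ψ i, h⟩
  · simp [diag, h]

theorem finiteTr_iff [CompleteSpace 𝓗] (b : EnergyEigenbasis H ι) {A : 𝓗 →ₗ.[ℂ] 𝓗}
    (hA : IsSelfAdjoint A) (hd : ∀ i, b.ψ i ∈ A.domain) (f : ℝ → ℝ) :
    b.FiniteTr A f ↔ Summable fun i => b.weight A i * f (b.E i) := by
  have h1 : b.diag (opMul A (b.fn f)) = fun i => ((b.weight A i * f (b.E i) : ℝ) : ℂ) := by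
    funext i
    rw [b.diag_opMul_fn f (hd i), b.diag_eq_weight hA]
    push_cast
    ring
  rw [FiniteTr, HasTrace, h1, Complex.summable_ofReal]
  refine and_iff_right fun i => ?_
  exact (b.mem_domain_opMul_fn_iff A f i).mpr (A.domain.smul_mem _ (hd i))

theorem tr_eq_tsum [CompleteSpace 𝓗] (b : EnergyEigenbasis H ι) {A : 𝓗 →ₗ.[ℂ] 𝓗}
    (hA : IsSelfAdjoint A) (hd : ∀ i, b.ψ i ∈ A.domain) (f : ℝ → ℝ) :
    b.Tr A f = ∑' i, b.weight A i * f (b.E i) := by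
  have h1 : b.diag (opMul A (b.fn f)) = fun i => ((b.weight A i * f (b.E i) : ℝ) : ℂ) := by
    funext i
    rw [b.diag_opMul_fn f (hd i), b.diag_eq_weight hA]
    push_cast
    ring
  rw [Tr, trace, h1, ← Complex.ofReal_tsum, Complex.ofReal_re]

/-- The exponential never vanishes, so the scalar can be divided out. Finiteness at a single `β`
thus puts all eigenvectors into the domain of `A`, which reduces the traces for arbitrary functions
to sums. -/
theorem ψ_mem_domain_of_gBounded (b : EnergyEigenbasis H ι) {A : 𝓗 →ₗ.[ℂ] 𝓗} {g : ℝ ≃o ℝ}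
    {β : ℝ} (h : GBounded b A g β) (i : ι) : b.ψ i ∈ A.domain := by
  have h1 := (b.mem_domain_opMul_fn_iff A _ i).mp (h.1 i)
  have h2 : ((Real.exp (-β * g (b.E i)) : ℝ) : ℂ) ≠ 0 := by
    exact_mod_cast (Real.exp_pos _).ne'
  exact (A.domain.smul_mem_iff h2).mp h1

end EnergyEigenbasis

end Reduction

/-! ### Diagonal operators on `ℓ²(ℕ)` -/

section Diagonal

/-- The diagonal operator with entries `a n` on its maximal domain in `ℓ²(ℕ)`. -/
def diagOp (a : ℕ → ℝ) : HilbertSeq →ₗ.[ℂ] HilbertSeq where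
  domain :=
    { carrier := {v | Memℓp (fun n => (a n : ℂ) * v n) 2}
      add_mem' := fun {v w} hv hw => by
        have h := Memℓp.add hv hw
        refine (congrArg (fun s => Memℓp s 2) (funext fun i => ?_)).mp h
        simp [mul_add]
      zero_mem' := by
        refine (congrArg (fun s => Memℓp s 2) (funext fun i => ?_)).mp
          (zero_memℓp (E := fun _ : ℕ => ℂ) (p := 2))
        simp
      smul_mem' := fun c v hv => by
        have h := Memℓp.const_smul hv c
        refine (congrArg (fun s => Memℓp s 2) (funext fun i => ?_)).mp h
        simp [mul_left_comm] }
  toFun :=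
    { toFun := fun v => ⟨fun n => (a n : ℂ) * (v : HilbertSeq) n, v.2⟩
      map_add' := fun v w => by
        apply lp.ext
        funext i
        rw [lp.coeFn_add, Pi.add_apply]
        simp [mul_add]
      map_smul' := fun c v => by
        apply lp.ext
        funext i
        rw [lp.coeFn_smul, Pi.smul_apply]
        simp [mul_left_comm] }

theorem mem_diagOp_domain {a : ℕ → ℝ} {v : HilbertSeq} :
    v ∈ (diagOp a).domain ↔ Memℓp (fun n => (a n : ℂ) * v n) 2 := Iff.rfl

theorem diagOp_apply (a : ℕ → ℝ) (v : (diagOp a).domain) (n : ℕ) :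
    (diagOp a v : HilbertSeq) n = a n * (v : HilbertSeq) n := rfl

theorem single_mem_diagOp_domain (a : ℕ → ℝ) (n : ℕ) :
    lp.single 2 n (1 : ℂ) ∈ (diagOp a).domain := by
  rw [mem_diagOp_domain]
  have h := lp.memℓp (lp.single (E := fun _ : ℕ => ℂ) 2 n ((a n : ℂ)))
  refine (congrArg (fun s => Memℓp s 2) (funext fun j => ?_)).mp h
  by_cases hj : j = n
  · subst hj; simp
  · simp [hj]

theorem diagOp_single (a : ℕ → ℝ) (n : ℕ) :
    diagOp a ⟨lp.single 2 n (1 : ℂ), single_mem_diagOp_domain a n⟩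
      = (a n : ℂ) • (lp.single 2 n (1 : ℂ) : HilbertSeq) := by
  apply lp.ext
  funext j
  rw [diagOp_apply, lp.coeFn_smul, Pi.smul_apply]
  by_cases hj : j = n
  · subst hj; simp
  · simp [hj]

/-- The standard basis of `ℓ²(ℕ)`. -/
def stdBasis : HilbertBasis ℕ ℂ HilbertSeq :=
  HilbertBasis.ofRepr (LinearIsometryEquiv.refl ℂ HilbertSeq)

theorem stdBasis_apply (n : ℕ) : stdBasis n = lp.single 2 n (1 : ℂ) := by
  rw [← stdBasis.repr_symm_single]
  rfl

theorem dense_diagOp_domain (a : ℕ → ℝ) : Dense ((diagOp a).domain : Set HilbertSeq) := by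
  have h := stdBasis.dense_span
  have h2 : Submodule.span ℂ (Set.range stdBasis) ≤ (diagOp a).domain := by
    rw [Submodule.span_le]
    rintro _ ⟨n, rfl⟩
    rw [stdBasis_apply]
    exact single_mem_diagOp_domain a n
  have h3 := Submodule.topologicalClosure_mono h2
  rw [h] at h3
  exact Submodule.dense_iff_topologicalClosure_eq_top.mpr (top_le_iff.mp h3)

theorem diagOp_isFormalAdjoint (a : ℕ → ℝ) : (diagOp a).IsFormalAdjoint (diagOp a) := by
  intro v w
  rw [lp.inner_eq_tsum, lp.inner_eq_tsum]
  refine tsum_congr fun n => ?_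
  rw [diagOp_apply, diagOp_apply]
  simp
  ring

/-- Testing the adjoint against the basis vectors shows that it acts by multiplication with `a n`;
since its values lie in `ℓ²`, every vector of its domain already lies in the maximal domain. -/
theorem isSelfAdjoint_diagOp (a : ℕ → ℝ) : IsSelfAdjoint (diagOp a) := by
  rw [LinearPMap.isSelfAdjoint_def]
  have hd := dense_diagOp_domain a
  have hle := (diagOp_isFormalAdjoint a).le_adjoint hd
  refine (LinearPMap.eq_of_le_of_domain_eq hle (le_antisymm hle.1 fun v hv => ?_)).symm
  have h1 : ∀ n, ((diagOp a).adjoint ⟨v, hv⟩ : HilbertSeq) n = a n * v n := by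
    intro n
    have h2 := LinearPMap.adjoint_isFormalAdjoint hd ⟨v, hv⟩
      ⟨lp.single 2 n (1 : ℂ), single_mem_diagOp_domain a n⟩
    rw [diagOp_single, inner_smul_right, lp.inner_single_right, lp.inner_single_right] at h2
    have h3 := congrArg (starRingEnd ℂ) h2
    simpa using h3
  rw [mem_diagOp_domain]
  refine (congrArg (fun s => Memℓp s 2) (funext fun j => ?_)).mp
    (lp.memℓp ((diagOp a).adjoint ⟨v, hv⟩))
  exact h1 j

theorem isPositiveObservable_diagOp {a : ℕ → ℝ} (ha : ∀ n, 0 ≤ a n) :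
    IsPositiveObservable (diagOp a) := by
  refine ⟨isSelfAdjoint_diagOp a, fun v => ?_⟩
  rw [lp.inner_eq_tsum]
  have h : ∀ n, ⟪(v : HilbertSeq) n, (diagOp a v : HilbertSeq) n⟫_ℂ
      = ((a n * ‖(v : HilbertSeq) n‖ ^ 2 : ℝ) : ℂ) := by
    intro n
    rw [diagOp_apply]
    simp only [RCLike.inner_apply, mul_assoc, Complex.mul_conj]
    rw [Complex.normSq_eq_norm_sq]
    push_cast
    ring
  simp_rw [h]
  rw [← Complex.ofReal_tsum, Complex.ofReal_re]
  exact tsum_nonneg fun n => mul_nonneg (ha n) (by positivity)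

/-- The energy eigenbasis of a diagonal operator whose entries tend to infinity. -/
def diagEigenbasis (a : ℕ → ℝ) (ha : Tendsto a atTop atTop) :
    EnergyEigenbasis (diagOp a) ℕ where
  ψ := stdBasis
  E := a
  mem_domain := fun n => by
    rw [stdBasis_apply]
    exact single_mem_diagOp_domain a n
  eigen := fun n => by
    simp_rw [stdBasis_apply]
    exact diagOp_single a n
  discrete := fun R => by
    have h := (ha.eventually_gt_atTop R)
    rw [← Nat.cofinite_eq_atTop] at h
    refine Set.Finite.subset h fun n hn => ?_
    simp only [Set.mem_ofPred_eq, Set.mem_compl_iff, not_lt] at hn ⊢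
    exact (le_abs_self _).trans hn

theorem diagEigenbasis_weight (a w : ℕ → ℝ) (ha : Tendsto a atTop atTop) (n : ℕ) :
    (diagEigenbasis a ha).weight (diagOp w) n = w n := by
  have h : (diagEigenbasis a ha).ψ n = lp.single 2 n (1 : ℂ) := stdBasis_apply n
  have hm : (diagEigenbasis a ha).ψ n ∈ (diagOp w).domain := by
    rw [h]
    exact single_mem_diagOp_domain w n
  rw [EnergyEigenbasis.weight, EnergyEigenbasis.diag, dif_pos hm]
  simp_rw [h]
  rw [diagOp_single, inner_smul_right, lp.inner_single_left]
  simp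

theorem diagEigenbasis_mem_domain (a w : ℕ → ℝ) (ha : Tendsto a atTop atTop) (n : ℕ) :
    (diagEigenbasis a ha).ψ n ∈ (diagOp w).domain := by
  have h : (diagEigenbasis a ha).ψ n = lp.single 2 n (1 : ℂ) := stdBasis_apply n
  rw [h]
  exact single_mem_diagOp_domain w n

theorem isSystem_diag {a w : ℕ → ℝ} (ha : Tendsto a atTop atTop) (hw : ∀ n, 0 ≤ w n)
    {F : ℝ → ℝ} (hF : ∀ x, 0 ≤ F x) (hs : Summable fun n => F (a n)) (hp : 0 < F (a 0)) :
    IsSystem (diagEigenbasis a ha) (diagOp w) F := by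
  set b := diagEigenbasis a ha
  have hdiag : b.diag (b.fn F) = fun n => ((F (a n) : ℝ) : ℂ) := by
    funext n
    have hm : b.ψ n ∈ (b.fn F).domain := b.ψ_mem_fnDomain F n
    rw [EnergyEigenbasis.diag, dif_pos hm, b.fn_apply_ψ, inner_smul_right]
    have := b.ψ.orthonormal.1 n
    rw [inner_self_eq_norm_sq_to_K, this]
    simp [b, diagEigenbasis]
  refine ⟨isSelfAdjoint_diagOp a, isPositiveObservable_diagOp hw,
    ⟨fun n => b.ψ_mem_fnDomain F n, ?_⟩, ?_⟩
  · rw [hdiag, Complex.summable_ofReal]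
    exact hs
  · rw [EnergyEigenbasis.trace, hdiag, ← Complex.ofReal_tsum, Complex.ofReal_re]
    exact hs.tsum_pos (fun n => hF _) 0 hp

end Diagonal

/-! ### Pointwise comparison of smoothed densities with Gaussians -/

section Pointwise

/-- The usual remainder carries `exp |x|`. Here `x` will be an exponent with a large negative
quadratic part, for which that factor would grow like a Gaussian and spoil integrability; for `x ≤
-1` the Taylor polynomial itself is already `O(|x|³)`. -/
theorem abs_exp_sub_taylor_two_le (x : ℝ) :
    |Real.exp x - 1 - x - x ^ 2 / 2| ≤ 4 * |x| ^ 3 * max 1 (Real.exp x) := by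
  have h1 : |Real.exp x - 1 - x - x ^ 2 / 2| ≤ |x| ^ 3 * Real.exp |x| := by
    have h := Complex.norm_exp_sub_sum_le_norm_mul_exp (x : ℂ) 3
    simp only [Finset.sum_range_succ, Finset.sum_range_zero] at h
    norm_num at h
    rw [← Complex.ofReal_exp] at h
    have h2 : (Real.exp x : ℂ) - (1 + (x : ℂ) + (x : ℂ) ^ 2 / 2)
        = ((Real.exp x - 1 - x - x ^ 2 / 2 : ℝ) : ℂ) := by
      push_cast
      ring
    rw [h2, Complex.norm_real, Real.norm_eq_abs] at h
    exact h
  rcases le_total 0 x with hx | hx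
  · refine h1.trans ?_
    rw [abs_of_nonneg hx]
    have h3 : Real.exp x ≤ max 1 (Real.exp x) := le_max_right _ _
    have h4 : 0 ≤ x ^ 3 := by positivity
    have h5 : 0 ≤ max 1 (Real.exp x) := zero_le_one.trans (le_max_left _ _)
    linarith [mul_le_mul_of_nonneg_left h3 h4, mul_nonneg h4 h5]
  · have h6 : (1 : ℝ) ≤ max 1 (Real.exp x) := le_max_left _ _
    have h4 : 0 ≤ |x| ^ 3 := by positivity
    suffices h : |Real.exp x - 1 - x - x ^ 2 / 2| ≤ 4 * |x| ^ 3 by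
      linarith [mul_le_mul_of_nonneg_left h6 h4]
    rcases le_total (-1) x with hx1 | hx1
    · refine h1.trans ?_
      have h7 : Real.exp |x| ≤ 4 := by
        have : |x| ≤ 1 := by rw [abs_le]; constructor <;> linarith
        calc Real.exp |x| ≤ Real.exp 1 := Real.exp_le_exp.mpr this
          _ ≤ 4 := by linarith [Real.exp_one_lt_d9]
      linarith [mul_le_mul_of_nonneg_left h7 h4]
    · have h8 : |x| = -x := abs_of_nonpos hx
      have h9 : Real.exp x ≤ 1 := Real.exp_le_one_iff.mpr hx
      have h10 := Real.exp_pos x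
      rw [h8, abs_le]
      set z := -x with hz
      have hxz : x = -z := by rw [hz]; ring
      rw [hxz] at h9 h10 ⊢
      have hz1 : 1 ≤ z := by linarith
      have hz2 : z ≤ z ^ 3 := by nlinarith [mul_nonneg (by linarith : 0 ≤ z) (by nlinarith : 0 ≤ z ^ 2 - 1)]
      have hz3 : z ^ 2 ≤ z ^ 3 := by nlinarith [mul_nonneg (sq_nonneg z) (by linarith : 0 ≤ z - 1)]
      constructor <;> linarith [sq_nonneg z]

/-- Count `θ` and `τ` as order one. In the second-order expansion of the exponential only `θ z`, `θ²
z²` and `τ² z²` have order at most two; the other terms of `Z² / 2` are `θ τ² z³` and `τ⁴ z⁴`, which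
go into the cubic error because `τ ≤ 1`. -/
theorem abs_exp_quadratic_sub_le {δ θ τ : ℝ} (hθ : |θ| ≤ δ) (hτ : 0 ≤ τ) (hτ1 : τ ≤ 1) (z : ℝ) :
    |Real.exp (θ * z - z ^ 2 * τ ^ 2 / 2) - (1 + θ * z + (θ ^ 2 - τ ^ 2) / 2 * z ^ 2)|
      ≤ 5 * (|θ| + τ) ^ 3 * (1 + |z|) ^ 6 * Real.exp (δ * |z|) := by
  set Z := θ * z - z ^ 2 * τ ^ 2 / 2 with hZ
  set s := |θ| + τ with hs
  set a := |z| with ha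
  have ha0 : 0 ≤ a := abs_nonneg z
  have hθ0 : 0 ≤ |θ| := abs_nonneg θ
  have hs0 : 0 ≤ s := by positivity
  have hδ : 0 ≤ δ := hθ0.trans hθ
  have hE1 : (1 : ℝ) ≤ Real.exp (δ * a) := Real.one_le_exp (by positivity)
  have hza : z ^ 2 = a ^ 2 := (sq_abs z).symm
  have hmax : max 1 (Real.exp Z) ≤ Real.exp (δ * a) := by
    refine max_le hE1 (Real.exp_le_exp.mpr ?_)
    have h1 : θ * z ≤ |θ| * a := by rw [ha, ← abs_mul]; exact le_abs_self _
    have h2 : |θ| * a ≤ δ * a := mul_le_mul_of_nonneg_right hθ ha0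
    have h3 : 0 ≤ z ^ 2 * τ ^ 2 / 2 := by positivity
    rw [hZ]; linarith
  have hτs : τ ≤ s := by rw [hs]; linarith
  have hθs : |θ| ≤ s := by rw [hs]; linarith
  have hττ : τ ^ 2 ≤ τ := by nlinarith
  have hZabs : |Z| ≤ s * (1 + a) ^ 2 := by
    have h1 : |Z| ≤ |θ| * a + a ^ 2 * τ ^ 2 / 2 := by
      rw [hZ, ← hza, ha, ← abs_mul]
      refine (abs_sub _ _).trans ?_
      rw [abs_of_nonneg (by positivity : 0 ≤ z ^ 2 * τ ^ 2 / 2)]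
    have h2 : a ^ 2 * τ ^ 2 ≤ a ^ 2 * s := mul_le_mul_of_nonneg_left (hττ.trans hτs) (by positivity)
    have h3 : |θ| * a ≤ s * a := mul_le_mul_of_nonneg_right hθs ha0
    linarith [mul_nonneg hs0 ha0, mul_nonneg hs0 (sq_nonneg a)]
  have hZ3 : |Z| ^ 3 ≤ s ^ 3 * (1 + a) ^ 6 := by
    calc |Z| ^ 3 ≤ (s * (1 + a) ^ 2) ^ 3 := pow_le_pow_left₀ (abs_nonneg _) hZabs 3
      _ = s ^ 3 * (1 + a) ^ 6 := by ring
  have hT := abs_exp_sub_taylor_two_le Z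
  have hrest : |(- (θ * z ^ 3 * τ ^ 2 / 2) + z ^ 4 * τ ^ 4 / 8)| ≤ s ^ 3 * (1 + a) ^ 6 := by
    refine (abs_add_le _ _).trans ?_
    rw [abs_neg]
    have e1 : |θ * z ^ 3 * τ ^ 2 / 2| = |θ| * a ^ 3 * τ ^ 2 / 2 := by
      rw [abs_div, abs_mul, abs_mul, abs_pow, abs_pow, abs_of_nonneg hτ]; norm_num [ha]
    have e2 : |z ^ 4 * τ ^ 4 / 8| = a ^ 4 * τ ^ 4 / 8 := by
      rw [abs_div, abs_mul, abs_pow, abs_pow, abs_of_nonneg hτ]; norm_num [ha]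
    rw [e1, e2]
    have f1 : |θ| * τ ^ 2 ≤ s ^ 3 := by
      calc |θ| * τ ^ 2 ≤ s * s ^ 2 := by gcongr
        _ = s ^ 3 := by ring
    have f2 : τ ^ 4 ≤ s ^ 3 := by
      calc τ ^ 4 = τ * τ ^ 3 := by ring
        _ ≤ 1 * s ^ 3 := by gcongr
        _ = s ^ 3 := by ring
    have f3 : a ^ 3 ≤ (1 + a) ^ 6 := by
      calc a ^ 3 ≤ (1 + a) ^ 3 := by gcongr; linarith
        _ ≤ (1 + a) ^ 6 := pow_le_pow_right₀ (by linarith) (by norm_num)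
    have f4 : a ^ 4 ≤ (1 + a) ^ 6 := by
      calc a ^ 4 ≤ (1 + a) ^ 4 := by gcongr; linarith
        _ ≤ (1 + a) ^ 6 := pow_le_pow_right₀ (by linarith) (by norm_num)
    have g1 : (|θ| * τ ^ 2) * a ^ 3 ≤ s ^ 3 * (1 + a) ^ 6 := by gcongr
    have g2 : τ ^ 4 * a ^ 4 ≤ s ^ 3 * (1 + a) ^ 6 := by gcongr
    have g3 : 0 ≤ s ^ 3 * (1 + a) ^ 6 := by positivity
    linarith
  have hsplit : Real.exp Z - (1 + θ * z + (θ ^ 2 - τ ^ 2) / 2 * z ^ 2)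
      = (Real.exp Z - 1 - Z - Z ^ 2 / 2) + (- (θ * z ^ 3 * τ ^ 2 / 2) + z ^ 4 * τ ^ 4 / 8) := by
    rw [hZ]; ring
  rw [hsplit]
  refine (abs_add_le _ _).trans ?_
  have k0 : 0 ≤ s ^ 3 * (1 + a) ^ 6 := by positivity
  have k1 : 4 * |Z| ^ 3 * max 1 (Real.exp Z) ≤ 4 * (s ^ 3 * (1 + a) ^ 6) * Real.exp (δ * a) := by
    gcongr
  linarith [mul_le_mul_of_nonneg_left hE1 k0]

theorem one_add_pow_le_exp {δ : ℝ} (hδ : 0 < δ) (n : ℕ) :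
    ∃ C : ℝ, 0 < C ∧ ∀ a : ℝ, 0 ≤ a → (1 + a) ^ n ≤ C * Real.exp (δ * a) := by
  refine ⟨n.factorial / δ ^ n * Real.exp δ, by positivity, fun a ha => ?_⟩
  have h := Real.pow_div_factorial_le_exp (δ * (1 + a)) (by positivity) n
  rw [div_le_iff₀ (by positivity), mul_pow] at h
  have h2 : (1 + a) ^ n ≤ Real.exp (δ * (1 + a)) * n.factorial / δ ^ n := by
    rw [le_div_iff₀ (by positivity)]
    linarith
  refine h2.trans (le_of_eq ?_)
  rw [mul_add, mul_one, Real.exp_add]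
  field_simp

/-- `R(Λ, y)` is of order `(|y| / Λ² + 1 / Λ) ^ k` relative to the Gaussian `e^{-y²/(2Λ²)}` for
`|y| ≤ δ Λ²`, and bounded by the tangential exponential of this Gaussian for `|y| > δ Λ²`. -/
def RelOrder (δ : ℝ) (k : ℕ) (R : ℝ → ℝ → ℝ) : Prop :=
  ∃ C : ℝ, 0 ≤ C ∧ ∀ Λ : ℝ, 1 ≤ Λ → ∀ y : ℝ,
    (|y| ≤ δ * Λ ^ 2 →
      |R Λ y| ≤ C * (|y| / Λ ^ 2 + 1 / Λ) ^ k * Real.exp (-y ^ 2 / (2 * Λ ^ 2))) ∧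
    (δ * Λ ^ 2 < |y| → |R Λ y| ≤ C * Real.exp (-δ * |y| + δ ^ 2 * Λ ^ 2 / 2))

namespace RelOrder

variable {δ : ℝ} {k : ℕ} {R S : ℝ → ℝ → ℝ}

theorem add (hR : RelOrder δ k R) (hS : RelOrder δ k S) :
    RelOrder δ k fun Λ y => R Λ y + S Λ y := by
  obtain ⟨C, hC, h⟩ := hR
  obtain ⟨D, hD, h'⟩ := hS
  refine ⟨C + D, by positivity, fun Λ hΛ y => ⟨fun hy => ?_, fun hy => ?_⟩⟩
  · have h1 := (h Λ hΛ y).1 hy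
    have h2 := (h' Λ hΛ y).1 hy
    calc |R Λ y + S Λ y| ≤ |R Λ y| + |S Λ y| := abs_add_le _ _
      _ ≤ _ := add_le_add h1 h2
      _ = _ := by ring
  · have h1 := (h Λ hΛ y).2 hy
    have h2 := (h' Λ hΛ y).2 hy
    calc |R Λ y + S Λ y| ≤ |R Λ y| + |S Λ y| := abs_add_le _ _
      _ ≤ _ := add_le_add h1 h2
      _ = _ := by ring

theorem const_mul (hR : RelOrder δ k R) (c : ℝ) : RelOrder δ k fun Λ y => c * R Λ y := by
  obtain ⟨C, hC, h⟩ := hR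
  refine ⟨|c| * C, by positivity, fun Λ hΛ y => ⟨fun hy => ?_, fun hy => ?_⟩⟩
  · rw [abs_mul]
    calc |c| * |R Λ y| ≤ |c| * _ := mul_le_mul_of_nonneg_left ((h Λ hΛ y).1 hy) (abs_nonneg c)
      _ = _ := by ring
  · rw [abs_mul]
    calc |c| * |R Λ y| ≤ |c| * _ := mul_le_mul_of_nonneg_left ((h Λ hΛ y).2 hy) (abs_nonneg c)
      _ = _ := by ring

theorem sub (hR : RelOrder δ k R) (hS : RelOrder δ k S) :
    RelOrder δ k fun Λ y => R Λ y - S Λ y := by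
  simpa [sub_eq_add_neg] using hR.add (hS.const_mul (-1))

theorem of_succ (hR : RelOrder δ (k + 1) R) : RelOrder δ k R := by
  obtain ⟨C, hC, h⟩ := hR
  refine ⟨C * (|δ| + 2), by positivity, fun Λ hΛ y => ⟨fun hy => ?_, fun hy => ?_⟩⟩
  · refine ((h Λ hΛ y).1 hy).trans ?_
    have hΛ0 : 0 < Λ := by linarith
    have h1 : |y| / Λ ^ 2 + 1 / Λ ≤ |δ| + 2 := by
      have h2 : |y| / Λ ^ 2 ≤ δ := by rw [div_le_iff₀ (by positivity)]; exact hy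
      have h3 : 1 / Λ ≤ 1 := by rw [div_le_one hΛ0]; exact hΛ
      linarith [le_abs_self δ]
    have h4 : 0 ≤ |y| / Λ ^ 2 + 1 / Λ := by positivity
    refine mul_le_mul_of_nonneg_right ?_ (Real.exp_pos _).le
    rw [pow_succ, mul_assoc, mul_comm ((|y| / Λ ^ 2 + 1 / Λ) ^ k)]
    gcongr
  · refine ((h Λ hΛ y).2 hy).trans ?_
    refine mul_le_mul_of_nonneg_right ?_ (Real.exp_pos _).le
    nlinarith [abs_nonneg δ, mul_nonneg hC (abs_nonneg δ)]

/-- Tangent bound for the Gaussian. -/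
theorem exp_gaussian_le {σ : ℝ} (hσ : 0 < σ) (δ y : ℝ) :
    Real.exp (-y ^ 2 / (2 * σ)) ≤ Real.exp (-δ * |y| + δ ^ 2 * σ / 2) := by
  rw [Real.exp_le_exp, div_le_iff₀ (by positivity), ← sq_abs y]
  nlinarith [sq_nonneg (|y| - δ * σ)]

/-- Near the center this is monotonicity. In the tail, completing the square shows that the tangent
exponential exceeds the Gaussian by exactly `exp ((q - δ)² Λ² / 2)` with `q = |y| / Λ²`, which
absorbs the power of `q`. -/
theorem monomial (_hδ : 0 < δ) (i j : ℕ) :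
    RelOrder δ (i + j) fun Λ y =>
      (y / Λ ^ 2) ^ i * (1 / Λ) ^ j * Real.exp (-y ^ 2 / (2 * Λ ^ 2)) := by
  refine ⟨i.factorial * Real.exp (δ + 1 / 2) + 1, by positivity,
    fun Λ hΛ y => ⟨fun hy => ?_, fun hy => ?_⟩⟩
  · have hΛ0 : 0 < Λ := by linarith
    have hq : 0 ≤ |y| / Λ ^ 2 := by positivity
    have hr : 0 ≤ 1 / Λ := by positivity
    rw [abs_mul, abs_mul, abs_pow, abs_pow, abs_div, abs_of_pos (by positivity : 0 < Λ ^ 2),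
      abs_of_nonneg hr, abs_of_pos (Real.exp_pos _)]
    refine mul_le_mul_of_nonneg_right ?_ (Real.exp_pos _).le
    have h1 : (|y| / Λ ^ 2) ^ i * (1 / Λ) ^ j ≤ (|y| / Λ ^ 2 + 1 / Λ) ^ (i + j) := by
      rw [pow_add]
      gcongr <;> linarith
    refine h1.trans ?_
    have h2 : 0 ≤ (|y| / Λ ^ 2 + 1 / Λ) ^ (i + j) := by positivity
    have h3 : 0 ≤ i.factorial * Real.exp (δ + 1 / 2) := by positivity
    nlinarith
  · have hΛ0 : 0 < Λ := by linarith
    set q := |y| / Λ ^ 2 with hq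
    have hyq : |y| = q * Λ ^ 2 := by rw [hq]; field_simp
    have hq0 : 0 ≤ q := by positivity
    have hr : 0 ≤ 1 / Λ := by positivity
    have hqδ : δ < q := by
      rw [hq, lt_div_iff₀ (by positivity)]; exact hy
    rw [abs_mul, abs_mul, abs_pow, abs_pow, abs_div, abs_of_pos (by positivity : 0 < Λ ^ 2),
      abs_of_nonneg hr, abs_of_pos (Real.exp_pos _), ← hq]
    have h1 : (1 / Λ) ^ j ≤ 1 := pow_le_one₀ hr (by rw [div_le_one hΛ0]; exact hΛ)
    have h2 : q ^ i ≤ i.factorial * Real.exp (δ + 1 / 2) * Real.exp ((q - δ) ^ 2 * Λ ^ 2 / 2) := by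
      have h3 := Real.pow_div_factorial_le_exp q hq0 i
      rw [div_le_iff₀ (by positivity)] at h3
      have h4 : Real.exp q ≤ Real.exp (δ + 1 / 2) * Real.exp ((q - δ) ^ 2 * Λ ^ 2 / 2) := by
        rw [← Real.exp_add, Real.exp_le_exp]
        have h5 : (q - δ) ^ 2 * 1 ≤ (q - δ) ^ 2 * Λ ^ 2 := by gcongr; nlinarith
        nlinarith [sq_nonneg (q - δ - 1)]
      have h6 : (0 : ℝ) ≤ i.factorial := by positivity
      linarith [mul_le_mul_of_nonneg_left h4 h6]
    have h7 : Real.exp ((q - δ) ^ 2 * Λ ^ 2 / 2) * Real.exp (-y ^ 2 / (2 * Λ ^ 2))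
        = Real.exp (-δ * |y| + δ ^ 2 * Λ ^ 2 / 2) := by
      rw [← Real.exp_add]
      congr 1
      rw [← sq_abs y, hyq]
      field_simp
      ring
    calc q ^ i * (1 / Λ) ^ j * Real.exp (-y ^ 2 / (2 * Λ ^ 2))
        ≤ (i.factorial * Real.exp (δ + 1 / 2) * Real.exp ((q - δ) ^ 2 * Λ ^ 2 / 2)) * 1
          * Real.exp (-y ^ 2 / (2 * Λ ^ 2)) := by gcongr
      _ = (i.factorial * Real.exp (δ + 1 / 2)) * Real.exp (-δ * |y| + δ ^ 2 * Λ ^ 2 / 2) := by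
          rw [← h7]; ring
      _ ≤ _ := by
          refine mul_le_mul_of_nonneg_right ?_ (Real.exp_pos _).le
          linarith

end RelOrder

/-- The density `h` smoothed by an unnormalized Gaussian, centered at `L`. -/
def smoothed (h : ℝ → ℝ) (L Λ y : ℝ) : ℝ :=
  ∫ z, h z * Real.exp (-(y - (z - L)) ^ 2 / (2 * Λ ^ 2))

/-- The Gaussian of variance `v + Λ²`, normalized relative to the one of variance `Λ²`. -/
def widened (v Λ y : ℝ) : ℝ :=
  1 / Real.sqrt (1 + v * (1 / Λ) ^ 2) * Real.exp (-y ^ 2 / (2 * (v + Λ ^ 2)))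

/-- The moments of `h` around `L`. -/
def moment (h : ℝ → ℝ) (L : ℝ) (k : ℕ) : ℝ := ∫ z, h z * (z - L) ^ k

/-- `h` is a nonnegative density with exponential moments of order `2 δ`. -/
structure ExpDecay (δ : ℝ) (h : ℝ → ℝ) : Prop where
  pos : 0 < δ
  nonneg : ∀ z, 0 ≤ h z
  cont : Continuous h
  integrable : Integrable fun z => h z * Real.exp (2 * δ * |z|)

namespace ExpDecay

variable {δ : ℝ} {h : ℝ → ℝ}

theorem integrable_shift (H : ExpDecay δ h) (L : ℝ) :
    Integrable fun z => h z * Real.exp (2 * δ * |z - L|) := by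
  have hδ := H.pos
  refine (H.integrable.mul_const (Real.exp (2 * δ * |L|))).mono'
    (H.cont.mul (by fun_prop)).aestronglyMeasurable (ae_of_all _ fun z => ?_)
  rw [Real.norm_eq_abs, abs_mul, abs_of_nonneg (H.nonneg z), abs_of_pos (Real.exp_pos _),
    mul_assoc (h z), ← Real.exp_add]
  refine mul_le_mul_of_nonneg_left (Real.exp_le_exp.mpr ?_) (H.nonneg z)
  nlinarith [abs_sub z L]

theorem integrable_of_le (H : ExpDecay δ h) (L C : ℝ) {f : ℝ → ℝ} (hf : Continuous f)
    (hle : ∀ z, |f z| ≤ C * Real.exp (2 * δ * |z - L|)) : Integrable fun z => h z * f z := by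
  refine ((H.integrable_shift L).const_mul C).mono' (H.cont.mul hf).aestronglyMeasurable
    (ae_of_all _ fun z => ?_)
  rw [Real.norm_eq_abs, abs_mul, abs_of_nonneg (H.nonneg z)]
  calc h z * |f z| ≤ h z * _ := mul_le_mul_of_nonneg_left (hle z) (H.nonneg z)
    _ = _ := by ring

theorem integrable_moment (H : ExpDecay δ h) (L : ℝ) (k : ℕ) :
    Integrable fun z => h z * (z - L) ^ k := by
  have hδ := H.pos
  obtain ⟨C, hC, hk⟩ := one_add_pow_le_exp (by linarith : 0 < 2 * δ) k
  refine H.integrable_of_le L C (by fun_prop) fun z => ?_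
  rw [abs_pow]
  refine le_trans ?_ (hk _ (abs_nonneg (z - L)))
  gcongr
  linarith

/-- Expanding the square separates the common Gaussian factor and leaves an integrand that depends
on `y` and `Λ` only through `y / Λ²` and `1 / Λ`. -/
theorem smoothed_eq {h : ℝ → ℝ} (L : ℝ) {Λ : ℝ} (hΛ : 0 < Λ) (y : ℝ) :
    smoothed h L Λ y = Real.exp (-y ^ 2 / (2 * Λ ^ 2)) *
      ∫ z, h z * Real.exp (y / Λ ^ 2 * (z - L) - (z - L) ^ 2 * (1 / Λ) ^ 2 / 2) := by
  rw [smoothed, ← integral_const_mul]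
  congr 1
  funext z
  rw [mul_left_comm, ← Real.exp_add]
  congr 2
  field_simp
  ring

theorem integrable_smoothed (H : ExpDecay δ h) (L Λ y : ℝ) :
    Integrable fun z => h z * Real.exp (-(y - (z - L)) ^ 2 / (2 * Λ ^ 2)) := by
  refine H.integrable_of_le L 1 (by fun_prop) fun z => ?_
  rw [abs_of_pos (Real.exp_pos _), one_mul]
  have h1 : -(y - (z - L)) ^ 2 / (2 * Λ ^ 2) ≤ 0 :=
    div_nonpos_of_nonpos_of_nonneg (by nlinarith [sq_nonneg (y - (z - L))]) (by positivity)
  have h2 : 0 ≤ 2 * δ * |z - L| := by have := H.pos; positivity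
  exact Real.exp_le_exp.mpr (by linarith)

theorem smoothed_nonneg (H : ExpDecay δ h) (L Λ y : ℝ) : 0 ≤ smoothed h L Λ y :=
  integral_nonneg fun z => mul_nonneg (H.nonneg z) (Real.exp_pos _).le

/-- The parabola `-s² / (2 Λ²)` lies below its tangent `-κ s + κ² Λ² / 2`; the leftover `exp (κ (z -
L))` is integrable against `h`. Both signs of `κ` are needed, one for each tail in `y`. -/
theorem smoothed_le (H : ExpDecay δ h) (L κ : ℝ) (hκ : |κ| ≤ δ) {Λ : ℝ} (hΛ : 0 < Λ) (y : ℝ) :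
    smoothed h L Λ y ≤ (∫ z, h z * Real.exp (2 * δ * |z - L|)) *
      Real.exp (-κ * y + κ ^ 2 * Λ ^ 2 / 2) := by
  rw [smoothed, ← integral_mul_const]
  refine integral_mono (H.integrable_smoothed L Λ y) ((H.integrable_shift L).mul_const _)
    fun z => ?_
  simp only
  rw [mul_assoc, ← Real.exp_add]
  refine mul_le_mul_of_nonneg_left (Real.exp_le_exp.mpr ?_) (H.nonneg z)
  have h1 : -(y - (z - L)) ^ 2 / (2 * Λ ^ 2) ≤ -κ * (y - (z - L)) + κ ^ 2 * Λ ^ 2 / 2 := by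
    rw [div_le_iff₀ (by positivity)]
    nlinarith [sq_nonneg ((y - (z - L)) - κ * Λ ^ 2)]
  have h2 : κ * (z - L) ≤ δ * |z - L| := by
    calc κ * (z - L) ≤ |κ * (z - L)| := le_abs_self _
      _ = |κ| * |z - L| := abs_mul _ _
      _ ≤ _ := by gcongr
  have h3 : 0 ≤ δ * |z - L| := by have := H.pos; positivity
  linarith

/-- The exponential moments of order `2 δ` are split in half: one `exp (δ |z - L|)` pays for `|θ| ≤
δ`, the other for the polynomial of degree six in the Taylor error. In the tail no cancellation is
used, and the smoothed density and its polynomial approximation are bounded separately. -/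
theorem relOrder_smoothed (H : ExpDecay δ h) (L : ℝ) :
    RelOrder δ 3 fun Λ y => smoothed h L Λ y -
      Real.exp (-y ^ 2 / (2 * Λ ^ 2)) * (moment h L 0 + y / Λ ^ 2 * moment h L 1
        + ((y / Λ ^ 2) ^ 2 - (1 / Λ) ^ 2) / 2 * moment h L 2) := by
  have hδ := H.pos
  obtain ⟨C, hC, hCexp⟩ := one_add_pow_le_exp hδ 6
  set I := ∫ z, h z * Real.exp (2 * δ * |z - L|) with hI
  have hI0 : 0 ≤ I := integral_nonneg fun z => mul_nonneg (H.nonneg z) (Real.exp_pos _).le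
  have hnear : ∀ Λ : ℝ, 1 ≤ Λ → ∀ y : ℝ, |y| ≤ δ * Λ ^ 2 →
      |smoothed h L Λ y - Real.exp (-y ^ 2 / (2 * Λ ^ 2)) * (moment h L 0 + y / Λ ^ 2 * moment h L 1
        + ((y / Λ ^ 2) ^ 2 - (1 / Λ) ^ 2) / 2 * moment h L 2)|
      ≤ 5 * C * I * (|y| / Λ ^ 2 + 1 / Λ) ^ 3 * Real.exp (-y ^ 2 / (2 * Λ ^ 2)) := by
    intro Λ hΛ y hy
    have hΛ0 : 0 < Λ := by linarith
    set θ := y / Λ ^ 2 with hθ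
    set τ := 1 / Λ with hτ
    have hθa : |y| / Λ ^ 2 = |θ| := by
      rw [hθ, abs_div, abs_of_pos (by positivity : 0 < Λ ^ 2)]
    have hθδ : |θ| ≤ δ := by rw [← hθa, div_le_iff₀ (by positivity)]; exact hy
    have hτ0 : 0 ≤ τ := by positivity
    have hτ1 : τ ≤ 1 := by rw [hτ, div_le_one hΛ0]; exact hΛ
    have hpt : ∀ z, |Real.exp (θ * (z - L) - (z - L) ^ 2 * τ ^ 2 / 2)
        - (1 + θ * (z - L) + (θ ^ 2 - τ ^ 2) / 2 * (z - L) ^ 2)|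
        ≤ 5 * C * (|θ| + τ) ^ 3 * Real.exp (2 * δ * |z - L|) := by
      intro z
      refine (abs_exp_quadratic_sub_le hθδ hτ0 hτ1 (z - L)).trans ?_
      have h1 := hCexp _ (abs_nonneg (z - L))
      calc 5 * (|θ| + τ) ^ 3 * (1 + |z - L|) ^ 6 * Real.exp (δ * |z - L|)
          ≤ 5 * (|θ| + τ) ^ 3 * (C * Real.exp (δ * |z - L|)) * Real.exp (δ * |z - L|) := by gcongr
        _ = 5 * C * (|θ| + τ) ^ 3 * (Real.exp (δ * |z - L|) * Real.exp (δ * |z - L|)) := by ring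
        _ = _ := by rw [← Real.exp_add]; ring_nf
    have hint := H.integrable_of_le L _ (by fun_prop) hpt
    have i0 := H.integrable_moment L 0
    have i1 := H.integrable_moment L 1
    have i2 := H.integrable_moment L 2
    have hpoly : Integrable fun z => h z *
        (1 + θ * (z - L) + (θ ^ 2 - τ ^ 2) / 2 * (z - L) ^ 2) := by
      refine ((i0.add (i1.const_mul θ)).add (i2.const_mul ((θ ^ 2 - τ ^ 2) / 2))).congr
        (ae_of_all _ fun z => ?_)
      simp only [Pi.add_apply]
      ring
    have hpolyint : ∫ z, h z * (1 + θ * (z - L) + (θ ^ 2 - τ ^ 2) / 2 * (z - L) ^ 2)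
        = moment h L 0 + θ * moment h L 1 + (θ ^ 2 - τ ^ 2) / 2 * moment h L 2 := by
      rw [moment, moment, moment, ← integral_const_mul, ← integral_const_mul,
        ← integral_add i0 (i1.const_mul θ)]
      refine Eq.trans ?_ (integral_add (i0.add (i1.const_mul θ))
          (i2.const_mul ((θ ^ 2 - τ ^ 2) / 2)))
      congr 1
      funext z
      ring
    have hexp : Integrable fun z => h z * Real.exp (θ * (z - L) - (z - L) ^ 2 * τ ^ 2 / 2) := by
      refine (hint.add hpoly).congr (ae_of_all _ fun z => ?_)
      simp only [Pi.add_apply]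
      ring
    rw [smoothed_eq L hΛ0, ← hθ, ← hτ, ← hpolyint, ← mul_sub, ← integral_sub hexp hpoly, abs_mul,
      abs_of_pos (Real.exp_pos _), mul_comm, hθa]
    refine mul_le_mul_of_nonneg_right ?_ (Real.exp_pos _).le
    calc |∫ z, (h z * Real.exp (θ * (z - L) - (z - L) ^ 2 * τ ^ 2 / 2) -
          h z * (1 + θ * (z - L) + (θ ^ 2 - τ ^ 2) / 2 * (z - L) ^ 2))|
        ≤ ∫ z, 5 * C * (|θ| + τ) ^ 3 * (h z * Real.exp (2 * δ * |z - L|)) := by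
          rw [← Real.norm_eq_abs]
          refine (norm_integral_le_of_norm_le ((H.integrable_shift L).const_mul _)
            (ae_of_all _ fun z => ?_))
          rw [← mul_sub, Real.norm_eq_abs, abs_mul, abs_of_nonneg (H.nonneg z)]
          calc _ ≤ h z * _ := mul_le_mul_of_nonneg_left (hpt z) (H.nonneg z)
            _ = _ := by ring
      _ = _ := by rw [integral_const_mul]; ring
  have hpol : RelOrder δ 0 fun Λ y => Real.exp (-y ^ 2 / (2 * Λ ^ 2)) *
      (moment h L 0 + y / Λ ^ 2 * moment h L 1
        + ((y / Λ ^ 2) ^ 2 - (1 / Λ) ^ 2) / 2 * moment h L 2) := by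
    have m0 := (RelOrder.monomial hδ 0 0).const_mul (moment h L 0)
    have m1 := ((RelOrder.monomial hδ 1 0).of_succ).const_mul (moment h L 1)
    have m2 := ((RelOrder.monomial hδ 2 0).of_succ.of_succ).const_mul (moment h L 2 / 2)
    have m3 := ((RelOrder.monomial hδ 0 2).of_succ.of_succ).const_mul (-moment h L 2 / 2)
    convert ((m0.add m1).add m2).add m3 using 3
    ring
  obtain ⟨D, hD, hpol⟩ := hpol
  refine ⟨5 * C * I + (I + D), by positivity, fun Λ hΛ y => ⟨fun hy => ?_, fun hy => ?_⟩⟩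
  · have hΛ0 : 0 < Λ := by linarith
    refine (hnear Λ hΛ y hy).trans ?_
    gcongr
    linarith
  · have hΛ0 : 0 < Λ := by linarith
    refine (abs_sub _ _).trans ?_
    rw [abs_of_nonneg (H.smoothed_nonneg L Λ y)]
    have h1 := (hpol Λ hΛ y).2 hy
    have h2 : smoothed h L Λ y ≤ I * Real.exp (-δ * |y| + δ ^ 2 * Λ ^ 2 / 2) := by
      rcases le_total 0 y with hy0 | hy0
      · rw [abs_of_nonneg hy0]
        exact H.smoothed_le L δ (abs_of_pos hδ).le hΛ0 y
      · have := H.smoothed_le L (-δ) (by rw [abs_neg, abs_of_pos hδ]) hΛ0 y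
        rw [abs_of_nonpos hy0]
        convert this using 3
        ring
    have h3 : 0 ≤ 5 * C * I * Real.exp (-δ * |y| + δ ^ 2 * Λ ^ 2 / 2) := by positivity
    linarith

end ExpDecay

/-- In terms of `s = √(1 + t)` both sides contain the factor `(s - 1)²`, and the remaining factors
compare directly. -/
theorem abs_one_div_sqrt_sub_le {t : ℝ} (ht : 0 ≤ t) :
    |1 / Real.sqrt (1 + t) - 1 + t / 2| ≤ t ^ 2 := by
  set s := Real.sqrt (1 + t) with hs
  have hs1 : 1 ≤ s := by rw [hs]; exact Real.one_le_sqrt.mpr (by linarith)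
  have hs2 : s ^ 2 = 1 + t := Real.sq_sqrt (by linarith)
  have ht' : t = s ^ 2 - 1 := by linarith
  have hs0 : 0 < s := by linarith
  have key : 1 / s - 1 + t / 2 = (s - 1) ^ 2 * (s + 2) / (2 * s) := by
    rw [ht']; field_simp; ring
  rw [key, abs_of_nonneg (by positivity), div_le_iff₀ (by positivity), ht']
  have : (s ^ 2 - 1) ^ 2 = (s - 1) ^ 2 * (s + 1) ^ 2 := by ring
  rw [this, mul_assoc]
  refine mul_le_mul_of_nonneg_left ?_ (sq_nonneg _)
  nlinarith [mul_nonneg hs0.le hs0.le]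

/-- The constant in the expansion of the widened Gaussian. -/
def widenedConst (δ v : ℝ) : ℝ :=
  (v ^ 2 * Real.exp (v * δ ^ 2 / 2) + 3 * v ^ 2) * (δ + 1)

/-- The prefactor contributes `-v τ² / 2` and the change of the exponent `v θ² / 2`. All errors have
order four; one of the four powers is traded for the bound `|θ| + τ ≤ δ + 1`. -/
theorem abs_widened_factor_sub_le {δ v θ τ : ℝ} (hv : 0 ≤ v) (hθδ : |θ| ≤ δ) (hτ0 : 0 ≤ τ)
    (hτ1 : τ ≤ 1) :
    |1 / Real.sqrt (1 + v * τ ^ 2) * Real.exp (θ ^ 2 * v / (2 * (1 + v * τ ^ 2)))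
      - (1 + (θ ^ 2 - τ ^ 2) / 2 * v)| ≤ widenedConst δ v * (|θ| + τ) ^ 3 := by
  set W := v * δ ^ 2 / 2 with hW
  have hW0 : 0 ≤ W := by positivity
  set T := v * τ ^ 2 with hT
  have hT0 : 0 ≤ T := by positivity
  set w := θ ^ 2 * v / (2 * (1 + T)) with hw
  have hw0 : 0 ≤ w := by positivity
  have hwle : w ≤ θ ^ 2 * v / 2 := by
    rw [hw]
    gcongr
    linarith
  have hθ2 : θ ^ 2 ≤ δ ^ 2 := by rw [← sq_abs θ]; gcongr
  have hwW : w ≤ W := hwle.trans (by rw [hW]; nlinarith)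
  set a := 1 / Real.sqrt (1 + T) with ha
  have ha0 : 0 ≤ a := by positivity
  have ha1 : a ≤ 1 := by
    rw [ha, div_le_one (by positivity)]
    exact Real.one_le_sqrt.mpr (by linarith)
  have haT := abs_one_div_sqrt_sub_le hT0
  rw [← ha] at haT
  have hB : |Real.exp w - 1 - w| ≤ w ^ 2 * Real.exp W := by
    have h1 : |Real.exp w - 1 - w| ≤ |w| ^ 2 * Real.exp |w| := by
      have h := Complex.norm_exp_sub_sum_le_norm_mul_exp (w : ℂ) 2
      simp only [Finset.sum_range_succ, Finset.sum_range_zero] at h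
      norm_num at h
      rw [← Complex.ofReal_exp] at h
      have h2 : (Real.exp w : ℂ) - (1 + (w : ℂ)) = ((Real.exp w - 1 - w : ℝ) : ℂ) := by
        push_cast
        ring
      rw [h2, Complex.norm_real, Real.norm_eq_abs] at h
      simpa using h
    rw [abs_of_nonneg hw0] at h1
    exact h1.trans (by gcongr)
  have hwd : |w - θ ^ 2 * v / 2| ≤ θ ^ 2 * v / 2 * T := by
    rw [abs_sub_comm, abs_of_nonneg (by linarith), hw, sub_le_iff_le_add,
      ← sub_le_iff_le_add', le_div_iff₀ (by positivity)]
    nlinarith [mul_nonneg (mul_nonneg (sq_nonneg θ) hv) (sq_nonneg T)]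
  have ham : |a - 1| ≤ T := by
    rw [abs_sub_comm, abs_of_nonneg (by linarith)]
    have h1 : 1 / (1 + T) ≤ a := by
      rw [ha]
      refine one_div_le_one_div_of_le (Real.sqrt_pos.mpr (by linarith)) ?_
      refine (Real.sqrt_le_sqrt (by nlinarith : 1 + T ≤ (1 + T) ^ 2)).trans ?_
      rw [Real.sqrt_sq (by linarith)]
    have h2 : 1 - T ≤ 1 / (1 + T) := by
      rw [le_div_iff₀ (by linarith)]; nlinarith
    linarith
  have hsplit : a * Real.exp w - (1 + (θ ^ 2 - τ ^ 2) / 2 * v)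
      = a * (Real.exp w - 1 - w) + (a - 1) * w + (a - 1 + T / 2) + (w - θ ^ 2 * v / 2) := by
    rw [hT]; ring
  set s := |θ| + τ with hs
  have hs0 : 0 ≤ s := by positivity
  have hθs : θ ^ 2 ≤ s ^ 2 := by
    rw [← sq_abs θ]; gcongr; rw [hs]; linarith
  have hτs : τ ^ 2 ≤ s ^ 2 := by gcongr; rw [hs]; linarith [abs_nonneg θ]
  have hws : w ≤ v * s ^ 2 := hwle.trans (by nlinarith [mul_nonneg hv (sq_nonneg s)])
  have hTs : T ≤ v * s ^ 2 := by rw [hT]; gcongr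
  rw [hsplit]
  rw [widenedConst, ← hW]
  have n1 : |a * (Real.exp w - 1 - w)| ≤ v ^ 2 * Real.exp W * s ^ 4 := by
    rw [abs_mul, abs_of_nonneg ha0]
    calc a * |Real.exp w - 1 - w| ≤ 1 * ((v * s ^ 2) ^ 2 * Real.exp W) := by
          refine mul_le_mul ha1 (hB.trans ?_) (abs_nonneg _) zero_le_one
          gcongr
      _ = _ := by ring
  have n2 : |(a - 1) * w| ≤ v ^ 2 * s ^ 4 := by
    rw [abs_mul, abs_of_nonneg hw0]
    calc |a - 1| * w ≤ (v * s ^ 2) * (v * s ^ 2) :=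
          mul_le_mul (ham.trans hTs) hws hw0 (by positivity)
      _ = _ := by ring
  have n3 : |a - 1 + T / 2| ≤ v ^ 2 * s ^ 4 := by
    refine haT.trans ?_
    calc T ^ 2 ≤ (v * s ^ 2) ^ 2 := by gcongr
      _ = _ := by ring
  have n4 : |w - θ ^ 2 * v / 2| ≤ v ^ 2 * s ^ 4 := by
    refine hwd.trans ?_
    calc θ ^ 2 * v / 2 * T ≤ (v * s ^ 2) * (v * s ^ 2) := by
          refine mul_le_mul ?_ hTs hT0 (by positivity)
          nlinarith [mul_nonneg hv (sq_nonneg s), mul_le_mul_of_nonneg_right hθs hv]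
      _ = _ := by ring
  have n5 : s ^ 4 ≤ (δ + 1) * s ^ 3 := by
    have : s ≤ δ + 1 := by rw [hs]; linarith
    calc s ^ 4 = s * s ^ 3 := by ring
      _ ≤ _ := by gcongr
  calc _ ≤ |a * (Real.exp w - 1 - w)| + |(a - 1) * w| + |a - 1 + T / 2|
        + |w - θ ^ 2 * v / 2| := by
          refine (abs_add_le _ _).trans (add_le_add_left ?_ _)
          refine (abs_add_le _ _).trans (add_le_add_left ?_ _)
          exact abs_add_le _ _
    _ ≤ (v ^ 2 * Real.exp W + 3 * v ^ 2) * s ^ 4 := by linarith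
    _ ≤ (v ^ 2 * Real.exp W + 3 * v ^ 2) * ((δ + 1) * s ^ 3) := by gcongr
    _ = _ := by ring

theorem relOrder_widened {δ : ℝ} (hδ : 0 < δ) {v : ℝ} (hv : 0 ≤ v) :
    RelOrder δ 3 fun Λ y => widened v Λ y -
      Real.exp (-y ^ 2 / (2 * Λ ^ 2)) * (1 + ((y / Λ ^ 2) ^ 2 - (1 / Λ) ^ 2) / 2 * v) := by
  have hpol : RelOrder δ 0 fun Λ y => Real.exp (-y ^ 2 / (2 * Λ ^ 2)) *
      (1 + ((y / Λ ^ 2) ^ 2 - (1 / Λ) ^ 2) / 2 * v) := by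
    have m0 := RelOrder.monomial hδ 0 0
    have m2 := ((RelOrder.monomial hδ 2 0).of_succ.of_succ).const_mul (v / 2)
    have m3 := ((RelOrder.monomial hδ 0 2).of_succ.of_succ).const_mul (-v / 2)
    convert (m0.add m2).add m3 using 3
    ring
  obtain ⟨D, hD, hpol⟩ := hpol
  set W := v * δ ^ 2 / 2 with hW
  have hW0 : 0 ≤ W := by positivity
  set K := widenedConst δ v with hK
  have hK0 : 0 ≤ K := by rw [hK, widenedConst]; positivity
  refine ⟨K + (Real.exp W + D), by positivity, fun Λ hΛ y => ⟨fun hy => ?_, fun hy => ?_⟩⟩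
  · have hΛ0 : 0 < Λ := by linarith
    set θ := y / Λ ^ 2 with hθ
    set τ := 1 / Λ with hτ
    have hθa : |y| / Λ ^ 2 = |θ| := by
      rw [hθ, abs_div, abs_of_pos (by positivity : 0 < Λ ^ 2)]
    have hθδ : |θ| ≤ δ := by rw [← hθa, div_le_iff₀ (by positivity)]; exact hy
    have hτ0 : 0 ≤ τ := by positivity
    have hτ1 : τ ≤ 1 := by rw [hτ, div_le_one hΛ0]; exact hΛ
    have heq : Real.exp (-y ^ 2 / (2 * (v + Λ ^ 2)))
        = Real.exp (-y ^ 2 / (2 * Λ ^ 2)) * Real.exp (θ ^ 2 * v / (2 * (1 + v * τ ^ 2))) := by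
      rw [← Real.exp_add]
      congr 1
      rw [hθ, hτ]
      field_simp
      ring
    have hfin := abs_widened_factor_sub_le hv hθδ hτ0 hτ1
    beta_reduce
    rw [hθa, widened, heq, ← hτ, mul_left_comm, ← mul_sub, abs_mul,
      abs_of_pos (Real.exp_pos _), mul_comm]
    refine mul_le_mul_of_nonneg_right (hfin.trans ?_) (Real.exp_pos _).le
    gcongr
    have := Real.exp_pos W
    linarith
  · have hΛ0 : 0 < Λ := by linarith
    refine (abs_sub _ _).trans ?_
    have h1 := (hpol Λ hΛ y).2 hy
    have h2 : |widened v Λ y| ≤ Real.exp W * Real.exp (-δ * |y| + δ ^ 2 * Λ ^ 2 / 2) := by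
      rw [widened, abs_of_nonneg (by positivity)]
      have h3 : 1 / Real.sqrt (1 + v * (1 / Λ) ^ 2) ≤ 1 := by
        rw [div_le_one (by positivity)]
        exact Real.one_le_sqrt.mpr (by nlinarith [mul_nonneg hv (sq_nonneg (1 / Λ))])
      have h4 := RelOrder.exp_gaussian_le (by positivity : 0 < v + Λ ^ 2) δ y
      have h5 : Real.exp (-δ * |y| + δ ^ 2 * (v + Λ ^ 2) / 2)
          = Real.exp W * Real.exp (-δ * |y| + δ ^ 2 * Λ ^ 2 / 2) := by
        rw [← Real.exp_add, hW]; congr 1; ring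
      rw [← h5]
      calc _ ≤ 1 * Real.exp (-δ * |y| + δ ^ 2 * (v + Λ ^ 2) / 2) := by gcongr
        _ = _ := one_mul _
    have h6 : 0 ≤ K * Real.exp (-δ * |y| + δ ^ 2 * Λ ^ 2 / 2) := by positivity
    linarith

namespace ExpDecay

variable {δ : ℝ} {h : ℝ → ℝ}

/-- The deviation of the smoothed density from the Gaussian of variance `v + Λ²`. -/
def deviation (h : ℝ → ℝ) (L v Λ y : ℝ) : ℝ :=
  smoothed h L Λ y - moment h L 0 * widened v Λ y

/-- The zeroth moments cancel. What is subtracted here is the leading term that decides both the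
guaranteed rate, when its coefficients vanish, and the failure of a better one, when they do not. -/
theorem relOrder_deviation (H : ExpDecay δ h) (L : ℝ) {v : ℝ} (hv : 0 ≤ v) :
    RelOrder δ 3 fun Λ y => deviation h L v Λ y -
      Real.exp (-y ^ 2 / (2 * Λ ^ 2)) * (y / Λ ^ 2 * moment h L 1
        + ((y / Λ ^ 2) ^ 2 - (1 / Λ) ^ 2) / 2 * (moment h L 2 - v * moment h L 0)) := by
  convert (H.relOrder_smoothed L).sub ((relOrder_widened H.pos hv).const_mul (moment h L 0))
    using 3
  rw [deviation]
  ring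

theorem relOrder_deviation_two (H : ExpDecay δ h) (L : ℝ) {v : ℝ} (hv : 0 ≤ v) :
    RelOrder δ 2 fun Λ y => deviation h L v Λ y -
      Real.exp (-y ^ 2 / (2 * Λ ^ 2)) * (y / Λ ^ 2 * moment h L 1) := by
  have m1 := (RelOrder.monomial H.pos 2 0).const_mul ((moment h L 2 - v * moment h L 0) / 2)
  have m2 := (RelOrder.monomial H.pos 0 2).const_mul (-(moment h L 2 - v * moment h L 0) / 2)
  convert ((H.relOrder_deviation L hv).of_succ.add m1).add m2 using 3
  ring

theorem relOrder_deviation_one (H : ExpDecay δ h) (L : ℝ) {v : ℝ} (hv : 0 ≤ v) :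
    RelOrder δ 1 (deviation h L v) := by
  have m1 := (RelOrder.monomial H.pos 1 0).const_mul (moment h L 1)
  convert (H.relOrder_deviation_two L hv).of_succ.add m1 using 3
  ring

end ExpDecay

end Pointwise

/-! ### Weighted sums over the energy levels -/

section WeightedSums

universe v

variable {ι : Type v} {w x : ι → ℝ}

/-- The canonical mean of the levels `x` with weights `w`. -/
def canonMean (w x : ι → ℝ) (β : ℝ) : ℝ :=
  (∑' i, w i * (Real.exp (-β * x i) * x i)) / ∑' i, w i * Real.exp (-β * x i)

/-- The canonical variance of the levels `x` with weights `w`. -/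
def canonVar (w x : ι → ℝ) (β : ℝ) : ℝ :=
  (∑' i, w i * (Real.exp (-β * x i) * (x i - canonMean w x β) ^ 2)) /
    ∑' i, w i * Real.exp (-β * x i)

/-- The unnormalized Gaussian sum of variance `Λ²` around `L`. -/
def gaussSum (w x : ι → ℝ) (L Λ : ℝ) : ℝ :=
  ∑' i, w i * Real.exp (-(x i - L) ^ 2 / (2 * Λ ^ 2))

theorem exp_add_abs_le (x : ℝ) {α β γ η : ℝ} (h1 : η ≤ β - α) (h2 : η ≤ γ - β) :
    Real.exp (-β * x + η * |x|) ≤ Real.exp (-α * x) + Real.exp (-γ * x) := by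
  rcases le_total 0 x with hx | hx
  · rw [abs_of_nonneg hx]
    have : Real.exp (-β * x + η * x) ≤ Real.exp (-α * x) := Real.exp_le_exp.mpr (by nlinarith)
    linarith [Real.exp_pos (-γ * x)]
  · rw [abs_of_nonpos hx]
    have : Real.exp (-β * x + η * -x) ≤ Real.exp (-γ * x) := Real.exp_le_exp.mpr (by nlinarith)
    linarith [Real.exp_pos (-α * x)]

theorem summable_of_abs_le_exp (hw : ∀ i, 0 ≤ w i) {α γ : ℝ}
    (hα : Summable fun i => w i * Real.exp (-α * x i))
    (hγ : Summable fun i => w i * Real.exp (-γ * x i)) (C : ℝ) {f : ι → ℝ}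
    (hf : ∀ i, |f i| ≤ C * (Real.exp (-α * x i) + Real.exp (-γ * x i))) :
    Summable fun i => w i * f i := by
  refine Summable.of_norm_bounded ((hα.add hγ).mul_left C) fun i => ?_
  rw [Real.norm_eq_abs, abs_mul, abs_of_nonneg (hw i)]
  calc w i * |f i| ≤ w i * _ := mul_le_mul_of_nonneg_left (hf i) (hw i)
    _ = _ := by ring

theorem exists_abs_pow_mul_exp_le {α β γ : ℝ} (h1 : α < β) (h2 : β < γ) (k : ℕ) (M : ℝ) :
    ∃ C : ℝ, ∀ x : ℝ, (|x| + |M|) ^ k * Real.exp (-β * x)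
      ≤ C * (Real.exp (-α * x) + Real.exp (-γ * x)) := by
  set η := min (β - α) (γ - β) with hη
  have hη0 : 0 < η := lt_min (by linarith) (by linarith)
  obtain ⟨C, hC, h⟩ := one_add_pow_le_exp hη0 k
  refine ⟨C * Real.exp (η * |M|), fun x => ?_⟩
  have h3 := h (|x| + |M|) (by positivity)
  have h4 : (|x| + |M|) ^ k ≤ (1 + (|x| + |M|)) ^ k :=
    pow_le_pow_left₀ (by positivity) (by linarith) k
  have h5 := exp_add_abs_le x (min_le_left _ _ : η ≤ β - α) (min_le_right _ _ : η ≤ γ - β)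
  calc (|x| + |M|) ^ k * Real.exp (-β * x)
      ≤ C * Real.exp (η * (|x| + |M|)) * Real.exp (-β * x) := by
        gcongr; exact h4.trans h3
    _ = C * Real.exp (η * |M|) * Real.exp (-β * x + η * |x|) := by
        rw [mul_add, Real.exp_add, Real.exp_add]; ring
    _ ≤ _ := by gcongr

/-- The levels may be unbounded in both directions, so finiteness is needed on both sides of `β`;
the spare exponential decay then pays for the polynomial. -/
theorem summable_abs_pow_mul_exp (hw : ∀ i, 0 ≤ w i) {α β γ : ℝ} (h1 : α < β) (h2 : β < γ)
    (hα : Summable fun i => w i * Real.exp (-α * x i))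
    (hγ : Summable fun i => w i * Real.exp (-γ * x i)) (k : ℕ) (M : ℝ) :
    Summable fun i => w i * ((|x i| + |M|) ^ k * Real.exp (-β * x i)) := by
  obtain ⟨C, h⟩ := exists_abs_pow_mul_exp_le h1 h2 k M
  refine summable_of_abs_le_exp hw hα hγ C fun i => ?_
  rw [abs_of_nonneg (by positivity)]
  exact h _

section Positive

variable (hw : ∀ i, 0 ≤ w i) (hZ : ∀ β : ℝ, 0 < β → Summable fun i => w i * Real.exp (-β * x i))

include hw hZ

theorem summable_abs_pow_mul_exp_of_pos {β : ℝ} (hβ : 0 < β) (k : ℕ) (M : ℝ) :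
    Summable fun i => w i * ((|x i| + |M|) ^ k * Real.exp (-β * x i)) :=
  summable_abs_pow_mul_exp hw (by linarith : β / 2 < β) (by linarith : β < 2 * β)
    (hZ _ (by linarith)) (hZ _ (by linarith)) k M

theorem summable_sub_pow_mul_exp {β : ℝ} (hβ : 0 < β) (k : ℕ) (M : ℝ) :
    Summable fun i => w i * (Real.exp (-β * x i) * (x i - M) ^ k) := by
  refine Summable.of_norm_bounded (summable_abs_pow_mul_exp_of_pos hw hZ hβ k M) fun i => ?_
  rw [Real.norm_eq_abs, abs_mul, abs_of_nonneg (hw i), abs_mul, abs_of_pos (Real.exp_pos _),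
    abs_pow, mul_comm (Real.exp _)]
  refine mul_le_mul_of_nonneg_left ?_ (hw i)
  gcongr
  exact abs_sub _ _

theorem continuousOn_tsum_pow_mul_exp (k : ℕ) :
    ContinuousOn (fun β => ∑' i, w i * (Real.exp (-β * x i) * x i ^ k)) (Set.Ioi 0) := by
  intro β hβ
  have hβ0 : 0 < β := hβ
  have h : ContinuousOn (fun β => ∑' i, w i * (Real.exp (-β * x i) * x i ^ k))
      (Set.Icc (β / 2) (2 * β)) := by
    refine continuousOn_tsum (u := fun i => w i * ((|x i| + |0|) ^ k * Real.exp (-(β / 2) * x i))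
      + w i * ((|x i| + |0|) ^ k * Real.exp (-(2 * β) * x i))) (fun i => by fun_prop)
      ((summable_abs_pow_mul_exp_of_pos hw hZ (by linarith) k 0).add
        (summable_abs_pow_mul_exp_of_pos hw hZ (by linarith) k 0)) fun i b hb => ?_
    rw [Real.norm_eq_abs, abs_mul, abs_of_nonneg (hw i), abs_mul, abs_of_pos (Real.exp_pos _),
      abs_pow, abs_zero, add_zero, ← mul_add, ← mul_add, mul_comm (Real.exp _)]
    refine mul_le_mul_of_nonneg_left ?_ (hw i)
    refine mul_le_mul_of_nonneg_left ?_ (by positivity)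
    have := exp_add_abs_le (x i) (η := 0) (sub_nonneg.mpr hb.1) (sub_nonneg.mpr hb.2)
    simpa using this
  exact ((h β ⟨by linarith, by linarith⟩).continuousAt
    (Icc_mem_nhds (by linarith) (by linarith))).continuousWithinAt

variable (hpos : ∃ i, 0 < w i)

include hpos

theorem partitionFn_pos {β : ℝ} (hβ : 0 < β) : 0 < ∑' i, w i * Real.exp (-β * x i) := by
  obtain ⟨i, hi⟩ := hpos
  exact (hZ β hβ).tsum_pos (fun j => mul_nonneg (hw j) (Real.exp_pos _).le) i
    (mul_pos hi (Real.exp_pos _))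

theorem continuousOn_canonMean : ContinuousOn (canonMean w x) (Set.Ioi 0) := by
  have h0 := continuousOn_tsum_pow_mul_exp hw hZ 0
  have h1 := continuousOn_tsum_pow_mul_exp hw hZ 1
  simp only [pow_zero, mul_one, pow_one] at h0 h1
  exact h1.div h0 fun β hβ => (partitionFn_pos hw hZ hpos hβ).ne'

theorem canonVar_nonneg {β : ℝ} (hβ : 0 < β) : 0 ≤ canonVar w x β :=
  div_nonneg (tsum_nonneg fun i => mul_nonneg (hw i)
    (mul_nonneg (Real.exp_pos _).le (sq_nonneg _))) (partitionFn_pos hw hZ hpos hβ).le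

omit hpos in
/-- The canonical mean has at most one zero, unless all levels vanish. -/
theorem canonVar_eq_zero_or_eventually_canonMean_ne_zero :
    (∀ β, canonVar w x β = 0) ∨ (∀ᶠ β in 𝓝[>] (0 : ℝ), canonMean w x β ≠ 0) := by
  by_cases hall : ∀ i, w i * x i = 0
  · left
    intro β
    have hm : canonMean w x β = 0 := by
      rw [canonMean]
      have : ∀ i, w i * (Real.exp (-β * x i) * x i) = 0 := fun i => by
        rw [mul_left_comm, hall i, mul_zero]
      rw [tsum_congr this, tsum_zero, zero_div]
    rw [canonVar, hm]
    have : ∀ i, w i * (Real.exp (-β * x i) * (x i - 0) ^ 2) = 0 := fun i => by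
      rw [sub_zero, mul_left_comm, sq, ← mul_assoc (w i), hall i, zero_mul, mul_zero]
    rw [tsum_congr this, tsum_zero, zero_div]
  · right
    push Not at hall
    obtain ⟨j, hj⟩ := hall
    have hj1 : w j ≠ 0 := left_ne_zero_of_mul hj
    have hj2 : x j ≠ 0 := right_ne_zero_of_mul hj
    have hwj : 0 < w j := lt_of_le_of_ne (hw j) hj1.symm
    -- Each term `exp (-β x) x` is nonincreasing in `β`, strictly so for `x ≠ 0`; hence the
    -- numerator of the mean cannot vanish twice.
    have key : ∀ β₁ β₂, 0 < β₁ → β₁ < β₂ → canonMean w x β₁ = 0 → canonMean w x β₂ = 0 → False := by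
      intro β₁ β₂ h1 h12 hm1 hm2
      have e1 := (div_eq_zero_iff.mp hm1).resolve_right
        (partitionFn_pos hw hZ ⟨j, hwj⟩ h1).ne'
      have e2 := (div_eq_zero_iff.mp hm2).resolve_right
        (partitionFn_pos hw hZ ⟨j, hwj⟩ (h1.trans h12)).ne'
      have s1 := summable_sub_pow_mul_exp hw hZ h1 1 0
      have s2 := summable_sub_pow_mul_exp hw hZ (h1.trans h12) 1 0
      simp only [sub_zero, pow_one] at s1 s2
      have hs := (s1.sub s2).tsum_pos (fun i => ?_) j ?_
      · rw [s1.tsum_sub s2, e1, e2] at hs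
        simp at hs
      · rw [← mul_sub]
        refine mul_nonneg (hw i) ?_
        rcases le_total 0 (x i) with h | h
        · have : Real.exp (-β₂ * x i) ≤ Real.exp (-β₁ * x i) :=
            Real.exp_le_exp.mpr (by nlinarith)
          nlinarith
        · have : Real.exp (-β₁ * x i) ≤ Real.exp (-β₂ * x i) :=
            Real.exp_le_exp.mpr (by nlinarith)
          nlinarith
      · rw [← mul_sub]
        refine mul_pos hwj ?_
        rcases lt_or_gt_of_ne hj2 with h | h
        · have : Real.exp (-β₁ * x j) < Real.exp (-β₂ * x j) :=
            Real.exp_lt_exp.mpr (by nlinarith)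
          nlinarith
        · have : Real.exp (-β₂ * x j) < Real.exp (-β₁ * x j) :=
            Real.exp_lt_exp.mpr (by nlinarith)
          nlinarith
    by_cases hz : ∃ β₀, 0 < β₀ ∧ canonMean w x β₀ = 0
    · obtain ⟨β₀, h0, hm0⟩ := hz
      filter_upwards [Ioo_mem_nhdsGT h0] with β hβ hm
      exact key β β₀ hβ.1 hβ.2 hm hm0
    · push Not at hz
      filter_upwards [self_mem_nhdsWithin] with β hβ
      exact hz β hβ

/-- The canonical ensemble at the saddle point controls the Gaussian sum. -/
theorem tsum_exp_le_gaussSum {L Λ β : ℝ} (hβ : 0 < β) (hΛ : 0 < Λ)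
    (hm : canonMean w x β - L = β * Λ ^ 2) :
    ∑' i, w i * Real.exp (-β * (x i - L) + β ^ 2 * Λ ^ 2 / 2)
      ≤ Real.exp (canonVar w x β / (2 * Λ ^ 2)) * gaussSum w x L Λ := by
  set m := canonMean w x β with hmdef
  set z₀ := canonVar w x β / (2 * Λ ^ 2) with hz₀
  set Z := ∑' i, w i * Real.exp (-β * x i) with hZdef
  set κ := Real.exp (β * L + β ^ 2 * Λ ^ 2 / 2) with hκ
  have hZpos : 0 < Z := partitionFn_pos hw hZ hpos hβ
  have h1 : ∀ i, w i * Real.exp (-β * (x i - L) + β ^ 2 * Λ ^ 2 / 2)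
      = κ * (w i * Real.exp (-β * x i)) := fun i => by
    rw [hκ, mul_left_comm, ← Real.exp_add]; congr 2; ring
  simp_rw [h1]
  rw [tsum_mul_left, ← hZdef]
  -- The saddle point equation turns the Gaussian about `L` into the canonical weight times a
  -- Gaussian about the canonical mean.
  have h2 : ∀ i, w i * Real.exp (-(x i - L) ^ 2 / (2 * Λ ^ 2))
      = κ * (w i * (Real.exp (-β * x i) * Real.exp (-((x i - m) ^ 2 / (2 * Λ ^ 2))))) := fun i => by
    rw [hκ, mul_left_comm, ← Real.exp_add, ← Real.exp_add]
    congr 2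
    have : m = L + β * Λ ^ 2 := by linarith
    rw [this]
    field_simp
    ring
  have hs2 := summable_sub_pow_mul_exp hw hZ hβ 2 m
  have hs0 := hZ β hβ
  have hsg : Summable fun i =>
      w i * (Real.exp (-β * x i) * Real.exp (-((x i - m) ^ 2 / (2 * Λ ^ 2)))) := by
    refine Summable.of_nonneg_of_le (fun i => mul_nonneg (hw i) (by positivity)) (fun i => ?_) hs0
    refine mul_le_mul_of_nonneg_left ?_ (hw i)
    refine mul_le_of_le_one_right (Real.exp_pos _).le (Real.exp_le_one_iff.mpr ?_)
    rw [neg_nonpos]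
    positivity
  rw [gaussSum]
  simp_rw [h2]
  rw [tsum_mul_left, mul_left_comm]
  refine mul_le_mul_of_nonneg_left ?_ (Real.exp_pos _).le
  -- Jensen's inequality for the exponential in its tangent form: `1 + s ≤ exp s` is averaged for `s
  -- = z₀ - (x i - m)² / (2 Λ²)`, whose canonical mean is zero.
  have h3 : Real.exp (-z₀) * Z ≤
      ∑' i, w i * (Real.exp (-β * x i) * Real.exp (-((x i - m) ^ 2 / (2 * Λ ^ 2)))) := by
    have h4 : Real.exp (-z₀) * Z = ∑' i, Real.exp (-z₀) * ((1 + z₀) * (w i * Real.exp (-β * x i))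
        - 1 / (2 * Λ ^ 2) * (w i * (Real.exp (-β * x i) * (x i - m) ^ 2))) := by
      rw [tsum_mul_left, (hs0.mul_left _).tsum_sub (hs2.mul_left _), tsum_mul_left, tsum_mul_left]
      congr 1
      have h5 : ∑' i, w i * (Real.exp (-β * x i) * (x i - m) ^ 2) = canonVar w x β * Z := by
        rw [canonVar, ← hmdef, ← hZdef]
        field_simp
      rw [h5, ← hZdef, hz₀]
      field_simp
      ring
    rw [h4]
    refine Summable.tsum_le_tsum (fun i => ?_)
      (((hs0.mul_left _).sub (hs2.mul_left _)).mul_left _) hsg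
    have h6 := Real.add_one_le_exp (z₀ - (x i - m) ^ 2 / (2 * Λ ^ 2))
    have h7 : Real.exp (-((x i - m) ^ 2 / (2 * Λ ^ 2)))
        = Real.exp (-z₀) * Real.exp (z₀ - (x i - m) ^ 2 / (2 * Λ ^ 2)) := by
      rw [← Real.exp_add]; congr 1; ring
    rw [h7]
    have h8 : 0 ≤ Real.exp (-z₀) * (w i * Real.exp (-β * x i)) :=
      mul_nonneg (Real.exp_pos _).le (mul_nonneg (hw i) (Real.exp_pos _).le)
    calc _ = Real.exp (-z₀) * (w i * Real.exp (-β * x i)) *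
          (z₀ - (x i - m) ^ 2 / (2 * Λ ^ 2) + 1) := by ring
      _ ≤ Real.exp (-z₀) * (w i * Real.exp (-β * x i)) *
          Real.exp (z₀ - (x i - m) ^ 2 / (2 * Λ ^ 2)) := mul_le_mul_of_nonneg_left h6 h8
      _ = _ := by ring
  calc Z = Real.exp z₀ * (Real.exp (-z₀) * Z) := by
        rw [← mul_assoc, ← Real.exp_add]; simp
    _ ≤ _ := mul_le_mul_of_nonneg_left h3 (Real.exp_pos _).le

end Positive

/-- Pointwise domination of a relatively small remainder by the canonical ensemble. -/
theorem RelOrder.le_canonical {δ : ℝ} (hδ : 0 < δ) {k : ℕ} {R : ℝ → ℝ → ℝ}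
    (hR : RelOrder δ k R) {K : ℝ} (hK : 0 ≤ K) :
    ∃ C : ℝ, 0 ≤ C ∧ ∀ Λ ε β : ℝ, 1 ≤ Λ → 1 / Λ ≤ ε → 0 ≤ β → β ≤ δ / 4 → β ≤ K * ε → ∀ y,
      |R Λ y| ≤ C * ε ^ k * Real.exp (-β * y + β ^ 2 * Λ ^ 2 / 2) := by
  obtain ⟨C, hC, h⟩ := hR
  set C₁ := C * ((K + 1) ^ k * (k.factorial * Real.exp (3 / 2))) with hC₁
  set C₂ := C * (k.factorial * (4 / δ ^ 2) ^ k) with hC₂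
  refine ⟨C₁ + C₂, by positivity, fun Λ ε β hΛ hε hβ hβδ hβK y => ?_⟩
  have hΛ0 : 0 < Λ := by linarith
  have hε0 : 0 < ε := lt_of_lt_of_le (by positivity) hε
  have hE := Real.exp_pos (-β * y + β ^ 2 * Λ ^ 2 / 2)
  rcases le_or_gt |y| (δ * Λ ^ 2) with hy | hy
  -- In the standardized distance `u` from the saddle, the Gaussian is `exp (-u² / 2)` times the
  -- canonical weight, and the relative order is at most a multiple of `ε (1 + |u|)`. The factor
  -- `exp (-u² / 2)` absorbs the powers of `1 + |u|`.
  · set u := (y - β * Λ ^ 2) / Λ with hu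
    have hyu : y = β * Λ ^ 2 + u * Λ := by rw [hu]; field_simp; ring
    have hexp : Real.exp (-y ^ 2 / (2 * Λ ^ 2))
        = Real.exp (-u ^ 2 / 2) * Real.exp (-β * y + β ^ 2 * Λ ^ 2 / 2) := by
      rw [← Real.exp_add]; congr 1; rw [hyu]; field_simp; ring
    have hθ : |y| / Λ ^ 2 + 1 / Λ ≤ (K + 1) * ε * (1 + |u|) := by
      have h1 : |y| ≤ β * Λ ^ 2 + |u| * Λ := by
        rw [hyu]
        refine (abs_add_le _ _).trans (le_of_eq ?_)
        rw [abs_mul, abs_mul, abs_of_pos hΛ0, abs_of_nonneg hβ, abs_of_nonneg (sq_nonneg Λ)]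
      have h2 : |y| / Λ ^ 2 ≤ β + |u| * (1 / Λ) := by
        rw [div_le_iff₀ (by positivity)]
        refine h1.trans (le_of_eq ?_)
        field_simp
      have h3 : |u| * (1 / Λ) ≤ |u| * ε := by gcongr
      have h4 : 0 ≤ K * ε * |u| := by positivity
      linarith
    have hmom : (1 + |u|) ^ k * Real.exp (-u ^ 2 / 2) ≤ k.factorial * Real.exp (3 / 2) := by
      have h1 := Real.pow_div_factorial_le_exp (1 + |u|) (by positivity) k
      rw [div_le_iff₀ (by positivity)] at h1
      calc (1 + |u|) ^ k * Real.exp (-u ^ 2 / 2)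
          ≤ (Real.exp (1 + |u|) * k.factorial) * Real.exp (-u ^ 2 / 2) := by gcongr
        _ = k.factorial * Real.exp (1 + |u| + -u ^ 2 / 2) := by rw [Real.exp_add (1 + |u|)]; ring
        _ ≤ _ := by
          gcongr
          rw [← sq_abs u]
          nlinarith [sq_nonneg (|u| - 1)]
    calc |R Λ y| ≤ C * (|y| / Λ ^ 2 + 1 / Λ) ^ k * Real.exp (-y ^ 2 / (2 * Λ ^ 2)) :=
          (h Λ hΛ y).1 hy
      _ ≤ C * ((K + 1) * ε * (1 + |u|)) ^ k * Real.exp (-y ^ 2 / (2 * Λ ^ 2)) := by gcongr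
      _ = C * (K + 1) ^ k * ε ^ k * ((1 + |u|) ^ k * Real.exp (-u ^ 2 / 2)) *
            Real.exp (-β * y + β ^ 2 * Λ ^ 2 / 2) := by
          rw [hexp, mul_pow, mul_pow]; ring
      _ ≤ C * (K + 1) ^ k * ε ^ k * (k.factorial * Real.exp (3 / 2)) *
            Real.exp (-β * y + β ^ 2 * Λ ^ 2 / 2) := by gcongr
      _ = C₁ * ε ^ k * Real.exp (-β * y + β ^ 2 * Λ ^ 2 / 2) := by rw [hC₁]; ring
      _ ≤ _ := by
          have : 0 ≤ C₂ * ε ^ k * Real.exp (-β * y + β ^ 2 * Λ ^ 2 / 2) := by positivity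
          linarith
  · have h1 := (h Λ hΛ y).2 hy
    -- The restriction `β ≤ δ / 4` leaves a gap of `δ² Λ² / 4` between the two exponents in the
    -- tail, more than enough to beat `ε ^ k ≥ Λ ^ (-k)`.
    have h2 : Real.exp (-δ * |y| + δ ^ 2 * Λ ^ 2 / 2)
        ≤ Real.exp (-(δ ^ 2 / 4 * Λ)) * Real.exp (-β * y + β ^ 2 * Λ ^ 2 / 2) := by
      rw [← Real.exp_add, Real.exp_le_exp]
      have e1 : β * y ≤ β * |y| := mul_le_mul_of_nonneg_left (le_abs_self y) hβ
      have e2 : (δ - β) * (δ * Λ ^ 2) ≤ (δ - β) * |y| :=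
        mul_le_mul_of_nonneg_left hy.le (by linarith)
      have e3 : β * (δ * Λ ^ 2) ≤ δ / 4 * (δ * Λ ^ 2) := by gcongr
      have e4 : δ ^ 2 / 4 * Λ ≤ δ ^ 2 / 4 * Λ ^ 2 := by gcongr; nlinarith
      have e5 : 0 ≤ β ^ 2 * Λ ^ 2 := by positivity
      linarith
    have h3 : Real.exp (-(δ ^ 2 / 4 * Λ)) ≤ k.factorial * (4 / δ ^ 2) ^ k * ε ^ k := by
      have e1 := Real.pow_div_factorial_le_exp (δ ^ 2 / 4 * Λ) (by positivity) k
      have e2 : (1 / Λ) ^ k ≤ ε ^ k := by gcongr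
      rw [Real.exp_neg, inv_le_comm₀ (Real.exp_pos _) (by positivity)]
      refine le_trans ?_ e1
      calc (k.factorial * (4 / δ ^ 2) ^ k * ε ^ k)⁻¹
          ≤ (k.factorial * (4 / δ ^ 2) ^ k * (1 / Λ) ^ k)⁻¹ := by gcongr
        _ = _ := by
          rw [mul_pow, div_pow, div_pow, div_pow, one_pow]
          field_simp
    calc |R Λ y| ≤ C * Real.exp (-δ * |y| + δ ^ 2 * Λ ^ 2 / 2) := h1
      _ ≤ C * ((k.factorial * (4 / δ ^ 2) ^ k * ε ^ k) *
            Real.exp (-β * y + β ^ 2 * Λ ^ 2 / 2)) := by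
          gcongr
          exact h2.trans (by gcongr)
      _ = C₂ * ε ^ k * Real.exp (-β * y + β ^ 2 * Λ ^ 2 / 2) := by rw [hC₂]; ring
      _ ≤ _ := by
          have : 0 ≤ C₁ * ε ^ k * Real.exp (-β * y + β ^ 2 * Λ ^ 2 / 2) := by positivity
          linarith

end WeightedSums

/-! ### Remainder sums relative to the Gaussian sum -/

section Remainders

universe v

variable {ι : Type v} {w x : ι → ℝ}

/-- The weighted sum of `|R(Λ, x - L)|` is `O(Λ^{-s})` relative to the Gaussian sum. -/
def SumOrder (w x : ι → ℝ) (L s : ℝ) (R : ℝ → ℝ → ℝ) : Prop :=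
  ∃ C : ℝ, 0 ≤ C ∧ ∀ᶠ Λ in atTop, Summable (fun i => w i * |R Λ (x i - L)|) ∧
    ∑' i, w i * |R Λ (x i - L)| ≤ C * Λ ^ (-s) * gaussSum w x L Λ

theorem SumOrder.of_weights_zero (hw : ∀ i, w i = 0) (L s : ℝ) (R : ℝ → ℝ → ℝ) :
    SumOrder w x L s R := by
  refine ⟨0, le_rfl, Eventually.of_forall fun Λ => ?_⟩
  simp [hw]

theorem gaussSum_nonneg (hw : ∀ i, 0 ≤ w i) (L Λ : ℝ) : 0 ≤ gaussSum w x L Λ :=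
  tsum_nonneg fun i => mul_nonneg (hw i) (Real.exp_pos _).le

theorem summable_gaussSum (hw : ∀ i, 0 ≤ w i) {β : ℝ}
    (hZ : Summable fun i => w i * Real.exp (-β * x i)) (L : ℝ) {σ : ℝ} (hσ : 0 < σ) :
    Summable fun i => w i * Real.exp (-(x i - L) ^ 2 / (2 * σ)) := by
  refine summable_of_abs_le_exp hw hZ hZ (Real.exp (β * L + β ^ 2 * σ / 2)) fun i => ?_
  rw [abs_of_pos (Real.exp_pos _)]
  have h1 : Real.exp (-(x i - L) ^ 2 / (2 * σ))
      ≤ Real.exp (β * L + β ^ 2 * σ / 2) * Real.exp (-β * x i) := by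
    rw [← Real.exp_add, Real.exp_le_exp, div_le_iff₀ (by positivity)]
    nlinarith [sq_nonneg ((x i - L) - β * σ)]
  refine h1.trans ?_
  gcongr
  linarith [Real.exp_pos (-β * x i)]

theorem exists_forall_mem_Ioc {p : ℝ → Prop} (h : ∀ᶠ β in 𝓝[>] (0 : ℝ), p β) {d : ℝ}
    (hd : 0 < d) : ∃ b, 0 < b ∧ b ≤ d ∧ ∀ β, 0 < β → β ≤ b → p β := by
  obtain ⟨u, hu, hs⟩ := mem_nhdsGT_iff_exists_Ioo_subset.mp h
  have hu0 : (0 : ℝ) < u := hu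
  refine ⟨min (u / 2) d, lt_min (by linarith) hd, min_le_right _ _, fun β h0 hβ => hs ⟨h0, ?_⟩⟩
  linarith [hβ.trans (min_le_left _ _)]

/-- The saddle point `β Λ² = ḡ(β) - L` and its rate. -/
theorem exists_saddle (hw : ∀ i, 0 ≤ w i)
    (hZ : ∀ β : ℝ, 0 < β → Summable fun i => w i * Real.exp (-β * x i)) (hpos : ∃ i, 0 < w i)
    {L c d : ℝ} (hc : 0 ≤ c) (hd : 0 < d)
    (hL : ∃ η > 0, ∀ᶠ β in 𝓝[>] (0 : ℝ), L + η ≤ canonMean w x β)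
    (h2 : (fun β : ℝ => β ^ (1 + 2 * c) * canonMean w x β) =O[𝓝[>] 0] fun _ => (1 : ℝ))
    (h3 : (fun β : ℝ => β * canonVar w x β / canonMean w x β) =O[𝓝[>] 0] fun _ => (1 : ℝ)) :
    ∃ K : ℝ, 0 ≤ K ∧ ∀ᶠ Λ : ℝ in atTop, ∃ β, 0 < β ∧ β ≤ d ∧ β ≤ K * Λ ^ (-(1 / (1 + c))) ∧
      canonMean w x β - L = β * Λ ^ 2 ∧ canonVar w x β ≤ K * Λ ^ 2 := by
  obtain ⟨η, hη, hL⟩ := hL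
  obtain ⟨C₂, hC₂, h2⟩ := h2.exists_nonneg
  obtain ⟨C₃, hC₃, h3⟩ := h3.exists_nonneg
  -- At a zero of the mean the quotient in G3 is `0` by convention and carries no information on the
  -- variance. Such zeros do not accumulate at `0`, unless the variance vanishes identically.
  have h3' : ∀ᶠ β in 𝓝[>] (0 : ℝ), β * canonVar w x β ≤ C₃ * |canonMean w x β| := by
    rcases canonVar_eq_zero_or_eventually_canonMean_ne_zero hw hZ with h0 | h0
    · refine Eventually.of_forall fun β => ?_
      rw [h0, mul_zero]
      positivity
    · filter_upwards [h3.bound, h0] with β hb hm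
      rw [norm_one, mul_one, Real.norm_eq_abs, abs_div, div_le_iff₀ (abs_pos.mpr hm)] at hb
      exact (le_abs_self _).trans hb
  obtain ⟨b, hb0, hbd, hb⟩ := exists_forall_mem_Ioc (hL.and (h2.bound.and h3'))
    (lt_min hd zero_lt_one)
  set M := C₂ + |L| + 1 with hM
  have hM0 : 0 < M := by positivity
  set p := 1 / (2 + 2 * c) with hp
  have hp0 : 0 < p := by positivity
  refine ⟨M ^ p + C₃ * (1 + |L| / η), by positivity, ?_⟩
  have hlarge : ∀ᶠ Λ : ℝ in atTop, canonMean w x b - L ≤ b * Λ ^ 2 := by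
    have : Tendsto (fun Λ : ℝ => b * Λ ^ 2) atTop atTop :=
      (tendsto_pow_atTop two_ne_zero).const_mul_atTop hb0
    exact this.eventually_ge_atTop _
  filter_upwards [hlarge, eventually_ge_atTop 1] with Λ hΛ hΛ1
  have hΛ0 : 0 < Λ := by linarith
  -- Left endpoint for the intermediate value theorem: there `β' Λ² ≤ η`, while the mean exceeds `L`
  -- by at least `η`. At the right endpoint `b` the sign is reversed once `Λ` is large.
  set β' := min b (η / Λ ^ 2) with hβ'
  have hβ'0 : 0 < β' := lt_min hb0 (by positivity)
  have hcont : ContinuousOn (fun β => canonMean w x β - L - β * Λ ^ 2) (Set.Icc β' b) := by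
    refine ContinuousOn.sub (ContinuousOn.sub ?_ continuousOn_const) (by fun_prop)
    exact (continuousOn_canonMean hw hZ hpos).mono fun β hβ => lt_of_lt_of_le hβ'0 hβ.1
  have hmem : (0 : ℝ) ∈ Set.Icc (canonMean w x b - L - b * Λ ^ 2)
      (canonMean w x β' - L - β' * Λ ^ 2) := by
    refine ⟨by linarith, ?_⟩
    have e1 := (hb β' hβ'0 (min_le_left _ _)).1
    have e2 : β' * Λ ^ 2 ≤ η := by
      rw [← le_div_iff₀ (by positivity)]
      exact min_le_right _ _
    linarith
  obtain ⟨β, hβ, hβ0⟩ := intermediate_value_Icc' (min_le_left _ _) hcont hmem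
  have hβpos : 0 < β := lt_of_lt_of_le hβ'0 hβ.1
  obtain ⟨f1, f2, f3⟩ := hb β hβpos hβ.2
  have hsad : canonMean w x β - L = β * Λ ^ 2 := by linarith
  have hβ1 : β ≤ 1 := (hβ.2.trans hbd).trans (min_le_right _ _)
  have hηβ : η ≤ β * Λ ^ 2 := by linarith
  refine ⟨β, hβpos, (hβ.2.trans hbd).trans (min_le_left _ _), ?_, hsad, ?_⟩
  · rw [norm_one, mul_one, Real.norm_eq_abs] at f2
    have e1 : β ^ (1 + 2 * c) * canonMean w x β ≤ C₂ := (le_abs_self _).trans f2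
    have e2 : β ^ (1 + 2 * c) ≤ 1 := Real.rpow_le_one hβpos.le hβ1 (by positivity)
    have e3 : 0 < β ^ (1 + 2 * c) := Real.rpow_pos_of_pos hβpos _
    have e4 : β ^ (2 + 2 * c) = β ^ (1 + 2 * c) * β := by
      rw [← Real.rpow_add_one hβpos.ne']; congr 1; ring
    -- G2 at the saddle: `β ^ (1 + 2 c)` times `ḡ(β) - L = β Λ²` is bounded. The root of order `2 +
    -- 2 c` yields the rate.
    have e5 : β ^ (2 + 2 * c) ≤ M * Λ ^ (-2 : ℝ) := by
      rw [Real.rpow_neg hΛ0.le, ← div_eq_mul_inv, le_div_iff₀ (by positivity)]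
      have e6 : Λ ^ (2 : ℝ) = Λ ^ 2 := by norm_cast
      rw [e6, e4]
      have e7 : canonMean w x β = β * Λ ^ 2 + L := by linarith
      rw [e7] at e1
      have e8 : -(β ^ (1 + 2 * c) * L) ≤ |L| := by
        rw [← mul_neg]
        calc β ^ (1 + 2 * c) * -L ≤ β ^ (1 + 2 * c) * |L| := by
              gcongr; exact neg_le_abs L
          _ ≤ 1 * |L| := by gcongr
          _ = |L| := one_mul _
      rw [hM]
      linarith
    have e9 : β = (β ^ (2 + 2 * c)) ^ p := by
      rw [← Real.rpow_mul hβpos.le, hp, mul_one_div_cancel (by positivity), Real.rpow_one]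
    have e10 : (M * Λ ^ (-2 : ℝ)) ^ p = M ^ p * Λ ^ (-(1 / (1 + c))) := by
      rw [Real.mul_rpow hM0.le (by positivity), ← Real.rpow_mul hΛ0.le]
      congr 2
      rw [hp]
      field_simp
    calc β = (β ^ (2 + 2 * c)) ^ p := e9
      _ ≤ (M * Λ ^ (-2 : ℝ)) ^ p := Real.rpow_le_rpow (by positivity) e5 hp0.le
      _ = M ^ p * Λ ^ (-(1 / (1 + c))) := e10
      _ ≤ _ := by
        refine mul_le_mul_of_nonneg_right ?_ (by positivity)
        have : 0 ≤ C₃ * (1 + |L| / η) := by positivity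
        linarith
  · have e1 : |canonMean w x β| ≤ β * Λ ^ 2 + |L| := by
      have : canonMean w x β = β * Λ ^ 2 + L := by linarith
      rw [this]
      refine (abs_add_le _ _).trans ?_
      rw [abs_of_pos (by positivity : 0 < β * Λ ^ 2)]
    -- Because `β Λ² ≥ η` at the saddle, the constant `L` is absorbed. The mean is then at most a
    -- multiple of `β Λ²`, and G3 allows the cancellation of `β`.
    have e2 : |L| ≤ |L| / η * (β * Λ ^ 2) := by
      rw [div_mul_eq_mul_div, le_div_iff₀ hη]
      gcongr
    have e3 : β * canonVar w x β ≤ β * (C₃ * (1 + |L| / η) * Λ ^ 2) := by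
      refine f3.trans ?_
      calc C₃ * |canonMean w x β| ≤ C₃ * (β * Λ ^ 2 + |L| / η * (β * Λ ^ 2)) := by
            gcongr; linarith
        _ = _ := by ring
    refine (le_of_mul_le_mul_left e3 hβpos).trans ?_
    refine mul_le_mul_of_nonneg_right ?_ (by positivity)
    have : 0 ≤ M ^ p := by positivity
    linarith

/-- At the saddle the remainder is dominated termwise by the canonical ensemble with the factor `ε ^
k`, `ε = Λ^(-1/(1+c))`, and the canonical sum costs only `exp (K / 2)` relative to the Gaussian sum.
-/
theorem sumOrder_of_conditions (hw : ∀ i, 0 ≤ w i)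
    (hZ : ∀ β : ℝ, 0 < β → Summable fun i => w i * Real.exp (-β * x i))
    {L c δ : ℝ} (hc : 0 ≤ c) (hδ : 0 < δ)
    (hL : ∃ η > 0, ∀ᶠ β in 𝓝[>] (0 : ℝ), L + η ≤ canonMean w x β)
    (h2 : (fun β : ℝ => β ^ (1 + 2 * c) * canonMean w x β) =O[𝓝[>] 0] fun _ => (1 : ℝ))
    (h3 : (fun β : ℝ => β * canonVar w x β / canonMean w x β) =O[𝓝[>] 0] fun _ => (1 : ℝ))
    {k : ℕ} {R : ℝ → ℝ → ℝ} (hR : RelOrder δ k R) :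
    SumOrder w x L (k / (1 + c)) R := by
  by_cases hpos : ∃ i, 0 < w i
  swap
  · push Not at hpos
    exact SumOrder.of_weights_zero (fun i => le_antisymm (hpos i) (hw i)) L _ R
  obtain ⟨K, hK, hs⟩ := exists_saddle hw hZ hpos hc (by positivity : 0 < δ / 4) hL h2 h3
  obtain ⟨C, hC, hle⟩ := hR.le_canonical hδ hK
  refine ⟨C * Real.exp (K / 2), by positivity, ?_⟩
  filter_upwards [hs, eventually_ge_atTop 1] with Λ ⟨β, hβ, hβδ, hβK, hsad, hvar⟩ hΛ
  have hΛ0 : 0 < Λ := by linarith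
  set ε := Λ ^ (-(1 / (1 + c))) with hε
  have hε0 : 0 < ε := by positivity
  have hεΛ : 1 / Λ ≤ ε := by
    rw [one_div, ← Real.rpow_neg_one, hε]
    refine Real.rpow_le_rpow_of_exponent_le hΛ (neg_le_neg ?_)
    rw [div_le_one (by positivity)]
    linarith
  have hεk : ε ^ k = Λ ^ (-(k / (1 + c))) := by
    rw [hε, ← Real.rpow_natCast, ← Real.rpow_mul hΛ0.le]
    congr 1
    ring
  have hpt := fun i => hle Λ ε β hΛ hεΛ hβ.le hβδ hβK (x i - L)
  have hsum : Summable fun i => w i * Real.exp (-β * (x i - L) + β ^ 2 * Λ ^ 2 / 2) := by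
    refine ((hZ β hβ).mul_left (Real.exp (β * L + β ^ 2 * Λ ^ 2 / 2))).congr fun i => ?_
    rw [mul_left_comm, ← Real.exp_add]
    congr 2
    ring
  have hle' : ∀ i, w i * |R Λ (x i - L)|
      ≤ C * ε ^ k * (w i * Real.exp (-β * (x i - L) + β ^ 2 * Λ ^ 2 / 2)) := fun i => by
    calc w i * |R Λ (x i - L)| ≤ w i * _ := mul_le_mul_of_nonneg_left (hpt i) (hw i)
      _ = _ := by ring
  have hsR : Summable fun i => w i * |R Λ (x i - L)| :=
    Summable.of_nonneg_of_le (fun i => mul_nonneg (hw i) (abs_nonneg _)) hle' (hsum.mul_left _)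
  refine ⟨hsR, ?_⟩
  have h4 := tsum_exp_le_gaussSum hw hZ hpos hβ hΛ0 hsad
  have h5 : Real.exp (canonVar w x β / (2 * Λ ^ 2)) ≤ Real.exp (K / 2) := by
    rw [Real.exp_le_exp, div_le_iff₀ (by positivity)]
    linarith
  calc ∑' i, w i * |R Λ (x i - L)|
      ≤ C * ε ^ k * ∑' i, w i * Real.exp (-β * (x i - L) + β ^ 2 * Λ ^ 2 / 2) := by
        rw [← tsum_mul_left]
        exact hsR.tsum_le_tsum hle' (hsum.mul_left _)
    _ ≤ C * ε ^ k * (Real.exp (K / 2) * gaussSum w x L Λ) := by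
        gcongr
        refine h4.trans ?_
        have := gaussSum_nonneg (x := x) hw L Λ
        gcongr
    _ = _ := by rw [hεk]; ring

/-- Summability on both sides of `β = 0` makes all moments of the levels finite. A remainder of
order `k` is bounded by `Λ^(-k) (1 + |y|)^k`, also in the tail, and the Gaussian sum stays above the
contribution of a single level. -/
theorem sumOrder_of_summable_neg (hw : ∀ i, 0 ≤ w i) {α : ℝ} (hα : 0 < α)
    (hZ₁ : Summable fun i => w i * Real.exp (-α * x i))
    (hZ₂ : Summable fun i => w i * Real.exp (-(-α) * x i))
    {L δ : ℝ} (hδ : 0 < δ) {k : ℕ} {R : ℝ → ℝ → ℝ} (hR : RelOrder δ k R) :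
    SumOrder w x L k R := by
  by_cases hpos : ∃ i, 0 < w i
  swap
  · push Not at hpos
    exact SumOrder.of_weights_zero (fun i => le_antisymm (hpos i) (hw i)) L _ R
  obtain ⟨j, hj⟩ := hpos
  obtain ⟨C, hC, hR⟩ := hR
  set M := 1 + |L| with hM
  have hM0 : 0 < M := by positivity
  have hMs := summable_abs_pow_mul_exp hw (by linarith : -α < 0) hα hZ₂ hZ₁ k M
  simp only [neg_zero, zero_mul, Real.exp_zero, mul_one] at hMs
  set S := ∑' i, w i * (|x i| + |M|) ^ k with hS
  -- The Gaussian term of one occupied level at `Λ = 1`; it only increases with `Λ`.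
  set n₀ := w j * Real.exp (-(x j - L) ^ 2 / 2) with hn₀
  have hn₀0 : 0 < n₀ := mul_pos hj (Real.exp_pos _)
  have hS0 : 0 ≤ S := tsum_nonneg fun i => mul_nonneg (hw i) (by positivity)
  set C' := C * (1 + (1 / δ) ^ k) with hC'
  have hC'0 : 0 ≤ C' := by positivity
  refine ⟨C' * S / n₀, by positivity, ?_⟩
  filter_upwards [eventually_ge_atTop 1] with Λ hΛ
  have hΛ0 : 0 < Λ := by linarith
  have hN : n₀ ≤ gaussSum w x L Λ := by
    refine le_trans ?_ ((summable_gaussSum hw hZ₁ L (by positivity : 0 < Λ ^ 2)).le_tsum j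
      fun i _ => mul_nonneg (hw i) (Real.exp_pos _).le)
    refine mul_le_mul_of_nonneg_left (Real.exp_le_exp.mpr ?_) hj.le
    rw [neg_div, neg_div, neg_le_neg_iff]
    gcongr
    nlinarith
  have hpt : ∀ i, w i * |R Λ (x i - L)| ≤ C' * (1 / Λ) ^ k * (w i * (|x i| + |M|) ^ k) := by
    intro i
    have hy : 1 + |x i - L| ≤ |x i| + |M| := by
      rw [abs_of_pos hM0, hM]
      linarith [abs_sub (x i) L]
    have h1 : |R Λ (x i - L)| ≤ C' * (1 / Λ) ^ k * (1 + |x i - L|) ^ k := by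
      set y := x i - L
      have hp : 0 ≤ C * (1 / Λ) ^ k * (1 + |y|) ^ k := by positivity
      have hq : 0 ≤ C * (1 / δ) ^ k * (1 / Λ) ^ k * (1 + |y|) ^ k := by positivity
      rcases le_or_gt |y| (δ * Λ ^ 2) with h | h
      · calc |R Λ y| ≤ C * (|y| / Λ ^ 2 + 1 / Λ) ^ k * Real.exp (-y ^ 2 / (2 * Λ ^ 2)) :=
              (hR Λ hΛ y).1 h
          _ ≤ C * (1 / Λ * (1 + |y|)) ^ k * 1 := by
              gcongr
              · have : |y| / Λ ^ 2 ≤ |y| / Λ := by gcongr; nlinarith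
                calc |y| / Λ ^ 2 + 1 / Λ ≤ |y| / Λ + 1 / Λ := by linarith
                  _ = _ := by ring
              · rw [Real.exp_le_one_iff, neg_div, neg_nonpos]
                positivity
          _ = C * (1 / Λ) ^ k * (1 + |y|) ^ k := by rw [mul_pow]; ring
          _ ≤ _ := by rw [hC']; linarith
      · calc |R Λ y| ≤ C * Real.exp (-δ * |y| + δ ^ 2 * Λ ^ 2 / 2) := (hR Λ hΛ y).2 h
          _ ≤ C * 1 := by
              gcongr
              rw [Real.exp_le_one_iff]
              nlinarith [mul_lt_mul_of_pos_left h hδ, sq_nonneg (δ * Λ)]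
          _ ≤ C * (1 / δ * (1 / Λ) * (1 + |y|)) ^ k := by
              gcongr
              refine one_le_pow₀ ?_
              have : 1 / δ * (1 / Λ) * (1 + |y|) = (1 + |y|) / (δ * Λ) := by field_simp
              rw [this, le_div_iff₀ (by positivity)]
              nlinarith [mul_le_mul_of_nonneg_left hΛ (mul_nonneg hδ.le hΛ0.le)]
          _ = C * (1 / δ) ^ k * (1 / Λ) ^ k * (1 + |y|) ^ k := by rw [mul_pow, mul_pow]; ring
          _ ≤ _ := by rw [hC']; linarith
    calc w i * |R Λ (x i - L)| ≤ w i * (C' * (1 / Λ) ^ k * (|x i| + |M|) ^ k) := by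
          refine mul_le_mul_of_nonneg_left (h1.trans ?_) (hw i)
          gcongr
      _ = _ := by ring
  have hsR : Summable fun i => w i * |R Λ (x i - L)| :=
    Summable.of_nonneg_of_le (fun i => mul_nonneg (hw i) (abs_nonneg _)) hpt (hMs.mul_left _)
  refine ⟨hsR, ?_⟩
  have hk : (1 / Λ) ^ k = Λ ^ (-(k : ℝ)) := by
    rw [Real.rpow_neg hΛ0.le, Real.rpow_natCast, one_div, inv_pow]
  calc ∑' i, w i * |R Λ (x i - L)| ≤ C' * (1 / Λ) ^ k * S := by
        rw [hS, ← tsum_mul_left]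
        exact hsR.tsum_le_tsum hpt (hMs.mul_left _)
    _ = C' * S / n₀ * Λ ^ (-(k : ℝ)) * n₀ := by rw [hk]; field_simp
    _ ≤ _ := by gcongr

end Remainders

/-! ### Parameters of the transformed density -/

section Density

variable {g : ℝ ≃o ℝ} {F : ℝ → ℝ}

/-- For `β₀` between `0` and `β₊`, Schwartz decay at `β₀` and `-β₀` controls the right and the left
tail; `δ` is `β₀ / 2` because moments of order `2 δ` are wanted. -/
theorem exists_expDecay (hg' : ContDiff ℝ ∞ g.symm) (hF : IsSmoothDensity F) {βp : EReal}
    (hβp : 0 < βp) (hdecay : ∀ β : ℝ, (β : EReal) < βp →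
      IsRapidlyDecreasing fun x => Real.exp (β * x) * F (g.symm x)) :
    ∃ δ, ExpDecay δ fun z => F (g.symm z) := by
  obtain ⟨β₀, h1, h2⟩ := EReal.lt_iff_exists_real_btwn.mp hβp
  have h0 : 0 < β₀ := by exact_mod_cast h1
  have hint : ∀ β : ℝ, (β : EReal) < βp → Integrable fun x => Real.exp (β * x) * F (g.symm x) := by
    intro β hβ
    obtain ⟨φ, hφ⟩ := hdecay β hβ
    rw [← hφ]
    exact φ.integrable
  have hc : Continuous fun z => F (g.symm z) := hF.smooth.continuous.comp hg'.continuous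
  refine ⟨β₀ / 2, by linarith, fun z => hF.nonneg _, hc, ?_⟩
  have hn : ((-β₀ : ℝ) : EReal) < βp := lt_trans (by exact_mod_cast (by linarith : -β₀ < 0)) hβp
  refine ((hint β₀ h2).add (hint (-β₀) hn)).mono' (hc.mul (by fun_prop)).aestronglyMeasurable
    (ae_of_all _ fun z => ?_)
  rw [Real.norm_eq_abs, abs_mul, abs_of_nonneg (hF.nonneg _), abs_of_pos (Real.exp_pos _),
    Pi.add_apply, ← add_mul, mul_comm]
  refine mul_le_mul_of_nonneg_right ?_ (hF.nonneg _)
  rw [mul_div_cancel₀ _ (two_ne_zero' ℝ)]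
  rcases le_total 0 z with h | h
  · rw [abs_of_nonneg h]
    linarith [Real.exp_pos (-β₀ * z)]
  · rw [abs_of_nonpos h, mul_neg, neg_mul]
    linarith [Real.exp_pos (β₀ * z)]

theorem isOpen_pos (hg' : ContDiff ℝ ∞ g.symm) (hF : IsSmoothDensity F) :
    IsOpen {z | 0 < F (g.symm z)} :=
  isOpen_lt continuous_const (hF.smooth.continuous.comp hg'.continuous)

theorem exists_pos (hF : IsSmoothDensity F) : ∃ z, 0 < F (g.symm z) := by
  by_contra! h
  have h0 : F = 0 := by
    funext x
    have := h (g x)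
    rw [g.symm_apply_apply] at this
    exact le_antisymm this (hF.nonneg x)
  have h1 := hF.integral_eq_one
  simp [h0] at h1

theorem moment_zero (h : ℝ → ℝ) (L : ℝ) : moment h L 0 = ∫ z, h z := by simp [moment]

theorem moment_zero_pos (hg' : ContDiff ℝ ∞ g.symm) (hF : IsSmoothDensity F) {δ : ℝ}
    (H : ExpDecay δ fun z => F (g.symm z)) (L : ℝ) : 0 < moment (fun z => F (g.symm z)) L 0 := by
  have hi : Integrable fun z => F (g.symm z) := by
    have := H.integrable_moment 0 0
    simpa using this
  rw [moment_zero, integral_pos_iff_support_of_nonneg (fun z => hF.nonneg _) hi]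
  have hs : Function.support (fun z => F (g.symm z)) = {z | 0 < F (g.symm z)} := by
    ext z
    exact ⟨fun h => lt_of_le_of_ne (hF.nonneg _) (Ne.symm h), fun h => ne_of_gt h⟩
  rw [hs]
  obtain ⟨z, hz⟩ := exists_pos (g := g) hF
  exact (isOpen_pos hg' hF).measure_pos _ ⟨z, hz⟩

theorem Fbar_zero (g : ℝ ≃o ℝ) (F : ℝ → ℝ) (L : ℝ) :
    Fbar g F 0 = moment (fun z => F (g.symm z)) L 0 := by
  rw [moment_zero, Fbar]
  simp

theorem moment_one {δ : ℝ} (H : ExpDecay δ fun z => F (g.symm z))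
    (h0 : ∀ L, 0 < moment (fun z => F (g.symm z)) L 0) (L : ℝ) :
    moment (fun z => F (g.symm z)) L 1 =
      moment (fun z => F (g.symm z)) L 0 * (mean g F 0 - L) := by
  have hm : mean g F 0 = moment (fun z => F (g.symm z)) 0 1 / moment (fun z => F (g.symm z)) L 0 := by
    rw [mean, moment_zero, moment]
    simp
  have i0 := H.integrable_moment 0 0
  have i1 := H.integrable_moment 0 1
  simp only [pow_zero, mul_one, sub_zero, pow_one] at i0 i1
  rw [hm, mul_sub, mul_div_cancel₀ _ (h0 L).ne', moment_zero, moment, moment, ← integral_mul_const,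
    ← integral_sub _ (i0.mul_const L)]
  · congr 1
    funext z
    ring
  · simpa using i1

theorem moment_two (h0 : ∀ L, 0 < moment (fun z => F (g.symm z)) L 0) :
    moment (fun z => F (g.symm z)) (mean g F 0) 2 =
      variance g F 0 * moment (fun z => F (g.symm z)) (mean g F 0) 0 := by
  have hv : variance g F 0 = moment (fun z => F (g.symm z)) (mean g F 0) 2 /
      moment (fun z => F (g.symm z)) (mean g F 0) 0 := by
    rw [variance, moment_zero, moment]
    simp
  rw [hv, div_mul_cancel₀ _ (h0 _).ne']

theorem coarse_eq (g : ℝ ≃o ℝ) (F : ℝ → ℝ) (L Λ E : ℝ) :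
    coarse g F Λ E = 1 / Real.sqrt (2 * Real.pi * Λ ^ 2) *
      smoothed (fun z => F (g.symm z)) L Λ (g E - L) := by
  rw [coarse, smoothed, ← integral_const_mul]
  congr 1
  funext z
  rw [gaussian, mul_left_comm]
  congr 3
  ring_nf

/-- The normalization is split so that both traces carry the same prefactor `1 / √(2 π Λ²)`, which
drops out of the relative error. -/
theorem gaussEnsemble_eq (g : ℝ ≃o ℝ) (L : ℝ) {v : ℝ} (hv : 0 ≤ v) {Λ : ℝ} (hΛ : 0 < Λ) (E : ℝ) :
    gaussEnsemble g L v Λ E = 1 / Real.sqrt (2 * Real.pi * Λ ^ 2) *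
      widened v Λ (g E - L) := by
  have h : 2 * Real.pi * (v + Λ ^ 2) = 2 * Real.pi * Λ ^ 2 * (1 + v * (1 / Λ) ^ 2) := by
    field_simp
    ring
  rw [gaussEnsemble, gaussian, widened, Real.sq_sqrt (by positivity), ← mul_assoc,
    one_div_mul_one_div, ← Real.sqrt_mul (by positivity), ← h]
  congr 3
  ring

end Density

/-! ### Traces as weighted sums -/

section Traces

universe u v

variable {𝓗 : Type u} [NormedAddCommGroup 𝓗] [InnerProductSpace ℂ 𝓗] [CompleteSpace 𝓗]
  {H A : 𝓗 →ₗ.[ℂ] 𝓗} {ι : Type v} {g : ℝ ≃o ℝ} {F : ℝ → ℝ}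

theorem gBounded_iff (b : EnergyEigenbasis H ι) (hA : IsPositiveObservable A)
    (hd : ∀ i, b.ψ i ∈ A.domain) (β : ℝ) :
    GBounded b A g β ↔ Summable fun i => b.weight A i * Real.exp (-β * g (b.E i)) :=
  b.finiteTr_iff hA.selfAdjoint hd _

theorem gbar_eq (b : EnergyEigenbasis H ι) (hA : IsPositiveObservable A)
    (hd : ∀ i, b.ψ i ∈ A.domain) :
    gbar b A g = canonMean (b.weight A) fun i => g (b.E i) := by
  funext β
  rw [gbar, canonMean, b.tr_eq_tsum hA.selfAdjoint hd, b.tr_eq_tsum hA.selfAdjoint hd]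

theorem sigmaSq_eq (b : EnergyEigenbasis H ι) (hA : IsPositiveObservable A)
    (hd : ∀ i, b.ψ i ∈ A.domain) :
    sigmaSq b A g = canonVar (b.weight A) fun i => g (b.E i) := by
  funext β
  rw [sigmaSq, canonVar, b.tr_eq_tsum hA.selfAdjoint hd, b.tr_eq_tsum hA.selfAdjoint hd,
    gbar_eq b hA hd]

theorem summable_smoothed {ι : Type v} {w x : ι → ℝ} (hw : ∀ i, 0 ≤ w i) {δ : ℝ}
    {h : ℝ → ℝ} (D : ExpDecay δ h) (hZ : Summable fun i => w i * Real.exp (-δ * x i)) (L : ℝ)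
    {Λ : ℝ} (hΛ : 0 < Λ) : Summable fun i => w i * smoothed h L Λ (x i - L) := by
  set I := ∫ z, h z * Real.exp (2 * δ * |z - L|)
  refine Summable.of_nonneg_of_le (fun i => mul_nonneg (hw i) (D.smoothed_nonneg _ _ _))
    (fun i => ?_) (hZ.mul_left (I * Real.exp (δ * L + δ ^ 2 * Λ ^ 2 / 2)))
  calc w i * smoothed h L Λ (x i - L)
      ≤ w i * (I * Real.exp (-δ * (x i - L) + δ ^ 2 * Λ ^ 2 / 2)) :=
        mul_le_mul_of_nonneg_left (D.smoothed_le L δ (abs_of_pos D.pos).le hΛ _) (hw i)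
    _ = I * (w i * Real.exp ((δ * L + δ ^ 2 * Λ ^ 2 / 2) + -δ * x i)) := by
        rw [mul_left_comm]; congr 3; ring
    _ = _ := by rw [Real.exp_add]; ring

theorem summable_widened {ι : Type v} {w x : ι → ℝ} (hw : ∀ i, 0 ≤ w i) {δ : ℝ}
    (hZ : Summable fun i => w i * Real.exp (-δ * x i)) (L : ℝ) {v : ℝ} (hv : 0 ≤ v)
    {Λ : ℝ} (hΛ : 0 < Λ) : Summable fun i => w i * widened v Λ (x i - L) := by
  refine ((summable_gaussSum hw hZ L (by positivity : 0 < v + Λ ^ 2)).mul_left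
    (1 / Real.sqrt (1 + v * (1 / Λ) ^ 2))).congr fun i => ?_
  rw [widened]
  ring

section Comparison

variable (b : EnergyEigenbasis H ι) (hA : IsPositiveObservable A) (hd : ∀ i, b.ψ i ∈ A.domain)

include hA hd

theorem tr_coarse (L Λ : ℝ) :
    b.Tr A (coarse g F Λ) = 1 / Real.sqrt (2 * Real.pi * Λ ^ 2) *
      ∑' i, b.weight A i * smoothed (fun z => F (g.symm z)) L Λ (g (b.E i) - L) := by
  rw [b.tr_eq_tsum hA.selfAdjoint hd, ← tsum_mul_left]
  refine tsum_congr fun i => ?_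
  rw [coarse_eq g F L]
  ring

theorem tr_gaussEnsemble (L : ℝ) {v : ℝ} (hv : 0 ≤ v) {Λ : ℝ} (hΛ : 0 < Λ) :
    b.Tr A (gaussEnsemble g L v Λ) = 1 / Real.sqrt (2 * Real.pi * Λ ^ 2) *
      ∑' i, b.weight A i * widened v Λ (g (b.E i) - L) := by
  rw [b.tr_eq_tsum hA.selfAdjoint hd, ← tsum_mul_left]
  refine tsum_congr fun i => ?_
  rw [gaussEnsemble_eq g L hv hΛ]
  ring

variable {δ : ℝ} (D : ExpDecay δ fun z => F (g.symm z))
  (hZ : Summable fun i => b.weight A i * Real.exp (-δ * g (b.E i)))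

include D hZ

theorem finiteTr_coarse {Λ : ℝ} (hΛ : 0 < Λ) : b.FiniteTr A (coarse g F Λ) := by
  rw [b.finiteTr_iff hA.selfAdjoint hd]
  refine ((summable_smoothed (b.weight_nonneg hA) D hZ 0 hΛ).mul_left
    (1 / Real.sqrt (2 * Real.pi * Λ ^ 2))).congr fun i => ?_
  rw [coarse_eq g F 0]
  ring

omit D in
theorem finiteTr_gaussEnsemble (L : ℝ) {v : ℝ} (hv : 0 ≤ v) {Λ : ℝ} (hΛ : 0 < Λ) :
    b.FiniteTr A (gaussEnsemble g L v Λ) := by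
  rw [b.finiteTr_iff hA.selfAdjoint hd]
  refine ((summable_widened (b.weight_nonneg hA) hZ L hv hΛ).mul_left
    (1 / Real.sqrt (2 * Real.pi * Λ ^ 2))).congr fun i => ?_
  rw [gaussEnsemble_eq g L hv hΛ]
  ring

theorem tr_coarse_sub (L : ℝ) {v : ℝ} (hv : 0 ≤ v) {Λ : ℝ} (hΛ : 0 < Λ) :
    b.Tr A (coarse g F Λ) - Fbar g F 0 * b.Tr A (gaussEnsemble g L v Λ)
      = 1 / Real.sqrt (2 * Real.pi * Λ ^ 2) * ∑' i, b.weight A i *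
        ExpDecay.deviation (fun z => F (g.symm z)) L v Λ (g (b.E i) - L) := by
  have s1 := summable_smoothed (b.weight_nonneg hA) D hZ L hΛ
  have s2 := summable_widened (b.weight_nonneg hA) hZ L hv hΛ
  rw [tr_coarse b hA hd L, tr_gaussEnsemble b hA hd L hv hΛ, Fbar_zero g F L, mul_left_comm,
    ← mul_sub, ← tsum_mul_left, ← s1.tsum_sub (s2.mul_left _)]
  congr 1
  refine tsum_congr fun i => ?_
  rw [ExpDecay.deviation]
  ring

/-- Widening lowers the normalization by at most `√(1 + v)` for `Λ ≥ 1` and only increases the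
exponential. An error small relative to the narrow Gaussian sum is therefore small relative to the
Gaussian trace. -/
theorem approxBigO_of_sumOrder (h0 : ∀ L, 0 < moment (fun z => F (g.symm z)) L 0)
    {L v s : ℝ} (hv : 0 ≤ v)
    (hS : SumOrder (b.weight A) (fun i => g (b.E i)) L s
      (ExpDecay.deviation (fun z => F (g.symm z)) L v)) :
    ApproxBigO b A g F L v s := by
  obtain ⟨C, hC, hS⟩ := hS
  set T := fun Λ => b.Tr A (coarse g F Λ)
  set Q := fun Λ => Fbar g F 0 * b.Tr A (gaussEnsemble g L v Λ) with hQdef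
  have hF0 : 0 < Fbar g F 0 := by rw [Fbar_zero g F L]; exact h0 L
  set n := 1 / Real.sqrt (1 + v) with hn
  have hn0 : 0 < n := by positivity
  have hw := b.weight_nonneg hA
  have hkey : ∀ᶠ Λ in atTop, |T Λ - Q Λ| ≤ C / (Fbar g F 0 * n) * Λ ^ (-s) * Q Λ := by
    filter_upwards [hS, eventually_ge_atTop 1] with Λ ⟨hs1, hs2⟩ hΛ
    have hΛ0 : 0 < Λ := by linarith
    set κ := 1 / Real.sqrt (2 * Real.pi * Λ ^ 2) with hκ
    have hκ0 : 0 < κ := by positivity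
    set N := gaussSum (b.weight A) (fun i => g (b.E i)) L Λ with hN
    have h1 : |T Λ - Q Λ| ≤ κ * (C * Λ ^ (-s) * N) := by
      have := tr_coarse_sub b hA hd D hZ L hv hΛ0
      simp only [T, Q]
      rw [this, abs_mul, abs_of_pos hκ0]
      refine mul_le_mul_of_nonneg_left (le_trans ?_ hs2) hκ0.le
      rw [← Real.norm_eq_abs]
      refine (norm_tsum_le_tsum_norm ?_).trans (le_of_eq (tsum_congr fun i => ?_))
      · refine hs1.congr fun i => ?_
        rw [Real.norm_eq_abs, abs_mul, abs_of_nonneg (hw i)]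
      · rw [Real.norm_eq_abs, abs_mul, abs_of_nonneg (hw i)]
    have h2 : Fbar g F 0 * n * (κ * N) ≤ Q Λ := by
      simp only [Q]
      rw [tr_gaussEnsemble b hA hd L hv hΛ0, ← hκ, mul_assoc]
      refine mul_le_mul_of_nonneg_left ?_ hF0.le
      rw [mul_left_comm]
      refine mul_le_mul_of_nonneg_left ?_ hκ0.le
      rw [hN, gaussSum, ← tsum_mul_left]
      refine Summable.tsum_le_tsum (fun i => ?_)
        ((summable_gaussSum hw hZ L (by positivity : 0 < Λ ^ 2)).mul_left n)
        (summable_widened hw hZ L hv hΛ0)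
      rw [mul_left_comm]
      refine mul_le_mul_of_nonneg_left ?_ (hw i)
      rw [widened]
      have h3 : n ≤ 1 / Real.sqrt (1 + v * (1 / Λ) ^ 2) := by
        rw [hn]
        refine one_div_le_one_div_of_le (Real.sqrt_pos.mpr (by positivity)) (Real.sqrt_le_sqrt ?_)
        have : (1 / Λ) ^ 2 ≤ 1 := pow_le_one₀ (by positivity) (by rw [div_le_one hΛ0]; exact hΛ)
        nlinarith
      refine mul_le_mul h3 (Real.exp_le_exp.mpr ?_) (Real.exp_pos _).le (by positivity)
      rw [neg_div, neg_div, neg_le_neg_iff]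
      gcongr
      linarith
    calc |T Λ - Q Λ| ≤ κ * (C * Λ ^ (-s) * N) := h1
      _ = C / (Fbar g F 0 * n) * Λ ^ (-s) * (Fbar g F 0 * n * (κ * N)) := by field_simp
      _ ≤ _ := by gcongr
  refine ⟨fun Λ => (T Λ - Q Λ) / Q Λ, ?_, ?_⟩
  · filter_upwards [hkey] with Λ hΛ
    change T Λ = Q Λ * (1 + (T Λ - Q Λ) / Q Λ)
    -- If the Gaussian trace vanishes, the bound `hkey` forces the coarse-grained trace to vanish
    -- too, and any value of the relative error will do.
    by_cases hq : Q Λ = 0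
    · rw [hq, mul_zero, sub_zero] at hΛ
      rw [hq, zero_mul]
      exact abs_eq_zero.mp (le_antisymm hΛ (abs_nonneg _))
    · field_simp
      ring
  · refine IsBigO.of_bound (C / (Fbar g F 0 * n)) ?_
    filter_upwards [hkey, eventually_ge_atTop 1] with Λ hΛ h1
    have hΛ0 : 0 < Λ := by linarith
    have hp : 0 < Λ ^ (-s) := by positivity
    have hQ0 : 0 ≤ Q Λ := by
      simp only [Q]
      rw [tr_gaussEnsemble b hA hd L hv hΛ0]
      refine mul_nonneg hF0.le (mul_nonneg (by positivity) (tsum_nonneg fun i =>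
        mul_nonneg (hw i) ?_))
      rw [widened]
      positivity
    rw [Real.norm_eq_abs, Real.norm_eq_abs, abs_of_pos hp, abs_div, abs_of_nonneg hQ0]
    rcases hQ0.eq_or_lt with hq | hq
    · rw [← hq, div_zero]
      positivity
    · rw [div_le_iff₀ hq]
      exact hΛ

/-- A relative error controls the deviation sums. -/
theorem abs_tsum_deviation_le (h0 : ∀ L, 0 < moment (fun z => F (g.symm z)) L 0)
    {L v s : ℝ} (hv : 0 ≤ v) (hs : 0 ≤ s)
    (hS : SumOrder (b.weight A) (fun i => g (b.E i)) L s
      fun Λ y => widened v Λ y - Real.exp (-y ^ 2 / (2 * Λ ^ 2)))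
    {r : ℝ → ℝ} (hr : IsRelError b A g F L v r) :
    ∃ C : ℝ, 0 ≤ C ∧ ∀ᶠ Λ in atTop, |∑' i, b.weight A i *
        ExpDecay.deviation (fun z => F (g.symm z)) L v Λ (g (b.E i) - L)|
      ≤ C * |r Λ| * gaussSum (b.weight A) (fun i => g (b.E i)) L Λ := by
  obtain ⟨C, hC, hS⟩ := hS
  have hF0 : 0 < Fbar g F 0 := by rw [Fbar_zero g F L]; exact h0 L
  have hw := b.weight_nonneg hA
  refine ⟨Fbar g F 0 * (1 + C), by positivity, ?_⟩
  filter_upwards [hS, hr, eventually_ge_atTop 1] with Λ ⟨hs1, hs2⟩ hr hΛ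
  have hΛ0 : 0 < Λ := by linarith
  set κ := 1 / Real.sqrt (2 * Real.pi * Λ ^ 2) with hκ
  have hκ0 : 0 < κ := by positivity
  set N := gaussSum (b.weight A) (fun i => g (b.E i)) L Λ with hN
  have hN0 : 0 ≤ N := gaussSum_nonneg hw L Λ
  set W := ∑' i, b.weight A i * widened v Λ (g (b.E i) - L) with hW
  have hW0 : 0 ≤ W := tsum_nonneg fun i => mul_nonneg (hw i) (by rw [widened]; positivity)
  have h1 := tr_coarse_sub b hA hd D hZ L hv hΛ0
  rw [hr, tr_gaussEnsemble b hA hd L hv hΛ0, ← hκ, ← hW] at h1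
  have h2 : ∑' i, b.weight A i *
      ExpDecay.deviation (fun z => F (g.symm z)) L v Λ (g (b.E i) - L)
      = Fbar g F 0 * W * r Λ := by
    refine mul_left_cancel₀ hκ0.ne' ?_
    rw [← h1]
    ring
  -- The widened Gaussian may exceed the narrow one pointwise, far out by an arbitrarily large
  -- factor; only its weighted sum is comparable, by `hS`.
  have h3 : W ≤ (1 + C) * N := by
    have hsg := summable_gaussSum hw hZ L (by positivity : 0 < Λ ^ 2)
    have h4 : W ≤ N + ∑' i, b.weight A i * |widened v Λ (g (b.E i) - L)
        - Real.exp (-(g (b.E i) - L) ^ 2 / (2 * Λ ^ 2))| := by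
      rw [hN, gaussSum, hW, ← hsg.tsum_add hs1]
      refine Summable.tsum_le_tsum (fun i => ?_) (summable_widened hw hZ L hv hΛ0) (hsg.add hs1)
      rw [← mul_add]
      refine mul_le_mul_of_nonneg_left ?_ (hw i)
      linarith [le_abs_self (widened v Λ (g (b.E i) - L)
        - Real.exp (-(g (b.E i) - L) ^ 2 / (2 * Λ ^ 2)))]
    have h5 : Λ ^ (-s) ≤ 1 := Real.rpow_le_one_of_one_le_of_nonpos hΛ (by linarith)
    have h6 : C * Λ ^ (-s) * N ≤ C * 1 * N := by gcongr
    linarith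
  rw [h2, abs_mul, abs_of_nonneg (mul_nonneg hF0.le hW0)]
  calc Fbar g F 0 * W * |r Λ| ≤ Fbar g F 0 * ((1 + C) * N) * |r Λ| := by gcongr
    _ = _ := by ring

end Comparison

omit [CompleteSpace 𝓗] in
theorem BelowGbarZero.exists_gap {b : EnergyEigenbasis H ι} {L : ℝ}
    (h : BelowGbarZero b A g L) :
    ∃ η > 0, ∀ᶠ β in 𝓝[>] (0 : ℝ), L + η ≤ gbar b A g β := by
  obtain ⟨ℓ, hℓ, hL⟩ := h
  obtain ⟨r, h1, h2⟩ := EReal.lt_iff_exists_real_btwn.mp hL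
  refine ⟨r - L, sub_pos.mpr (by exact_mod_cast h1), ?_⟩
  filter_upwards [hℓ.eventually_const_lt h2] with β hβ
  have : r < gbar b A g β := by exact_mod_cast hβ
  linarith

/-- The guaranteed rates, for a single system. -/
theorem guaranteed_rates (hg' : ContDiff ℝ ∞ g.symm) (hF : IsSmoothDensity F) {βp : EReal}
    (hβp : 0 < βp) (hdecay : ∀ β : ℝ, (β : EReal) < βp →
      IsRapidlyDecreasing fun x => Real.exp (β * x) * F (g.symm x))
    (b : EnergyEigenbasis H ι) (hA : IsPositiveObservable A) {βm : EReal} (hβm : βm ≤ 0)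
    (hB : ∀ β : ℝ, βm < (β : EReal) → GBounded b A g β) :
    (∀ Λ : ℝ, 0 < Λ → b.FiniteTr A (coarse g F Λ) ∧
      ∀ L v : ℝ, 0 ≤ v → b.FiniteTr A (gaussEnsemble g L v Λ)) ∧
    (βm < 0 →
      ApproxBigO b A g F (mean g F 0) (variance g F 0) 3 ∧
      (∀ v : ℝ, 0 ≤ v → ApproxBigO b A g F (mean g F 0) v 2) ∧
      (∀ L v : ℝ, 0 ≤ v → ApproxBigO b A g F L v 1)) ∧
    (∀ c : ℝ, 0 ≤ c → GConditions b A g F c →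
      ApproxBigO b A g F (mean g F 0) (variance g F 0) (3 / (1 + c)) ∧
      (∀ v : ℝ, 0 ≤ v → ApproxBigO b A g F (mean g F 0) v (2 / (1 + c))) ∧
      (∀ L v : ℝ, 0 ≤ v → BelowGbarZero b A g L → ApproxBigO b A g F L v (1 / (1 + c)))) := by
  obtain ⟨δ, D⟩ := exists_expDecay hg' hF hβp hdecay
  have hd : ∀ i, b.ψ i ∈ A.domain :=
    b.ψ_mem_domain_of_gBounded (hB 1 (lt_of_le_of_lt hβm (by exact_mod_cast one_pos)))
  have hB' : ∀ β : ℝ, βm < (β : EReal) →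
      Summable fun i => b.weight A i * Real.exp (-β * g (b.E i)) := fun β hβ =>
    (gBounded_iff b hA hd β).mp (hB β hβ)
  have hZ : ∀ β : ℝ, 0 < β → Summable fun i => b.weight A i * Real.exp (-β * g (b.E i)) :=
    fun β hβ => hB' β (lt_of_le_of_lt hβm (by exact_mod_cast hβ))
  have hZδ := hZ δ D.pos
  have h0 : ∀ L, 0 < moment (fun z => F (g.symm z)) L 0 := moment_zero_pos hg' hF D
  have hw := b.weight_nonneg hA
  have hm1 : moment (fun z => F (g.symm z)) (mean g F 0) 1 = 0 := by
    rw [moment_one D h0, sub_self, mul_zero]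
  have hvar : 0 ≤ variance g F 0 := by
    rw [variance]
    refine div_nonneg (integral_nonneg fun x => ?_) (integral_nonneg fun x => ?_)
    · exact mul_nonneg (mul_nonneg (hF.nonneg _) (Real.exp_pos _).le) (sq_nonneg _)
    · exact mul_nonneg (hF.nonneg _) (Real.exp_pos _).le
  have R3 : RelOrder δ 3 (ExpDecay.deviation (fun z => F (g.symm z)) (mean g F 0)
      (variance g F 0)) := by
    convert D.relOrder_deviation (mean g F 0) hvar using 3
    rw [hm1, moment_two h0]
    ring
  have R2 : ∀ v : ℝ, 0 ≤ v →
      RelOrder δ 2 (ExpDecay.deviation (fun z => F (g.symm z)) (mean g F 0) v) := by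
    intro v hv
    convert D.relOrder_deviation_two (mean g F 0) hv using 3
    rw [hm1]
    ring
  have R1 := fun L v (hv : 0 ≤ v) => D.relOrder_deviation_one L hv
  refine ⟨fun Λ hΛ => ⟨finiteTr_coarse b hA hd D hZδ hΛ, fun L v hv =>
    finiteTr_gaussEnsemble b hA hd hZδ L hv hΛ⟩, fun hneg => ?_, fun c hc hG => ?_⟩
  -- A real `r` strictly between `β₋` and `0` gives summability at both `r` and `-r`.
  · obtain ⟨r, hr1, hr2⟩ := EReal.lt_iff_exists_real_btwn.mp hneg
    have hr0 : r < 0 := by exact_mod_cast hr2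
    have hα : 0 < -r := by linarith
    have hZr : Summable fun i => b.weight A i * Real.exp (-(-(-r)) * g (b.E i)) := by
      rw [neg_neg]
      exact hB' r hr1
    have key : ∀ (L v : ℝ) (k : ℕ), 0 ≤ v →
        RelOrder δ k (ExpDecay.deviation (fun z => F (g.symm z)) L v) →
        ApproxBigO b A g F L v k := fun L v k hv hR =>
      approxBigO_of_sumOrder b hA hd D hZδ h0 hv
        (sumOrder_of_summable_neg hw hα (hZ _ hα) hZr D.pos hR)
    refine ⟨?_, fun v hv => ?_, fun L v hv => ?_⟩
    · exact_mod_cast key _ _ 3 hvar R3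
    · exact_mod_cast key _ _ 2 hv (R2 v hv)
    · exact_mod_cast key _ _ 1 hv (R1 L v hv)
  · have key : ∀ (L v : ℝ) (k : ℕ), 0 ≤ v → BelowGbarZero b A g L →
        RelOrder δ k (ExpDecay.deviation (fun z => F (g.symm z)) L v) →
        ApproxBigO b A g F L v (k / (1 + c)) := by
      intro L v k hv hL hR
      have hL' := hL.exists_gap
      have h2 := hG.gbar_bdd
      have h3 := hG.sigmaSq_bdd
      rw [gbar_eq b hA hd] at hL' h2 h3
      rw [sigmaSq_eq b hA hd] at h3
      exact approxBigO_of_sumOrder b hA hd D hZδ h0 hv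
        (sumOrder_of_conditions hw hZ hc D.pos hL' h2 h3 hR)
    refine ⟨?_, fun v hv => ?_, fun L v hv hL => ?_⟩
    · exact_mod_cast key _ _ 3 hvar hG.mean_lt R3
    · exact_mod_cast key _ _ 2 hv hG.mean_lt (R2 v hv)
    · exact_mod_cast key _ _ 1 hv hL (R1 L v hv)

end Traces

/-! ### Failure of faster rates -/

section LowerBounds

universe u v

variable {𝓗 : Type u} [NormedAddCommGroup 𝓗] [InnerProductSpace ℂ 𝓗] [CompleteSpace 𝓗]
  {H A : 𝓗 →ₗ.[ℂ] 𝓗} {ι : Type v} {g : ℝ ≃o ℝ} {F : ℝ → ℝ}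

/-- A lower bound for the leading term of the deviation along a sequence excludes a faster rate. -/
theorem not_approxLittleO (b : EnergyEigenbasis H ι) (hA : IsPositiveObservable A)
    (hd : ∀ i, b.ψ i ∈ A.domain) {δ : ℝ} (D : ExpDecay δ fun z => F (g.symm z))
    (hZ : Summable fun i => b.weight A i * Real.exp (-δ * g (b.E i)))
    (h0 : ∀ L, 0 < moment (fun z => F (g.symm z)) L 0) {L v c : ℝ} (hv : 0 ≤ v) (hc : 0 ≤ c)
    (k : ℕ) {P : ℝ → ℝ → ℝ}
    (hW : SumOrder (b.weight A) (fun i => g (b.E i)) L (1 / (1 + c))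
      fun Λ y => widened v Λ y - Real.exp (-y ^ 2 / (2 * Λ ^ 2)))
    (hS : SumOrder (b.weight A) (fun i => g (b.E i)) L ((k + 1) / (1 + c))
      fun Λ y => ExpDecay.deviation (fun z => F (g.symm z)) L v Λ y -
        Real.exp (-y ^ 2 / (2 * Λ ^ 2)) * P Λ y)
    {Λs B : ℕ → ℝ} (hΛs : Tendsto Λs atTop atTop) (hB0 : Tendsto B atTop (𝓝 0))
    (hεB : ∀ᶠ n in atTop, Λs n ^ (-(1 / (1 + c))) ≤ B n) {κ : ℝ} (hκ : 0 < κ)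
    (hpos : ∃ i, 0 < b.weight A i)
    (hlow : ∀ᶠ n in atTop, κ * B n ^ k * gaussSum (b.weight A) (fun i => g (b.E i)) L (Λs n) ≤
      |∑' i, b.weight A i * (Real.exp (-(g (b.E i) - L) ^ 2 / (2 * Λs n ^ 2)) *
        P (Λs n) (g (b.E i) - L))|) :
    ¬ ApproxLittleO b A g F L v (k / (1 + c)) := by
  rintro ⟨r, hr, hro⟩
  have hw := b.weight_nonneg hA
  obtain ⟨C, hC, hdev⟩ := abs_tsum_deviation_le b hA hd D hZ h0 hv (by positivity) hW hr
  obtain ⟨C₂, hC₂, hS⟩ := hS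
  -- Chosen so that the deviation allowed by the `o`-rate is at most a quarter of the leading term's
  -- lower bound. The remainder takes another quarter, and the two cannot add up to the whole.
  set ζ := κ / (4 * (C + 1)) with hζ
  have hζ0 : 0 < ζ := by positivity
  have hrb := hro.bound hζ0
  have hBs : ∀ᶠ n in atTop, C₂ * B n < κ / 4 := by
    have : Tendsto (fun n => C₂ * B n) atTop (𝓝 0) := by simpa using hB0.const_mul C₂
    exact this.eventually_lt_const (by positivity)
  obtain ⟨n, h1, h2, h3, h4, h5, h6, h7⟩ := ((hΛs.eventually hdev).and <|
    (hΛs.eventually hS).and <| (hΛs.eventually hrb).and <|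
    (hΛs.eventually (eventually_ge_atTop 1)).and <| hBs.and <| hεB.and hlow).exists
  set Λ := Λs n with hΛdef
  have hΛ0 : 0 < Λ := by linarith
  set N := gaussSum (b.weight A) (fun i => g (b.E i)) L Λ with hN
  have hN0 : 0 < N := by
    obtain ⟨j, hj⟩ := hpos
    exact (summable_gaussSum hw hZ L (by positivity : 0 < Λ ^ 2)).tsum_pos
      (fun i => mul_nonneg (hw i) (Real.exp_pos _).le) j (mul_pos hj (Real.exp_pos _))
  set ε := Λ ^ (-(1 / (1 + c))) with hε
  have hε0 : 0 < ε := by positivity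
  have hεk : ∀ j : ℕ, Λ ^ (-((j : ℝ) / (1 + c))) = ε ^ j := by
    intro j
    rw [hε, ← Real.rpow_natCast, ← Real.rpow_mul hΛ0.le]
    congr 1
    ring
  have hB : 0 < B n := hε0.trans_le h6
  have hεB' : ε ^ k ≤ B n ^ k := by gcongr
  have hr' : |r Λ| ≤ ζ * B n ^ k := by
    rw [Real.norm_eq_abs, Real.norm_eq_abs, hεk, abs_of_pos (pow_pos hε0 k)] at h3
    exact h3.trans (by gcongr)
  have hS' : ∑' i, b.weight A i * |ExpDecay.deviation (fun z => F (g.symm z)) L v Λ (g (b.E i) - L)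
      - Real.exp (-(g (b.E i) - L) ^ 2 / (2 * Λ ^ 2)) * P Λ (g (b.E i) - L)|
      ≤ κ / 4 * B n ^ k * N := by
    refine h2.2.trans ?_
    have e1 : Λ ^ (-(((k : ℝ) + 1) / (1 + c))) = ε ^ (k + 1) := by
      rw [← hεk]
      push_cast
      rfl
    rw [e1]
    refine mul_le_mul_of_nonneg_right ?_ hN0.le
    calc C₂ * ε ^ (k + 1) ≤ C₂ * B n ^ (k + 1) := by gcongr
      _ = C₂ * B n * B n ^ k := by ring
      _ ≤ _ := by gcongr
  have s1 := summable_smoothed hw D hZ L hΛ0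
  have s2 := summable_widened hw hZ L hv hΛ0
  have sd : Summable fun i => b.weight A i *
      ExpDecay.deviation (fun z => F (g.symm z)) L v Λ (g (b.E i) - L) := by
    refine (s1.sub (s2.mul_left (moment (fun z => F (g.symm z)) L 0))).congr fun i => ?_
    rw [ExpDecay.deviation]
    ring
  have sr : Summable fun i => b.weight A i *
      (ExpDecay.deviation (fun z => F (g.symm z)) L v Λ (g (b.E i) - L)
      - Real.exp (-(g (b.E i) - L) ^ 2 / (2 * Λ ^ 2)) * P Λ (g (b.E i) - L)) := by
    refine Summable.of_norm (h2.1.congr fun i => ?_)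
    rw [Real.norm_eq_abs, abs_mul, abs_of_nonneg (hw i)]
  have hsplit : ∑' i, b.weight A i * (Real.exp (-(g (b.E i) - L) ^ 2 / (2 * Λ ^ 2)) *
        P Λ (g (b.E i) - L)) = ∑' i, b.weight A i *
      ExpDecay.deviation (fun z => F (g.symm z)) L v Λ (g (b.E i) - L) -
      ∑' i, b.weight A i *
      (ExpDecay.deviation (fun z => F (g.symm z)) L v Λ (g (b.E i) - L)
      - Real.exp (-(g (b.E i) - L) ^ 2 / (2 * Λ ^ 2)) * P Λ (g (b.E i) - L)) := by
    rw [← sd.tsum_sub sr]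
    refine tsum_congr fun i => ?_
    ring
  have habs : |∑' i, b.weight A i *
      (ExpDecay.deviation (fun z => F (g.symm z)) L v Λ (g (b.E i) - L)
      - Real.exp (-(g (b.E i) - L) ^ 2 / (2 * Λ ^ 2)) * P Λ (g (b.E i) - L))|
      ≤ κ / 4 * B n ^ k * N := by
    refine le_trans ?_ hS'
    rw [← Real.norm_eq_abs]
    refine (norm_tsum_le_tsum_norm sr.norm).trans (le_of_eq (tsum_congr fun i => ?_))
    rw [Real.norm_eq_abs, abs_mul, abs_of_nonneg (hw i)]
  have hdev' : C * |r Λ| * N ≤ κ / 4 * B n ^ k * N := by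
    refine mul_le_mul_of_nonneg_right ?_ hN0.le
    calc C * |r Λ| ≤ C * (ζ * B n ^ k) := by gcongr
      _ = C * ζ * B n ^ k := by ring
      _ ≤ κ / 4 * B n ^ k := by
        gcongr
        rw [hζ, mul_div_assoc', div_le_div_iff₀ (by positivity) (by norm_num)]
        nlinarith
  rw [hsplit] at h7
  have hfin := h7.trans (abs_sub _ _)
  have hp : 0 < κ * B n ^ k * N := by positivity
  linarith

end LowerBounds

/-! ### Failure of faster rates for negative `β₋`: an equidistant spectrum -/

section GibbsExample

theorem relOrder_widened_one {δ : ℝ} (hδ : 0 < δ) {v : ℝ} (hv : 0 ≤ v) :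
    RelOrder δ 1 fun Λ y => widened v Λ y - Real.exp (-y ^ 2 / (2 * Λ ^ 2)) := by
  have m1 := (RelOrder.monomial hδ 2 0).of_succ.const_mul (v / 2)
  have m2 := (RelOrder.monomial hδ 0 2).of_succ.const_mul (-v / 2)
  convert ((relOrder_widened hδ hv).of_succ.of_succ.add m1).add m2 using 3
  ring

/-- Dominated convergence: after multiplication by `Λ²`, the Gaussian tends to `1` and the term
quadratic in `y` to `0`, so that only `y m₁` and `-m₂ / 2` survive. Two moments of the weights
suffice as a bound. -/
theorem tendsto_tsum_leading {ι : Type*} {w y : ι → ℝ} (hw : ∀ i, 0 ≤ w i)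
    (hs : Summable fun i => w i * (1 + |y i|) ^ 2) (m₁ m₂ : ℝ) :
    Tendsto (fun Λ : ℝ => Λ ^ 2 * ∑' i, w i * (Real.exp (-y i ^ 2 / (2 * Λ ^ 2)) *
      (y i / Λ ^ 2 * m₁ + ((y i / Λ ^ 2) ^ 2 - (1 / Λ) ^ 2) / 2 * m₂))) atTop
      (𝓝 (∑' i, w i * (y i * m₁ - m₂ / 2))) := by
  have hΛ2 : Tendsto (fun Λ : ℝ => (Λ ^ 2)⁻¹) atTop (𝓝 0) :=
    (tendsto_pow_atTop two_ne_zero).inv_tendsto_atTop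
  have hmain : Tendsto (fun Λ : ℝ => ∑' i, w i * (Real.exp (-y i ^ 2 / 2 * (Λ ^ 2)⁻¹) *
      (y i * m₁ + (y i ^ 2 * (Λ ^ 2)⁻¹ - 1) / 2 * m₂))) atTop
      (𝓝 (∑' i, w i * (y i * m₁ - m₂ / 2))) := by
    refine tendsto_tsum_of_dominated_convergence
      (bound := fun i => (|m₁| + |m₂|) * (w i * (1 + |y i|) ^ 2)) (hs.mul_left _)
      (fun i => ?_) ?_
    · have h1 : Tendsto (fun Λ : ℝ => Real.exp (-y i ^ 2 / 2 * (Λ ^ 2)⁻¹)) atTop (𝓝 1) := by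
        have := (Real.continuous_exp.tendsto _).comp (hΛ2.const_mul (-y i ^ 2 / 2))
        simpa [Function.comp_def] using this
      have h2 : Tendsto (fun Λ : ℝ => y i * m₁ + (y i ^ 2 * (Λ ^ 2)⁻¹ - 1) / 2 * m₂) atTop
          (𝓝 (y i * m₁ + (y i ^ 2 * 0 - 1) / 2 * m₂)) :=
        ((((hΛ2.const_mul _).sub_const 1).div_const 2).mul_const m₂).const_add _
      convert (h1.mul h2).const_mul (w i) using 2
      ring
    · filter_upwards [eventually_ge_atTop 1] with Λ hΛ i
      have hi0 : 0 ≤ (Λ ^ 2)⁻¹ := by positivity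
      have hi1 : (Λ ^ 2)⁻¹ ≤ 1 := inv_le_one_of_one_le₀ (by nlinarith)
      rw [Real.norm_eq_abs, abs_mul, abs_of_nonneg (hw i), abs_mul, abs_of_pos (Real.exp_pos _),
        mul_left_comm (|m₁| + |m₂|)]
      refine mul_le_mul_of_nonneg_left ?_ (hw i)
      have h1 : Real.exp (-y i ^ 2 / 2 * (Λ ^ 2)⁻¹) ≤ 1 := by
        rw [Real.exp_le_one_iff]
        have : 0 ≤ y i ^ 2 / 2 * (Λ ^ 2)⁻¹ := by positivity
        linarith
      have h2 : |y i * m₁ + (y i ^ 2 * (Λ ^ 2)⁻¹ - 1) / 2 * m₂|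
          ≤ (|m₁| + |m₂|) * (1 + |y i|) ^ 2 := by
        refine (abs_add_le _ _).trans ?_
        rw [abs_mul, abs_mul]
        have h3 : |y i| ≤ (1 + |y i|) ^ 2 := by nlinarith [abs_nonneg (y i)]
        have h4 : |(y i ^ 2 * (Λ ^ 2)⁻¹ - 1) / 2| ≤ (1 + |y i|) ^ 2 := by
          have h5 : y i ^ 2 * (Λ ^ 2)⁻¹ ≤ |y i| ^ 2 * 1 := by rw [sq_abs]; gcongr
          have h6 : 0 ≤ y i ^ 2 * (Λ ^ 2)⁻¹ := by positivity
          rw [abs_le]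
          constructor <;> nlinarith [abs_nonneg (y i)]
        nlinarith [mul_le_mul_of_nonneg_right h3 (abs_nonneg m₁),
          mul_le_mul_of_nonneg_right h4 (abs_nonneg m₂)]
      calc _ ≤ 1 * ((|m₁| + |m₂|) * (1 + |y i|) ^ 2) :=
            mul_le_mul h1 h2 (abs_nonneg _) zero_le_one
        _ = _ := one_mul _
  refine hmain.congr' ?_
  filter_upwards [eventually_gt_atTop 0] with Λ hΛ
  rw [← tsum_mul_left]
  refine tsum_congr fun i => ?_
  have : -y i ^ 2 / 2 * (Λ ^ 2)⁻¹ = -y i ^ 2 / (2 * Λ ^ 2) := by field_simp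
  rw [this]
  field_simp

variable {g : ℝ ≃o ℝ} {F : ℝ → ℝ}

/-- Exponential decay of the transformed density at some positive `β`, together with levels growing
at least linearly, gives a geometric majorant; this makes `Tr F(H)` finite. -/
theorem summable_density_comp {βp : EReal} (hF : IsSmoothDensity F)
    (hβp : 0 < βp) (hdecay : ∀ β : ℝ, (β : EReal) < βp →
      IsRapidlyDecreasing fun x => Real.exp (β * x) * F (g.symm x)) {x : ℕ → ℝ} {p : ℝ}
    (hx : ∀ n, p + n ≤ x n) : Summable fun n => F (g.symm (x n)) := by
  obtain ⟨β, h1, h2⟩ := EReal.lt_iff_exists_real_btwn.mp hβp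
  have hβ : 0 < β := by exact_mod_cast h1
  obtain ⟨φ, hφ⟩ := hdecay β h2
  obtain ⟨C, hC⟩ := φ.decay 0 0
  simp only [pow_zero, one_mul, norm_iteratedFDeriv_zero] at hC
  have hle : ∀ n, F (g.symm (x n)) ≤ C * Real.exp (-β * p) * Real.exp (-β) ^ n := by
    intro n
    have h3 := hC.2 (x n)
    rw [hφ, Real.norm_eq_abs, abs_of_nonneg (mul_nonneg (Real.exp_pos _).le (hF.nonneg _))] at h3
    have h4 : F (g.symm (x n)) = Real.exp (-β * x n) *
        (Real.exp (β * x n) * F (g.symm (x n))) := by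
      rw [← mul_assoc, ← Real.exp_add]; simp
    have h5 : Real.exp (-β * x n) ≤ Real.exp (-β * p) * Real.exp (-β) ^ n := by
      rw [← Real.exp_nat_mul, ← Real.exp_add, Real.exp_le_exp]
      nlinarith [hx n]
    rw [h4]
    calc _ ≤ (Real.exp (-β * p) * Real.exp (-β) ^ n) * C :=
          mul_le_mul h5 h3 (mul_nonneg (Real.exp_pos _).le (hF.nonneg _)) (by positivity)
      _ = _ := by ring
  refine Summable.of_nonneg_of_le (fun n => hF.nonneg _) hle (Summable.mul_left _ ?_)
  exact summable_geometric_of_lt_one (Real.exp_pos _).le (Real.exp_lt_one_iff.mpr (by linarith))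

theorem tendsto_symm_comp {x : ℕ → ℝ} {p : ℝ} (hx : ∀ n, p + n ≤ x n) :
    Tendsto (fun n => g.symm (x n)) atTop atTop :=
  g.symm.tendsto_atTop.comp (tendsto_atTop_mono hx
    (tendsto_atTop_add_const_left _ _ tendsto_natCast_atTop_atTop))

theorem summable_exp_neg_two_mul {β : ℝ} (hβ : -2 < β) (p : ℝ) :
    Summable fun n : ℕ => Real.exp (-2 * n) * Real.exp (-β * (p + n)) := by
  have h : Summable fun n : ℕ => Real.exp (-β * p) * Real.exp (-(2 + β)) ^ n :=
    (summable_geometric_of_lt_one (Real.exp_pos _).le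
      (Real.exp_lt_one_iff.mpr (by linarith))).mul_left _
  refine h.congr fun n => ?_
  rw [← Real.exp_nat_mul, ← Real.exp_add, ← Real.exp_add]
  congr 1
  ring

/-- For other parameters the rate `o(Λ^{-2})` fails for the equidistant spectrum with a Gibbs state
as observable. -/
theorem exists_system_not_approxLittleO_two (hg' : ContDiff ℝ ∞ g.symm) (hF : IsSmoothDensity F)
    {βp : EReal} (hβp : 0 < βp) (hdecay : ∀ β : ℝ, (β : EReal) < βp →
      IsRapidlyDecreasing fun x => Real.exp (β * x) * F (g.symm x)) {L v : ℝ} (hv : 0 ≤ v)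
    (hne : L ≠ mean g F 0 ∨ v ≠ variance g F 0) :
    ∃ (H A : HilbertSeq →ₗ.[ℂ] HilbertSeq) (b : EnergyEigenbasis H ℕ) (βm : ℝ),
      IsSystem b A F ∧ βm < 0 ∧ (∀ β : ℝ, βm < β → GBounded b A g β) ∧
      ¬ ApproxLittleO b A g F L v 2 := by
  obtain ⟨δ, D⟩ := exists_expDecay hg' hF hβp hdecay
  have h0 : ∀ L, 0 < moment (fun z => F (g.symm z)) L 0 := moment_zero_pos hg' hF D
  set m₁ := moment (fun z => F (g.symm z)) L 1 with hm₁
  set m₂ := moment (fun z => F (g.symm z)) L 2 - v * moment (fun z => F (g.symm z)) L 0 with hm₂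
  set w : ℕ → ℝ := fun n => Real.exp (-2 * n) with hwdef
  have hw : ∀ n, 0 ≤ w n := fun n => (Real.exp_pos _).le
  have hZ : ∀ p β : ℝ, -2 < β → Summable fun n => w n * Real.exp (-β * (p + n)) :=
    fun p β hβ => summable_exp_neg_two_mul hβ p
  have hmom : ∀ p : ℝ, Summable fun n : ℕ => w n * (1 + |p + n - L|) ^ 2 := by
    intro p
    have h := summable_abs_pow_mul_exp (x := fun n : ℕ => p + n) hw (by norm_num : (-1 : ℝ) < 0)
      one_pos (hZ p (-1) (by norm_num)) (hZ p 1 (by norm_num)) 2 (1 + |L|)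
    refine Summable.of_nonneg_of_le (fun n => mul_nonneg (hw n) (by positivity)) (fun n => ?_) h
    refine mul_le_mul_of_nonneg_left ?_ (hw n)
    rw [neg_zero, zero_mul, Real.exp_zero, mul_one]
    refine pow_le_pow_left₀ (by positivity) ?_ 2
    rw [abs_of_pos (by positivity : 0 < 1 + |L|)]
    linarith [abs_sub (p + n) L]
  have hsw : Summable w := by
    have := hZ 0 0 (by norm_num)
    simpa using this
  have hsn : Summable fun n => w n * n := by
    refine Summable.of_nonneg_of_le (fun n => mul_nonneg (hw n) (Nat.cast_nonneg n))
      (fun n => ?_) (hmom L)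
    refine mul_le_mul_of_nonneg_left ?_ (hw n)
    rw [add_sub_cancel_left, Nat.abs_cast]
    nlinarith [(Nat.cast_nonneg n : (0 : ℝ) ≤ n)]
  set S₀ := ∑' n, w n with hS₀
  have hS₀pos : 0 < S₀ := hsw.tsum_pos hw 0 (Real.exp_pos _)
  set S₁ := ∑' n, w n * (n : ℝ) with hS₁
  have hlim : ∀ p : ℝ, ∑' n : ℕ, w n * ((p + n - L) * m₁ - m₂ / 2)
      = m₁ * S₁ + (m₁ * (p - L) - m₂ / 2) * S₀ := by
    intro p
    rw [hS₀, hS₁, ← tsum_mul_left, ← tsum_mul_left,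
      ← (hsn.mul_left _).tsum_add (hsw.mul_left _)]
    refine tsum_congr fun n => ?_
    ring
  -- The limit is affine in the lowest level `p` with slope `m₁ S₀`. If `m₁ ≠ 0`, a small shift
  -- inside the open set where the density is positive avoids its zero. If `m₁ = 0`, then `L` is the
  -- mean, so `v` is not the variance and the constant `-m₂ S₀ / 2` is nonzero.
  obtain ⟨p, hp, hℓ⟩ : ∃ p, 0 < F (g.symm p) ∧
      m₁ * S₁ + (m₁ * (p - L) - m₂ / 2) * S₀ ≠ 0 := by
    obtain ⟨z, hz⟩ := exists_pos (g := g) hF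
    by_cases hz0 : m₁ * S₁ + (m₁ * (z - L) - m₂ / 2) * S₀ = 0
    swap
    · exact ⟨z, hz, hz0⟩
    have hm1 : m₁ ≠ 0 := by
      intro h
      have hL : L = mean g F 0 := by
        rw [hm₁, moment_one D h0] at h
        rcases mul_eq_zero.mp h with h | h
        · exact absurd h (h0 L).ne'
        · linarith
      have hv' : v ≠ variance g F 0 := hne.resolve_left (not_not.mpr hL)
      rw [h, zero_mul, zero_mul, zero_add, zero_sub] at hz0
      have h3 : m₂ = 0 := by
        rcases mul_eq_zero.mp hz0 with h | h
        · linarith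
        · exact absurd h hS₀pos.ne'
      rw [hm₂, hL, moment_two h0, ← sub_mul] at h3
      rcases mul_eq_zero.mp h3 with h | h
      · exact hv' (by linarith)
      · exact (h0 _).ne' h
    obtain ⟨r, hr, hball⟩ := Metric.isOpen_iff.mp (isOpen_pos hg' hF) z hz
    refine ⟨z + r / 2, hball ?_, fun h => ?_⟩
    · rw [Metric.mem_ball, Real.dist_eq, add_sub_cancel_left, abs_of_pos (by linarith)]
      linarith
    · have : m₁ * (r / 2) * S₀ = 0 := by linear_combination h - hz0
      have h2 : m₁ * (r / 2) * S₀ ≠ 0 :=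
        mul_ne_zero (mul_ne_zero hm1 (by linarith)) hS₀pos.ne'
      exact h2 this
  set a : ℕ → ℝ := fun n => g.symm (p + n) with hadef
  have ha : Tendsto a atTop atTop := tendsto_symm_comp (fun n => le_refl (p + (n : ℝ)))
  set b := diagEigenbasis a ha with hb
  have hA : IsPositiveObservable (diagOp w) := isPositiveObservable_diagOp hw
  have hd := diagEigenbasis_mem_domain a w ha
  have hwt : b.weight (diagOp w) = w := funext fun n => diagEigenbasis_weight a w ha n
  have hE : ∀ n, g (b.E n) = p + n := fun n => g.apply_symm_apply _
  have hsys : IsSystem b (diagOp w) F := by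
    refine isSystem_diag ha hw hF.nonneg
      (summable_density_comp hF hβp hdecay (fun n => le_refl (p + (n : ℝ)))) ?_
    simpa [a] using hp
  have hGB : ∀ β : ℝ, -1 < β → GBounded b (diagOp w) g β := by
    intro β hβ
    rw [gBounded_iff b hA hd, hwt]
    simp_rw [hE]
    exact hZ p β (by linarith)
  refine ⟨diagOp a, diagOp w, b, -1, hsys, by norm_num, hGB, ?_⟩
  have hSO : ∀ {k : ℕ} {R : ℝ → ℝ → ℝ}, RelOrder δ k R →
      SumOrder (b.weight (diagOp w)) (fun i => g (b.E i)) L k R := by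
    intro k R hR
    rw [hwt]
    simp_rw [hE]
    exact sumOrder_of_summable_neg hw (by norm_num : (0 : ℝ) < 1 / 2)
      (hZ p _ (by norm_num)) (hZ p _ (by norm_num)) D.pos hR
  set ℓ := m₁ * S₁ + (m₁ * (p - L) - m₂ / 2) * S₀ with hℓdef
  have hlead := tendsto_tsum_leading hw (hmom p) m₁ m₂
  rw [hlim p, ← hℓdef] at hlead
  set Λs : ℕ → ℝ := fun n => n with hΛs
  have hΛt : Tendsto Λs atTop atTop := tendsto_natCast_atTop_atTop
  -- The value `c = 0` makes every order worth `1 / Λ`. Both leading terms are kept: since `y` does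
  -- not scale with `Λ`, the first-order one contributes at the rate `Λ^(-2)` as well.
  have hres := not_approxLittleO b hA hd D (L := L) (v := v) (c := 0)
    (P := fun Λ y => y / Λ ^ 2 * m₁ + ((y / Λ ^ 2) ^ 2 - (1 / Λ) ^ 2) / 2 * m₂)
    (κ := |ℓ| / (2 * S₀)) (B := fun n => 1 / Λs n)
    ((gBounded_iff b hA hd δ).mp (hGB δ (by linarith [D.pos]))) h0 hv le_rfl 2
    (by simpa using hSO (relOrder_widened_one D.pos hv)) (by
      have := hSO (D.relOrder_deviation L hv)
      norm_num at this ⊢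
      exact this) hΛt (by
      simp only [one_div]
      exact hΛt.inv_tendsto_atTop)
    (Eventually.of_forall fun n => by
      rw [add_zero, div_one, Real.rpow_neg_one, one_div]) (by positivity)
    ⟨0, by rw [hwt]; exact Real.exp_pos _⟩ ?_
  · simpa using hres
  · have hhalf : ∀ᶠ Λ : ℝ in atTop, |ℓ| / 2 < |Λ ^ 2 * ∑' n : ℕ, w n *
        (Real.exp (-(p + n - L) ^ 2 / (2 * Λ ^ 2)) * ((p + n - L) / Λ ^ 2 * m₁ +
        (((p + n - L) / Λ ^ 2) ^ 2 - (1 / Λ) ^ 2) / 2 * m₂))| :=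
      hlead.abs.eventually_const_lt (by
        have := abs_pos.mpr hℓ
        linarith)
    filter_upwards [hΛt.eventually hhalf, hΛt.eventually (eventually_ge_atTop 1)] with n hn h1
    rw [hwt]
    simp_rw [hE]
    set Λ := Λs n
    have hΛ0 : 0 < Λ := by linarith
    have hNle : gaussSum w (fun i : ℕ => p + i) L Λ ≤ S₀ := by
      refine Summable.tsum_le_tsum (fun i => ?_)
        (summable_gaussSum hw (hZ p 0 (by norm_num)) L (by positivity : 0 < Λ ^ 2)) hsw
      refine mul_le_of_le_one_right (hw i) (Real.exp_le_one_iff.mpr ?_)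
      rw [neg_div, neg_nonpos]
      positivity
    rw [abs_mul, abs_of_pos (by positivity : 0 < Λ ^ 2)] at hn
    have hp1 : |ℓ| / (2 * S₀) * (1 / Λ) ^ 2 * gaussSum w (fun i : ℕ => p + i) L Λ
        ≤ |ℓ| / (2 * S₀) * (1 / Λ) ^ 2 * S₀ := by gcongr
    refine hp1.trans ?_
    have hp2 : |ℓ| / (2 * S₀) * (1 / Λ) ^ 2 * S₀ = |ℓ| / 2 / Λ ^ 2 := by field_simp
    rw [hp2, div_le_iff₀ (by positivity), mul_comm]
    exact hn.le

end GibbsExample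

/-! ### Sparse spectra with prescribed growth of the canonical mean -/

section Sparse

/-- The parallel axis identity. A single second moment about the dominant level will control both
the variance and the distance of the mean from that level. -/
theorem canonMean_moment_identity {ι : Type*} {w x : ι → ℝ} (hw : ∀ i, 0 ≤ w i)
    (hZ : ∀ β : ℝ, 0 < β → Summable fun i => w i * Real.exp (-β * x i)) (hpos : ∃ i, 0 < w i)
    {β : ℝ} (hβ : 0 < β) (a : ℝ) :
    ∑' i, w i * (Real.exp (-β * x i) * (x i - a) ^ 2) =
      (∑' i, w i * Real.exp (-β * x i)) * (canonVar w x β + (canonMean w x β - a) ^ 2) := by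
  set m := canonMean w x β with hm
  set Z := ∑' i, w i * Real.exp (-β * x i) with hZdef
  have hZ0 : 0 < Z := partitionFn_pos hw hZ hpos hβ
  have s0 := hZ β hβ
  have s1 := summable_sub_pow_mul_exp hw hZ hβ 1 0
  have s2 := summable_sub_pow_mul_exp hw hZ hβ 2 m
  simp only [pow_one, sub_zero] at s1
  have e1 : ∑' i, w i * (Real.exp (-β * x i) * x i) = m * Z := by
    rw [hm, canonMean, ← hZdef, div_mul_cancel₀ _ hZ0.ne']
  have e2 : ∑' i, w i * (Real.exp (-β * x i) * (x i - m) ^ 2) = canonVar w x β * Z := by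
    rw [canonVar, ← hm, ← hZdef, div_mul_cancel₀ _ hZ0.ne']
  have e3 : ∀ i, w i * (Real.exp (-β * x i) * (x i - a) ^ 2) =
      w i * (Real.exp (-β * x i) * (x i - m) ^ 2) +
      (2 * (m - a) * (w i * (Real.exp (-β * x i) * x i)) +
        (a ^ 2 - m ^ 2) * (w i * Real.exp (-β * x i))) := fun i => by ring
  rw [tsum_congr e3, s2.tsum_add ((s1.mul_left _).add (s0.mul_left _)),
    (s1.mul_left _).tsum_add (s0.mul_left _), tsum_mul_left, tsum_mul_left, e1, e2, ← hZdef]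
  ring

/-- With truncated subtraction the exponent is `|i - m|`. -/
theorem sum_half_pow_le (m : ℕ) :
    ∑ i ∈ Finset.range m, (1 / 2 : ℝ) ^ ((i - m) + (m - i)) ≤ 1 := by
  induction m with
  | zero => simp
  | succ m ih =>
    rw [Finset.sum_range_succ]
    have h : ∀ i ∈ Finset.range m, (1 / 2 : ℝ) ^ ((i - (m + 1)) + (m + 1 - i))
        = 1 / 2 * (1 / 2 : ℝ) ^ ((i - m) + (m - i)) := by
      intro i hi
      rw [Finset.mem_range] at hi
      have : (i - (m + 1)) + (m + 1 - i) = (i - m) + (m - i) + 1 := by omega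
      rw [this, pow_succ]
      ring
    rw [Finset.sum_congr rfl h, ← Finset.mul_sum]
    have h2 : (m - (m + 1)) + (m + 1 - m) = 1 := by omega
    rw [h2]
    linarith

theorem summable_half_pow (m : ℕ) :
    Summable (fun i : ℕ => (1 / 2 : ℝ) ^ ((i - m) + (m - i))) ∧
      ∑' i : ℕ, (1 / 2 : ℝ) ^ ((i - m) + (m - i)) ≤ 3 := by
  have h : ∀ i : ℕ, (1 / 2 : ℝ) ^ ((i + m - m) + (m - (i + m))) = (1 / 2) ^ i := by
    intro i
    congr 1
    omega
  have hs : Summable (fun i : ℕ => (1 / 2 : ℝ) ^ ((i - m) + (m - i))) := by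
    rw [← summable_nat_add_iff m]
    simp_rw [h]
    exact summable_geometric_two
  refine ⟨hs, ?_⟩
  rw [← hs.sum_add_tsum_nat_add m]
  simp_rw [h]
  rw [tsum_geometric_two]
  linarith [sum_half_pow_le m]

/-- Levels `x` with gaps `D` and weights `w` such that the canonical weights of the levels `n` and
`n + 1` agree at inverse temperature `1 / t n`. -/
structure SparseSpectrum (t D x w : ℕ → ℝ) (ρ M : ℝ) : Prop where
  one_le_t : ∀ n, 1 ≤ t n
  t_lt : ∀ n, t n < t (n + 1)
  t_le : ∀ n, t (n + 1) ≤ 2 * t n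
  t_tendsto : Tendsto t atTop atTop
  one_le_D : ∀ n, 1 ≤ D n
  D_mono : ∀ n, D n ≤ D (n + 1)
  D_le : ∀ n, D (n + 1) ≤ ρ * D n
  x_succ : ∀ n, x (n + 1) = x n + D n
  w_zero : w 0 = 1
  w_succ : ∀ n, w (n + 1) = w n * Real.exp (D n / t n)
  gap : ∀ n, M / 2 ≤ (1 / t n - 1 / t (n + 1)) * D n
  le_ratio : ∀ n, M ≤ D n / t n
  one_le_ρ : 1 ≤ ρ
  M_large : 8 * ρ ^ 2 ≤ Real.exp (M / 2)

namespace SparseSpectrum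

variable {t D x w : ℕ → ℝ} {ρ M : ℝ} (S : SparseSpectrum t D x w ρ M)

include S

theorem t_pos (n : ℕ) : 0 < t n := zero_lt_one.trans_le (S.one_le_t n)

theorem D_pos (n : ℕ) : 0 < D n := zero_lt_one.trans_le (S.one_le_D n)

theorem w_pos (n : ℕ) : 0 < w n := by
  induction n with
  | zero => rw [S.w_zero]; exact one_pos
  | succ n ih => rw [S.w_succ]; positivity

theorem one_le_w (n : ℕ) : 1 ≤ w n := by
  induction n with
  | zero => rw [S.w_zero]
  | succ n ih =>
    rw [S.w_succ]
    have := S.t_pos n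
    have := S.D_pos n
    exact one_le_mul_of_one_le_of_one_le ih (Real.one_le_exp (by positivity))

theorem strictMono_t : StrictMono t := strictMono_nat_of_lt_succ S.t_lt

theorem monotone_D : Monotone D := monotone_nat_of_le_succ S.D_mono

theorem strictMono_x : StrictMono x :=
  strictMono_nat_of_lt_succ fun n => by rw [S.x_succ]; linarith [S.D_pos n]

theorem add_le_x (n : ℕ) : x 0 + n ≤ x n := by
  induction n with
  | zero => simp
  | succ n ih =>
    rw [S.x_succ]
    push_cast
    linarith [S.one_le_D n]

theorem q_le : 8 * ρ ^ 2 * Real.exp (-(M / 2)) ≤ 1 := by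
  rw [Real.exp_neg, ← div_eq_mul_inv, div_le_one (Real.exp_pos _)]
  exact S.M_large

theorem q_le_half : Real.exp (-(M / 2)) ≤ 1 / 2 := by
  have h1 := S.q_le
  have h2 := S.one_le_ρ
  have h3 := Real.exp_pos (-(M / 2))
  have h4 : Real.exp (-(M / 2)) ≤ ρ ^ 2 * Real.exp (-(M / 2)) :=
    le_mul_of_one_le_left h3.le (one_le_pow₀ h2)
  linarith

theorem canonWeight_succ (β : ℝ) (n : ℕ) : w (n + 1) * Real.exp (-β * x (n + 1)) =
    w n * Real.exp (-β * x n) * Real.exp ((1 / t n - β) * D n) := by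
  rw [S.w_succ, S.x_succ, mul_assoc, mul_assoc, ← Real.exp_add, ← Real.exp_add]
  congr 2
  ring

/-- Once `β ≥ 1 / t m`, level `m + 1` weighs no more than level `m`. Each further step loses a
factor `exp (-M / 2)`, because its balancing temperature lies beyond the previous one by the margin
`gap`, and the gaps `D` increase. -/
theorem canonWeight_above {β : ℝ} {m : ℕ} (hβ : 1 / t m ≤ β) (j : ℕ) :
    w (m + 1 + j) * Real.exp (-β * x (m + 1 + j)) ≤
      Real.exp (-(M / 2)) ^ j * (w m * Real.exp (-β * x m)) := by
  induction j with
  | zero =>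
    rw [add_zero, S.canonWeight_succ, pow_zero, one_mul]
    refine mul_le_of_le_one_right (mul_pos (S.w_pos m) (Real.exp_pos _)).le
      (Real.exp_le_one_iff.mpr ?_)
    exact mul_nonpos_of_nonpos_of_nonneg (by linarith) (S.D_pos m).le
  | succ j ih =>
    have e : m + 1 + (j + 1) = (m + 1 + j) + 1 := by ring
    rw [e, S.canonWeight_succ, pow_succ]
    have h1 : Real.exp ((1 / t (m + 1 + j) - β) * D (m + 1 + j)) ≤ Real.exp (-(M / 2)) := by
      rw [Real.exp_le_exp]
      have e' : m + 1 + j = (m + j) + 1 := by ring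
      rw [e']
      have g := S.gap (m + j)
      have h2 : 1 / t (m + j) ≤ 1 / t m :=
        one_div_le_one_div_of_le (S.t_pos m) (S.strictMono_t.monotone (by omega))
      have h3 : 1 / t (m + j + 1) ≤ 1 / t (m + j) :=
        one_div_le_one_div_of_le (S.t_pos _) (S.t_lt _).le
      have h4 := S.D_mono (m + j)
      have h5 := S.D_pos (m + j + 1)
      nlinarith [mul_le_mul_of_nonneg_left h4 (sub_nonneg.mpr h3)]
    calc _ ≤ Real.exp (-(M / 2)) ^ j * (w m * Real.exp (-β * x m)) * Real.exp (-(M / 2)) :=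
          mul_le_mul ih h1 (Real.exp_pos _).le
            (mul_nonneg (by positivity) (mul_pos (S.w_pos m) (Real.exp_pos _)).le)
      _ = _ := by ring

theorem canonWeight_below {β : ℝ} {m : ℕ} (hβ : β ≤ 1 / t m) (j : ℕ) : ∀ n, n + j = m →
    w n * Real.exp (-β * x n) ≤
      Real.exp (-(M / 2)) ^ j * (w (m + 1) * Real.exp (-β * x (m + 1))) := by
  induction j with
  | zero =>
    rintro n rfl
    rw [add_zero] at hβ ⊢
    rw [S.canonWeight_succ, pow_zero, one_mul]
    refine le_mul_of_one_le_right (mul_pos (S.w_pos n) (Real.exp_pos _)).le (Real.one_le_exp ?_)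
    exact mul_nonneg (by linarith) (S.D_pos n).le
  | succ j ih =>
    intro n hn
    have ih' := ih (n + 1) (by omega)
    have h1 : M / 2 ≤ (1 / t n - β) * D n := by
      refine (S.gap n).trans (mul_le_mul_of_nonneg_right ?_ (S.D_pos n).le)
      have h2 : 1 / t m ≤ 1 / t (n + 1) :=
        one_div_le_one_div_of_le (S.t_pos _) (S.strictMono_t.monotone (by omega))
      linarith
    rw [S.canonWeight_succ] at ih'
    set a := w n * Real.exp (-β * x n)
    have ha : 0 ≤ a := (mul_pos (S.w_pos n) (Real.exp_pos _)).le
    have h3 : a * Real.exp (M / 2) ≤ a * Real.exp ((1 / t n - β) * D n) :=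
      mul_le_mul_of_nonneg_left (Real.exp_le_exp.mpr h1) ha
    calc a = Real.exp (-(M / 2)) * (a * Real.exp (M / 2)) := by
          rw [mul_left_comm, ← Real.exp_add]; simp
      _ ≤ Real.exp (-(M / 2)) * _ :=
          mul_le_mul_of_nonneg_left (h3.trans ih') (Real.exp_pos _).le
      _ = _ := by rw [pow_succ]; ring

theorem summable_canonWeight {β : ℝ} (hβ : 0 < β) :
    Summable fun n => w n * Real.exp (-β * x n) := by
  obtain ⟨m, hm⟩ := (S.t_tendsto.eventually_ge_atTop (1 / β)).exists
  have hm' : 1 / t m ≤ β := by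
    rw [div_le_iff₀ (S.t_pos m), mul_comm, ← div_le_iff₀ hβ]
    exact hm
  rw [← summable_nat_add_iff (m + 1)]
  refine Summable.of_nonneg_of_le (fun j => (mul_pos (S.w_pos _) (Real.exp_pos _)).le)
    (fun j => ?_) ((summable_geometric_of_lt_one (Real.exp_pos _).le
      (lt_of_le_of_lt S.q_le_half (by norm_num))).mul_right (w m * Real.exp (-β * x m)))
  rw [add_comm j (m + 1)]
  exact S.canonWeight_above hm' j

/-- Between two successive balancing points level `m + 1` dominates, with geometric decay on both
sides. The factor `exp (M / 2)` pays for the first step away from it, which may be lossless. -/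
theorem canonWeight_le {β : ℝ} {m : ℕ} (h1 : 1 / t (m + 1) ≤ β) (h2 : β ≤ 1 / t m) (n : ℕ) :
    w n * Real.exp (-β * x n) ≤ Real.exp (M / 2) *
      Real.exp (-(M / 2)) ^ ((n - (m + 1)) + (m + 1 - n)) *
      (w (m + 1) * Real.exp (-β * x (m + 1))) := by
  have hE : Real.exp (M / 2) * Real.exp (-(M / 2)) = 1 := by rw [← Real.exp_add]; simp
  set q := Real.exp (-(M / 2)) with hq
  have hq0 : 0 < q := Real.exp_pos _
  set a := w (m + 1) * Real.exp (-β * x (m + 1)) with ha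
  have ha0 : 0 < a := mul_pos (S.w_pos _) (Real.exp_pos _)
  rcases lt_trichotomy n (m + 1) with h | h | h
  · have e : (n - (m + 1)) + (m + 1 - n) = (m - n) + 1 := by omega
    rw [e, pow_succ, mul_comm (q ^ _), ← mul_assoc (Real.exp (M / 2)), hE, one_mul]
    exact S.canonWeight_below h2 (m - n) n (by omega)
  · rw [h]
    have e : (m + 1 - (m + 1)) + (m + 1 - (m + 1)) = 0 := by omega
    rw [e, pow_zero, mul_one]
    refine le_mul_of_one_le_left ha0.le ?_
    nlinarith [S.q_le_half, Real.exp_pos (M / 2)]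
  · have e : (n - (m + 1)) + (m + 1 - n) = (n - (m + 2)) + 1 := by omega
    rw [e, pow_succ, mul_comm (q ^ _), ← mul_assoc (Real.exp (M / 2)), hE, one_mul]
    have := S.canonWeight_above h1 (n - (m + 2))
    have e2 : m + 1 + 1 + (n - (m + 2)) = n := by omega
    rwa [e2] at this

/-- Gaps grow at most by `ρ` per step upwards and do not grow downwards; the extra `2 ^ d` covers
the summation over `d` gaps. -/
theorem abs_x_sub_le (m n : ℕ) :
    |x n - x m| ≤ (2 * ρ) ^ ((n - m) + (m - n)) * D m := by
  have hρ := S.one_le_ρ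
  rcases le_total m n with h | h
  · obtain ⟨j, rfl⟩ := Nat.exists_eq_add_of_le h
    have e : (m + j - m) + (m - (m + j)) = j := by omega
    rw [e, abs_of_nonneg (sub_nonneg.mpr (S.strictMono_x.monotone h))]
    have hD : ∀ j, D (m + j) ≤ ρ ^ j * D m := by
      intro j
      induction j with
      | zero => simp
      | succ j ih =>
        calc D (m + (j + 1)) ≤ ρ * D (m + j) := S.D_le (m + j)
          _ ≤ ρ * (ρ ^ j * D m) := by gcongr
          _ = _ := by ring
    clear h e
    induction j with
    | zero => simp [(S.D_pos m).le]
    | succ j ih =>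
      have e : x (m + (j + 1)) = x (m + j) + D (m + j) := S.x_succ (m + j)
      have h1 : ρ ^ j * D m ≤ (2 * ρ) ^ j * D m := by
        have := S.D_pos m
        gcongr
        linarith
      have h2 : (2 * ρ) ^ j * D m * 2 ≤ (2 * ρ) ^ (j + 1) * D m := by
        have := S.D_pos m
        have h3 : 0 ≤ (2 * ρ) ^ j * D m := by positivity
        rw [pow_succ]
        nlinarith
      have := hD j
      rw [e]
      linarith
  · obtain ⟨j, rfl⟩ := Nat.exists_eq_add_of_le h
    have e : (n - (n + j)) + (n + j - n) = j := by omega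
    rw [e, abs_sub_comm, abs_of_nonneg (sub_nonneg.mpr (S.strictMono_x.monotone h))]
    have key : ∀ i, i ≤ j → x (n + j) - x (n + (j - i)) ≤ (2 * ρ) ^ i * D (n + j) := by
      intro i
      induction i with
      | zero => intro _; simp [(S.D_pos _).le]
      | succ i ih =>
        intro hi
        have ih' := ih (by omega)
        have e1 : n + (j - i) = (n + (j - (i + 1))) + 1 := by omega
        rw [e1, S.x_succ] at ih'
        have h1 : D (n + (j - (i + 1))) ≤ D (n + j) := S.monotone_D (by omega)
        have hDp := S.D_pos (n + j)
        have h2 : (1 : ℝ) ≤ (2 * ρ) ^ i := one_le_pow₀ (by linarith)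
        have h3 : (2 * ρ) ^ i * 2 ≤ (2 * ρ) ^ (i + 1) := by
          rw [pow_succ]
          have : (0 : ℝ) ≤ (2 * ρ) ^ i := by positivity
          nlinarith
        nlinarith [mul_le_mul_of_nonneg_right h2 hDp.le, mul_le_mul_of_nonneg_right h3 hDp.le]
    have := key j le_rfl
    simpa using this

/-- Two-sided control of the canonical ensemble by the dominant level. -/
theorem canonical_bounds {β : ℝ} (hβ : 0 < β) (hβ0 : β < 1 / t 0) : ∃ m,
    1 / t m ≤ β ∧ β ≤ 2 / t m ∧ canonVar w x β ≤ 3 * Real.exp (M / 2) * D m ^ 2 ∧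
    (canonMean w x β - x m) ^ 2 ≤ 3 * Real.exp (M / 2) * D m ^ 2 ∧
    x m - x 0 ≤ 3 * Real.exp (M / 2) * (canonMean w x β - x 0) := by
  have hex : ∃ n, 1 / t n ≤ β := by
    obtain ⟨m, hm⟩ := (S.t_tendsto.eventually_ge_atTop (1 / β)).exists
    refine ⟨m, ?_⟩
    rw [div_le_iff₀ (S.t_pos m), mul_comm, ← div_le_iff₀ hβ]
    exact hm
  classical
  -- The first balancing point not above `β`; it is not the zeroth one since `β < 1 / t 0`.
  obtain ⟨k, hk1, hk2⟩ : ∃ k, 1 / t (k + 1) ≤ β ∧ β ≤ 1 / t k := by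
    have h1 := Nat.find_spec hex
    have h2 : Nat.find hex ≠ 0 := by
      intro h
      rw [h] at h1
      linarith
    obtain ⟨k, hk⟩ := Nat.exists_eq_succ_of_ne_zero h2
    rw [hk] at h1
    exact ⟨k, h1, (not_le.mp (Nat.find_min hex (by omega : k < Nat.find hex))).le⟩
  have hw : ∀ n, 0 ≤ w n := fun n => (S.w_pos n).le
  have hZ : ∀ β : ℝ, 0 < β → Summable fun n => w n * Real.exp (-β * x n) :=
    fun β hβ => S.summable_canonWeight hβ
  have hpos : ∃ n, 0 < w n := ⟨0, S.w_pos 0⟩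
  have hle := S.canonWeight_le hk1 hk2
  set m := k + 1 with hm
  set E := Real.exp (M / 2) with hE
  have hE0 : 0 < E := Real.exp_pos _
  set q := Real.exp (-(M / 2)) with hq
  have hq0 : 0 < q := Real.exp_pos _
  set a := w m * Real.exp (-β * x m) with ha
  have ha0 : 0 < a := mul_pos (S.w_pos m) (Real.exp_pos _)
  set Z := ∑' n, w n * Real.exp (-β * x n) with hZdef
  obtain ⟨hs, hs3⟩ := summable_half_pow m
  have haZ : a ≤ Z := (hZ β hβ).le_tsum m fun n _ => (mul_pos (S.w_pos n) (Real.exp_pos _)).le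
  have hZ0 : 0 < Z := ha0.trans_le haZ
  have hZa : Z ≤ 3 * E * a := by
    calc Z ≤ ∑' n : ℕ, E * a * (1 / 2 : ℝ) ^ ((n - m) + (m - n)) := by
          refine (hZ β hβ).tsum_le_tsum (fun n => (hle n).trans ?_) (hs.mul_left _)
          calc E * q ^ ((n - m) + (m - n)) * a ≤ E * (1 / 2) ^ ((n - m) + (m - n)) * a := by
                gcongr
                exact S.q_le_half
            _ = _ := by ring
      _ = E * a * ∑' n : ℕ, (1 / 2 : ℝ) ^ ((n - m) + (m - n)) := tsum_mul_left
      _ ≤ E * a * 3 := by gcongr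
      _ = _ := by ring
  have hS2 : ∑' n, w n * (Real.exp (-β * x n) * (x n - x m) ^ 2) ≤ 3 * E * D m ^ 2 * a := by
    calc _ ≤ ∑' n : ℕ, E * a * D m ^ 2 * (1 / 2 : ℝ) ^ ((n - m) + (m - n)) := by
          refine (summable_sub_pow_mul_exp hw hZ hβ 2 (x m)).tsum_le_tsum (fun n => ?_)
            (hs.mul_left _)
          have h1 : (x n - x m) ^ 2 ≤ ((2 * ρ) ^ ((n - m) + (m - n)) * D m) ^ 2 := by
            rw [← sq_abs]
            exact pow_le_pow_left₀ (abs_nonneg _) (S.abs_x_sub_le m n) 2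
          set d := (n - m) + (m - n)
          -- This is what `M_large` is for: the decay of the weights must beat the growth of squared
          -- distances.
          have h2 : q * (2 * ρ) ^ 2 ≤ 1 / 2 := by
            have := S.q_le
            nlinarith
          calc w n * (Real.exp (-β * x n) * (x n - x m) ^ 2)
              = w n * Real.exp (-β * x n) * (x n - x m) ^ 2 := by ring
            _ ≤ (E * q ^ d * a) * ((2 * ρ) ^ d * D m) ^ 2 :=
                mul_le_mul (hle n) h1 (sq_nonneg _) (by positivity)
            _ = E * a * D m ^ 2 * (q * (2 * ρ) ^ 2) ^ d := by
                rw [mul_pow q, ← pow_mul, mul_pow ((2 * ρ) ^ d), ← pow_mul, mul_comm d 2]; ring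
            _ ≤ _ := by
                gcongr
      _ = E * a * D m ^ 2 * ∑' n : ℕ, (1 / 2 : ℝ) ^ ((n - m) + (m - n)) := tsum_mul_left
      _ ≤ E * a * D m ^ 2 * 3 := by gcongr
      _ = _ := by ring
  rw [canonMean_moment_identity hw hZ hpos hβ (x m), ← hZdef] at hS2
  have hvar := canonVar_nonneg hw hZ hpos hβ
  have hsum : canonVar w x β + (canonMean w x β - x m) ^ 2 ≤ 3 * E * D m ^ 2 := by
    refine le_of_mul_le_mul_left (hS2.trans ?_) hZ0
    rw [mul_comm]
    exact mul_le_mul_of_nonneg_right haZ (by positivity)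
  refine ⟨m, hk1, ?_, ?_, ?_, ?_⟩
  · refine hk2.trans ?_
    rw [div_le_div_iff₀ (S.t_pos _) (S.t_pos _)]
    linarith [S.t_le k]
  · linarith [sq_nonneg (canonMean w x β - x m)]
  · linarith
  · have s1 := summable_sub_pow_mul_exp hw hZ hβ 1 (x 0)
    simp only [pow_one] at s1
    have h1 : ∑' n, w n * (Real.exp (-β * x n) * (x n - x 0)) = Z * (canonMean w x β - x 0) := by
      have s2 := summable_sub_pow_mul_exp hw hZ hβ 1 0
      simp only [pow_one, sub_zero] at s2
      have e : ∀ n, w n * (Real.exp (-β * x n) * (x n - x 0)) =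
          w n * (Real.exp (-β * x n) * x n) - x 0 * (w n * Real.exp (-β * x n)) :=
        fun n => by ring
      rw [tsum_congr e, s2.tsum_sub ((hZ β hβ).mul_left _), tsum_mul_left, canonMean, ← hZdef]
      field_simp
    -- All terms of the mean relative to the lowest level are nonnegative, so the dominant level
    -- alone is a lower bound.
    have h2 : a * (x m - x 0) ≤ Z * (canonMean w x β - x 0) := by
      rw [← h1, ha, mul_assoc]
      refine s1.le_tsum m fun n _ => mul_nonneg (hw n) (mul_nonneg (Real.exp_pos _).le ?_)
      exact sub_nonneg.mpr (S.strictMono_x.monotone (Nat.zero_le n))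
    have h3 : 0 ≤ canonMean w x β - x 0 := by
      have h4 : 0 ≤ x m - x 0 := sub_nonneg.mpr (S.strictMono_x.monotone (Nat.zero_le m))
      by_contra! h5
      nlinarith [mul_nonneg ha0.le h4]
    have h6 : a * (x m - x 0) ≤ a * (3 * E * (canonMean w x β - x 0)) := by
      refine h2.trans ?_
      calc Z * (canonMean w x β - x 0) ≤ 3 * E * a * (canonMean w x β - x 0) := by gcongr
        _ = _ := by ring
    exact le_of_mul_le_mul_left h6 ha0

/-- With the Gaussian weights of variance `2 y_N t_N`, where `y_N = x_N - L`, at least half of the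
weight sits on the levels `n ≥ N`. -/
theorem gauss_tail {L : ℝ} {N : ℕ} (hN : 0 < x N - L) {Λ : ℝ} (hΛ : Λ ^ 2 = 2 * (x N - L) * t N) :
    ∑ n ∈ Finset.range N, w n * Real.exp (-(x n - L) ^ 2 / (2 * Λ ^ 2)) ≤
      w N * Real.exp (-(x N - L) ^ 2 / (2 * Λ ^ 2)) := by
  have hΛ0 : 0 < Λ ^ 2 := by
    rw [hΛ]
    have := S.t_pos N
    positivity
  have hstep : ∀ n, n < N → 2 * (w n * Real.exp (-(x n - L) ^ 2 / (2 * Λ ^ 2))) ≤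
      w (n + 1) * Real.exp (-(x (n + 1) - L) ^ 2 / (2 * Λ ^ 2)) := by
    intro n hn
    have e : w (n + 1) * Real.exp (-(x (n + 1) - L) ^ 2 / (2 * Λ ^ 2)) =
        w n * Real.exp (-(x n - L) ^ 2 / (2 * Λ ^ 2)) *
        Real.exp (D n * (1 / t n - ((x n - L) + (x (n + 1) - L)) / (2 * Λ ^ 2))) := by
      rw [S.w_succ, S.x_succ, mul_assoc, mul_assoc, ← Real.exp_add, ← Real.exp_add]
      congr 2
      field_simp
      ring
    rw [e, mul_comm]
    refine mul_le_mul_of_nonneg_left ?_ (mul_pos (S.w_pos n) (Real.exp_pos _)).le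
    -- Below level `N` the Gaussian decays at most half as fast as the weights grow. A net growth of
    -- at least `exp (M / 2) ≥ 2` per level remains.
    have h1 : ((x n - L) + (x (n + 1) - L)) / (2 * Λ ^ 2) ≤ 1 / t n / 2 := by
      have h2 : x n ≤ x N := S.strictMono_x.monotone hn.le
      have h3 : x (n + 1) ≤ x N := S.strictMono_x.monotone hn
      have h4 : t n ≤ t N := S.strictMono_t.monotone hn.le
      calc ((x n - L) + (x (n + 1) - L)) / (2 * Λ ^ 2)
          ≤ (2 * (x N - L)) / (2 * Λ ^ 2) := by gcongr; linarith
        _ = 1 / t N / 2 := by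
            have := S.t_pos N
            rw [hΛ]
            field_simp
        _ ≤ 1 / t n / 2 := by
            have := S.t_pos n
            gcongr
    have h5 : M / 2 ≤ D n * (1 / t n - ((x n - L) + (x (n + 1) - L)) / (2 * Λ ^ 2)) := by
      have h6 := S.le_ratio n
      have h7 : D n * (1 / t n / 2) ≤
          D n * (1 / t n - ((x n - L) + (x (n + 1) - L)) / (2 * Λ ^ 2)) := by
        refine mul_le_mul_of_nonneg_left ?_ (S.D_pos n).le
        linarith
      have h8 : D n * (1 / t n / 2) = D n / t n / 2 := by ring
      linarith
    have h9 : (2 : ℝ) ≤ Real.exp (M / 2) := by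
      have h10 : 1 ≤ ρ ^ 2 := one_le_pow₀ S.one_le_ρ
      linarith [S.M_large]
    exact h9.trans (Real.exp_le_exp.mpr h5)
  have key : ∀ j, j ≤ N → ∑ n ∈ Finset.range j, w n * Real.exp (-(x n - L) ^ 2 / (2 * Λ ^ 2)) ≤
      w j * Real.exp (-(x j - L) ^ 2 / (2 * Λ ^ 2)) := by
    intro j
    induction j with
    | zero =>
      intro _
      rw [Finset.sum_range_zero]
      exact (mul_pos (S.w_pos 0) (Real.exp_pos _)).le
    | succ j ih =>
      intro hj
      rw [Finset.sum_range_succ]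
      linarith [ih (by omega), hstep j (by omega)]
  exact key N le_rfl

theorem summable_gauss_mul_pow (L : ℝ) {Λ : ℝ} (hΛ : 0 < Λ) (k : ℕ) :
    Summable fun n => w n * (Real.exp (-(x n - L) ^ 2 / (2 * Λ ^ 2)) * (x n - L) ^ k) := by
  have hw : ∀ n, 0 ≤ w n := fun n => (S.w_pos n).le
  have hs := summable_sub_pow_mul_exp hw (fun β hβ => S.summable_canonWeight hβ) one_pos k L
  refine Summable.of_norm_bounded (hs.norm.mul_left (Real.exp (L + Λ ^ 2 / 2))) fun n => ?_
  rw [Real.norm_eq_abs, Real.norm_eq_abs, abs_mul, abs_mul, abs_mul, abs_mul,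
    abs_of_pos (Real.exp_pos _), abs_of_pos (Real.exp_pos _)]
  have h : Real.exp (-(x n - L) ^ 2 / (2 * Λ ^ 2)) ≤
      Real.exp (L + Λ ^ 2 / 2) * Real.exp (-1 * x n) := by
    rw [← Real.exp_add, Real.exp_le_exp, div_le_iff₀ (by positivity)]
    nlinarith [sq_nonneg ((x n - L) - Λ ^ 2)]
  calc |w n| * (Real.exp (-(x n - L) ^ 2 / (2 * Λ ^ 2)) * |(x n - L) ^ k|)
      ≤ |w n| * (Real.exp (L + Λ ^ 2 / 2) * Real.exp (-1 * x n) * |(x n - L) ^ k|) := by gcongr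
    _ = _ := by ring

/-- At least half of the Gaussian weight sits on levels `n ≥ N`, where the square is at least `(x N
- L)²`; the lower levels contribute nonnegatively. -/
theorem gauss_moment_two {L : ℝ} {N : ℕ} (hN : 0 < x N - L) {Λ : ℝ} (hΛ0 : 0 < Λ)
    (hΛ : Λ ^ 2 = 2 * (x N - L) * t N) :
    (x N - L) ^ 2 / 2 * gaussSum w x L Λ ≤
      ∑' n, w n * (Real.exp (-(x n - L) ^ 2 / (2 * Λ ^ 2)) * (x n - L) ^ 2) := by
  have s0 := S.summable_gauss_mul_pow L hΛ0 0
  have s2 := S.summable_gauss_mul_pow L hΛ0 2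
  simp only [pow_zero, mul_one] at s0
  have htail := S.gauss_tail hN hΛ
  have s0' := (summable_nat_add_iff N).mpr s0
  have s2' := (summable_nat_add_iff N).mpr s2
  set B := ∑' n, w (n + N) * Real.exp (-(x (n + N) - L) ^ 2 / (2 * Λ ^ 2)) with hB
  have h1 : w N * Real.exp (-(x N - L) ^ 2 / (2 * Λ ^ 2)) ≤ B := by
    have := s0'.le_tsum 0 fun n _ => (mul_pos (S.w_pos _) (Real.exp_pos _)).le
    simpa using this
  have h2 : gaussSum w x L Λ ≤ 2 * B := by
    rw [gaussSum, ← s0.sum_add_tsum_nat_add N, ← hB]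
    linarith
  have h3 : (x N - L) ^ 2 * B ≤
      ∑' n, w (n + N) * (Real.exp (-(x (n + N) - L) ^ 2 / (2 * Λ ^ 2)) * (x (n + N) - L) ^ 2) := by
    rw [hB, ← tsum_mul_left]
    refine (s0'.mul_left _).tsum_le_tsum (fun n => ?_) s2'
    rw [mul_comm, mul_assoc]
    refine mul_le_mul_of_nonneg_left (mul_le_mul_of_nonneg_left ?_ (Real.exp_pos _).le)
      (S.w_pos _).le
    have h4 : x N ≤ x (n + N) := S.strictMono_x.monotone (by omega)
    exact pow_le_pow_left₀ hN.le (by linarith) 2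
  have h5 : 0 ≤ ∑ n ∈ Finset.range N,
      w n * (Real.exp (-(x n - L) ^ 2 / (2 * Λ ^ 2)) * (x n - L) ^ 2) :=
    Finset.sum_nonneg fun n _ => mul_nonneg (S.w_pos n).le
      (mul_nonneg (Real.exp_pos _).le (sq_nonneg _))
  rw [← s2.sum_add_tsum_nat_add N]
  have h6 : (x N - L) ^ 2 / 2 * gaussSum w x L Λ ≤ (x N - L) ^ 2 / 2 * (2 * B) := by gcongr
  linarith

/-- The levels below `N` may contribute negatively, but by no more than `|x 0 - L|` times their
weight; the assumed margin lets the constant drop only from one half to one quarter. -/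
theorem gauss_moment_one {L : ℝ} {N : ℕ} (hN : 0 < x N - L) (hN4 : 4 * |x 0 - L| ≤ x N - L)
    {Λ : ℝ} (hΛ0 : 0 < Λ) (hΛ : Λ ^ 2 = 2 * (x N - L) * t N) :
    (x N - L) / 4 * gaussSum w x L Λ ≤
      ∑' n, w n * (Real.exp (-(x n - L) ^ 2 / (2 * Λ ^ 2)) * (x n - L)) := by
  have s0 := S.summable_gauss_mul_pow L hΛ0 0
  have s1 := S.summable_gauss_mul_pow L hΛ0 1
  simp only [pow_zero, mul_one, pow_one] at s0 s1
  have htail := S.gauss_tail hN hΛ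
  have s0' := (summable_nat_add_iff N).mpr s0
  have s1' := (summable_nat_add_iff N).mpr s1
  set B := ∑' n, w (n + N) * Real.exp (-(x (n + N) - L) ^ 2 / (2 * Λ ^ 2)) with hB
  set A := ∑ n ∈ Finset.range N, w n * Real.exp (-(x n - L) ^ 2 / (2 * Λ ^ 2)) with hAdef
  have hA0 : 0 ≤ A := Finset.sum_nonneg fun n _ => (mul_pos (S.w_pos n) (Real.exp_pos _)).le
  have h1 : w N * Real.exp (-(x N - L) ^ 2 / (2 * Λ ^ 2)) ≤ B := by
    have := s0'.le_tsum 0 fun n _ => (mul_pos (S.w_pos _) (Real.exp_pos _)).le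
    simpa using this
  have h2 : gaussSum w x L Λ = A + B := by
    rw [gaussSum, ← s0.sum_add_tsum_nat_add N, ← hB]
  have h3 : (x N - L) * B ≤
      ∑' n, w (n + N) * (Real.exp (-(x (n + N) - L) ^ 2 / (2 * Λ ^ 2)) * (x (n + N) - L)) := by
    rw [hB, ← tsum_mul_left]
    refine (s0'.mul_left _).tsum_le_tsum (fun n => ?_) s1'
    rw [mul_comm, mul_assoc]
    refine mul_le_mul_of_nonneg_left (mul_le_mul_of_nonneg_left ?_ (Real.exp_pos _).le)
      (S.w_pos _).le
    have h4 : x N ≤ x (n + N) := S.strictMono_x.monotone (by omega)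
    linarith
  have h5 : -|x 0 - L| * A ≤ ∑ n ∈ Finset.range N,
      w n * (Real.exp (-(x n - L) ^ 2 / (2 * Λ ^ 2)) * (x n - L)) := by
    rw [hAdef, Finset.mul_sum]
    refine Finset.sum_le_sum fun n _ => ?_
    rw [mul_comm, mul_assoc]
    refine mul_le_mul_of_nonneg_left (mul_le_mul_of_nonneg_left ?_ (Real.exp_pos _).le)
      (S.w_pos _).le
    have h4 : x 0 ≤ x n := S.strictMono_x.monotone (Nat.zero_le n)
    linarith [neg_abs_le (x 0 - L)]
  rw [← s1.sum_add_tsum_nat_add N, h2]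
  nlinarith [mul_le_mul_of_nonneg_right hN4 hA0]

end SparseSpectrum

end Sparse

/-! ### A sparse spectrum with power growth of the canonical mean -/

section PowerGrowth

/-- Inverse temperatures growing by the increments `t ^ (1 - c)`. -/
def levelScale (c : ℝ) : ℕ → ℝ
  | 0 => 1
  | n + 1 => levelScale c n + levelScale c n ^ (1 - c)

/-- Levels starting from `p` with the gaps `M t ^ (1 + c)`. -/
def sparseLevel (c M p : ℝ) : ℕ → ℝ
  | 0 => p
  | n + 1 => sparseLevel c M p n + M * levelScale c n ^ (1 + c)

/-- Weights balancing successive levels at the inverse temperatures `1 / t`. -/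
def sparseWeight (c M : ℝ) : ℕ → ℝ
  | 0 => 1
  | n + 1 => sparseWeight c M n * Real.exp (M * levelScale c n ^ (1 + c) / levelScale c n)

variable {c : ℝ}

theorem rpow_increment_le (hc : 0 ≤ c) {t : ℝ} (ht : 1 ≤ t) : t ^ (1 - c) ≤ t := by
  conv_rhs => rw [← Real.rpow_one t]
  exact Real.rpow_le_rpow_of_exponent_le ht (by linarith)

theorem one_le_levelScale (c : ℝ) (n : ℕ) : 1 ≤ levelScale c n := by
  induction n with
  | zero => exact le_rfl
  | succ n ih =>
    rw [levelScale]
    have : 0 < levelScale c n ^ (1 - c) := Real.rpow_pos_of_pos (by linarith) _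
    linarith

theorem levelScale_lt_succ (c : ℝ) (n : ℕ) : levelScale c n < levelScale c (n + 1) := by
  rw [levelScale]
  have : 0 < levelScale c n ^ (1 - c) :=
    Real.rpow_pos_of_pos (by linarith [one_le_levelScale c n]) _
  linarith

/-- If the scale stayed below `b`, its increments would be at least `b ^ (-c)`, forcing linear
growth. -/
theorem tendsto_levelScale (hc : 0 ≤ c) : Tendsto (levelScale c) atTop atTop := by
  refine tendsto_atTop_atTop_of_monotone
    (monotone_nat_of_le_succ fun n => (levelScale_lt_succ c n).le) fun b => ?_
  by_contra! hb
  have hb0 : 0 < b := by linarith [hb 0, one_le_levelScale c 0]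
  have hpos : 0 < b ^ (-c) := Real.rpow_pos_of_pos hb0 _
  have hlow : ∀ n : ℕ, n * b ^ (-c) ≤ levelScale c n := by
    intro n
    induction n with
    | zero => simpa using (zero_le_one.trans (one_le_levelScale c 0))
    | succ n ih =>
      have h1 := one_le_levelScale c n
      have h2 : levelScale c n ^ (-c) ≤ levelScale c n ^ (1 - c) :=
        Real.rpow_le_rpow_of_exponent_le h1 (by linarith)
      have h3 : b ^ (-c) ≤ levelScale c n ^ (-c) :=
        Real.rpow_le_rpow_of_nonpos (by linarith) (hb n).le (by linarith)
      rw [levelScale]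
      push_cast
      linarith
  obtain ⟨n, hn⟩ := exists_nat_gt (b / b ^ (-c))
  rw [div_lt_iff₀ hpos] at hn
  linarith [hb n, hlow n]

/-- The step `u = t^(1-c)` raises `t^(1+2c)` by about `t^(2c) u = t^(1+c)`, the size of a level gap.
The lower bound is Bernoulli's inequality based at `t`, the upper one Bernoulli's inequality based
at `t + u`. -/
theorem rpow_add_increment_bounds (hc : 0 ≤ c) {t : ℝ} (ht : 1 ≤ t) :
    t ^ (1 + 2 * c) + t ^ (1 + c) ≤ (t + t ^ (1 - c)) ^ (1 + 2 * c) ∧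
      (t + t ^ (1 - c)) ^ (1 + 2 * c) ≤
        t ^ (1 + 2 * c) + (1 + 2 * c) * 2 ^ (2 * c) * t ^ (1 + c) := by
  have ht0 : 0 < t := by linarith
  set u := t ^ (1 - c) with hu
  have hu0 : 0 < u := Real.rpow_pos_of_pos ht0 _
  have hut : u ≤ t := rpow_increment_le hc ht
  have h2c : t ^ (2 * c) * u = t ^ (1 + c) := by
    rw [hu, ← Real.rpow_add ht0]
    congr 1
    ring
  have hsplit : ∀ s : ℝ, 0 < s → s ^ (1 + 2 * c) = s * s ^ (2 * c) := fun s hs => by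
    rw [Real.rpow_add hs, Real.rpow_one]
  constructor
  · have hb := one_add_mul_self_le_rpow_one_add (by
      have : 0 < u / t := by positivity
      linarith : -1 ≤ u / t) (by linarith : 1 ≤ 1 + 2 * c)
    have e : t + u = t * (1 + u / t) := by field_simp
    have e2 : t ^ (1 + c) = t ^ (1 + 2 * c) * (u / t) := by
      rw [← h2c, hsplit t ht0]
      field_simp
    rw [e, Real.mul_rpow ht0.le (by positivity), e2]
    have hp : 0 < t ^ (1 + 2 * c) := by positivity
    have h3 : 1 + u / t ≤ (1 + u / t) ^ (1 + 2 * c) := by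
      refine le_trans ?_ hb
      have : 0 ≤ 2 * c * (u / t) := by positivity
      linarith
    calc _ = t ^ (1 + 2 * c) * (1 + u / t) := by ring
      _ ≤ _ := by gcongr
  · set T := t + u with hT
    have hT0 : 0 < T := by positivity
    have hs : -1 ≤ -(u / T) := by
      rw [neg_le_neg_iff, div_le_one hT0]
      linarith
    have hb := one_add_mul_self_le_rpow_one_add hs (by linarith : 1 ≤ 1 + 2 * c)
    have e : 1 + -(u / T) = t / T := by
      field_simp
      linarith
    rw [e, Real.div_rpow ht0.le hT0.le, le_div_iff₀ (by positivity)] at hb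
    have e2 : (1 + (1 + 2 * c) * -(u / T)) * T ^ (1 + 2 * c) =
        T ^ (1 + 2 * c) - (1 + 2 * c) * (T ^ (2 * c) * u) := by
      rw [hsplit T hT0]
      field_simp
      ring
    rw [e2] at hb
    have h3 : T ^ (2 * c) * u ≤ 2 ^ (2 * c) * t ^ (1 + c) := by
      rw [← h2c, ← mul_assoc, ← Real.mul_rpow zero_le_two ht0.le]
      gcongr
      linarith
    have h4 := mul_le_mul_of_nonneg_left h3 (by linarith : 0 ≤ 1 + 2 * c)
    linarith

/-- The exponents balance: with `u = t^(1-c) ≤ t` one has `(1/t - 1/(t+u)) M t^(1+c) = M t / (t+u) ≥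
M / 2`. -/
theorem sparseSpectrum (hc : 0 ≤ c) {M : ℝ} (hM1 : 1 ≤ M)
    (hM : 8 * ((2 : ℝ) ^ (1 + c)) ^ 2 ≤ Real.exp (M / 2)) (p : ℝ) :
    SparseSpectrum (levelScale c) (fun n => M * levelScale c n ^ (1 + c)) (sparseLevel c M p)
      (sparseWeight c M) (2 ^ (1 + c)) M where
  one_le_t := one_le_levelScale c
  t_lt := levelScale_lt_succ c
  t_le n := by
    rw [levelScale]
    linarith [rpow_increment_le hc (one_le_levelScale c n)]
  t_tendsto := tendsto_levelScale hc
  one_le_D n :=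
    one_le_mul_of_one_le_of_one_le hM1 (Real.one_le_rpow (one_le_levelScale c n) (by linarith))
  D_mono n := by
    have := one_le_levelScale c n
    have := (levelScale_lt_succ c n).le
    gcongr
  D_le n := by
    have h1 := one_le_levelScale c n
    rw [mul_left_comm, ← Real.mul_rpow zero_le_two (by linarith)]
    have h2 := one_le_levelScale c (n + 1)
    have : levelScale c (n + 1) ≤ 2 * levelScale c n := by
      rw [levelScale]
      linarith [rpow_increment_le hc (one_le_levelScale c n)]
    gcongr
  x_succ n := rfl
  w_zero := rfl
  w_succ n := rfl
  gap n := by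
    have h1 := one_le_levelScale c n
    rw [levelScale]
    set t := levelScale c n
    have ht0 : 0 < t := by linarith
    set u := t ^ (1 - c) with hu
    have hu0 : 0 < u := Real.rpow_pos_of_pos ht0 _
    have hut : u ≤ t := rpow_increment_le hc h1
    have hprod : u * t ^ (1 + c) = t ^ 2 := by
      rw [hu, ← Real.rpow_add ht0, ← Real.rpow_natCast]
      congr 1
      push_cast
      ring
    have e : (1 / t - 1 / (t + u)) * (M * t ^ (1 + c)) = M * (t / (t + u)) := by
      have : (1 / t - 1 / (t + u)) = u / (t * (t + u)) := by
        field_simp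
        ring
      rw [this]
      calc _ = M * (u * t ^ (1 + c)) / (t * (t + u)) := by ring
        _ = _ := by
          rw [hprod]
          field_simp
    rw [e, div_eq_mul_one_div M 2]
    gcongr M * ?_
    rw [div_le_div_iff₀ (by norm_num) (by positivity)]
    linarith
  le_ratio n := by
    have h1 := one_le_levelScale c n
    rw [le_div_iff₀ (by linarith)]
    gcongr
    conv_lhs => rw [← Real.rpow_one (levelScale c n)]
    exact Real.rpow_le_rpow_of_exponent_le h1 (by linarith)
  one_le_ρ := Real.one_le_rpow one_le_two (by linarith)
  M_large := hM

theorem sparseLevel_le (hc : 0 ≤ c) {M : ℝ} (hM : 0 ≤ M) (p : ℝ) (n : ℕ) :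
    sparseLevel c M p n - p ≤ M * levelScale c n ^ (1 + 2 * c) := by
  induction n with
  | zero => simpa [sparseLevel, levelScale] using hM
  | succ n ih =>
    have h := mul_le_mul_of_nonneg_left
      (rpow_add_increment_bounds hc (one_le_levelScale c n)).1 hM
    rw [sparseLevel, levelScale]
    linarith

/-- Gaps are compared with increments of `t^(1+2c)`. The factor 16 is a margin: after recentering at
`L`, eventually `8 t^(1+2c)` is left, which also exceeds `8 t`. -/
theorem le_sparseLevel (hc : 0 ≤ c) {M : ℝ} (hM : 16 * ((1 + 2 * c) * 2 ^ (2 * c)) ≤ M) (p : ℝ)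
    (n : ℕ) : 16 * (levelScale c n ^ (1 + 2 * c) - 1) ≤ sparseLevel c M p n - p := by
  induction n with
  | zero => simp [sparseLevel, levelScale]
  | succ n ih =>
    have h1 := one_le_levelScale c n
    have h := (rpow_add_increment_bounds hc h1).2
    have h2 : 0 ≤ levelScale c n ^ (1 + c) := Real.rpow_nonneg (by linarith) _
    have h3 := mul_le_mul_of_nonneg_right hM h2
    rw [sparseLevel, levelScale]
    linarith

/-- The canonical mean grows like `β ^ (-(1 + 2 c))`, the canonical variance at most like
`β ^ (-(2 + 2 c))`. -/
theorem exists_canonical_growth (hc : 0 ≤ c) {M : ℝ} (hM1 : 1 ≤ M)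
    (hM : 8 * ((2 : ℝ) ^ (1 + c)) ^ 2 ≤ Real.exp (M / 2))
    (hM' : 16 * ((1 + 2 * c) * 2 ^ (2 * c)) ≤ M) (p : ℝ) :
    ∃ C : ℝ, 0 < C ∧ ∀ᶠ β in 𝓝[>] (0 : ℝ), ∃ T, 1 / β ≤ T ∧ T ≤ 2 / β ∧
      T ^ (1 + 2 * c) ≤ C * canonMean (sparseWeight c M) (sparseLevel c M p) β ∧
      canonMean (sparseWeight c M) (sparseLevel c M p) β ≤ C * T ^ (1 + 2 * c) ∧
      canonVar (sparseWeight c M) (sparseLevel c M p) β ≤ C * T ^ (2 + 2 * c) := by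
  have S := sparseSpectrum hc hM1 hM p
  set E := 3 * Real.exp (M / 2) with hE
  have hE1 : 1 ≤ E := by
    have := Real.one_le_exp (by linarith : 0 ≤ M / 2)
    linarith
  set C := |p| + M + E * M ^ 2 + E with hC
  have hβ1 : ∀ᶠ β in 𝓝[>] (0 : ℝ), β < 1 :=
    (eventually_lt_nhds one_pos).filter_mono nhdsWithin_le_nhds
  -- For small `β` the additive constants are below `1 / β ≤ T` and are absorbed by the power of
  -- `T`.
  have hβ2 : ∀ᶠ β in 𝓝[>] (0 : ℝ), 16 + |p| * E ≤ 1 / β := by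
    simp only [one_div]
    exact tendsto_inv_nhdsGT_zero.eventually_ge_atTop _
  refine ⟨C, by positivity, ?_⟩
  filter_upwards [hβ1, hβ2, self_mem_nhdsWithin] with β h1 h2 h0
  have h0 : 0 < β := h0
  obtain ⟨m, hm1, hm2, hv, hd, hlow⟩ := S.canonical_bounds h0
    (by rw [levelScale]; simpa using h1)
  rw [← hE] at hv hd hlow
  have ht := one_le_levelScale c m
  have hup := sparseLevel_le hc (by linarith : 0 ≤ M) p m
  have hlo := le_sparseLevel hc hM' p m
  have hx0 : sparseLevel c M p 0 = p := rfl
  rw [hx0] at hlow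
  set T := levelScale c m
  set μ := canonMean (sparseWeight c M) (sparseLevel c M p) β
  have hT0 : 0 < T := by linarith
  have hT1 : 1 / β ≤ T := by
    rw [div_le_iff₀ h0]
    rw [div_le_iff₀ hT0] at hm1
    linarith
  have hTa : T ≤ T ^ (1 + 2 * c) := by
    conv_lhs => rw [← Real.rpow_one T]
    exact Real.rpow_le_rpow_of_exponent_le ht (by linarith)
  have hTc : T ^ (1 + c) ≤ T ^ (1 + 2 * c) :=
    Real.rpow_le_rpow_of_exponent_le ht (by linarith)
  have hTd : (T ^ (1 + c)) ^ 2 = T ^ (2 + 2 * c) := by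
    rw [← Real.rpow_natCast, ← Real.rpow_mul hT0.le]
    congr 1
    push_cast
    ring
  have hTp : 0 < T ^ (1 + c) := by positivity
  have hq0 : 0 < T ^ (1 + 2 * c) := by positivity
  have hq1 : 1 ≤ T ^ (1 + 2 * c) := by linarith
  refine ⟨T, hT1, ?_, ?_, ?_, ?_⟩
  · rw [le_div_iff₀ h0]
    rw [le_div_iff₀ hT0] at hm2
    linarith
  · have h4 : 16 * (T ^ (1 + 2 * c) - 1) ≤ E * (μ - p) := hlo.trans hlow
    have h5 : -(|p| * E) ≤ E * p := by nlinarith [neg_abs_le p]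
    have h6 : T ^ (1 + 2 * c) ≤ E * μ := by linarith
    have hμ : 0 < μ := by
      by_contra! h
      nlinarith
    refine h6.trans (mul_le_mul_of_nonneg_right ?_ hμ.le)
    have : 0 ≤ |p| + M + E * M ^ 2 := by positivity
    linarith
  · have h4 : μ - sparseLevel c M p m ≤ E * (M * T ^ (1 + c)) := by
      refine abs_le_of_sq_le_sq' ?_ (by positivity) |>.2
      refine hd.trans ?_
      rw [mul_pow E]
      exact mul_le_mul_of_nonneg_right (by nlinarith) (by positivity)
    have h5 : E * (M * T ^ (1 + c)) ≤ E * (M ^ 2 * T ^ (1 + 2 * c)) := by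
      gcongr
      nlinarith
    have h6 : p ≤ |p| * T ^ (1 + 2 * c) := by nlinarith [le_abs_self p, abs_nonneg p]
    have h7 : 0 ≤ E * T ^ (1 + 2 * c) := by positivity
    have e : C * T ^ (1 + 2 * c) = |p| * T ^ (1 + 2 * c) + M * T ^ (1 + 2 * c) +
      E * (M ^ 2 * T ^ (1 + 2 * c)) + E * T ^ (1 + 2 * c) := by ring
    linarith
  · rw [mul_pow, hTd, ← mul_assoc] at hv
    refine hv.trans ?_
    refine mul_le_mul_of_nonneg_right ?_ (by positivity)
    have : 0 ≤ |p| + M + E := by positivity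
    linarith

end PowerGrowth

/-! ### Failure of faster rates for vanishing `β₋`: the sparse system -/

section SparseSystem

/-- Since `T` is comparable to `1 / β`, the mean has exact order `β^(-(1+2c))`, and the variance
exceeds that order by at most one factor `1 / β`, which is what G3 permits. -/
theorem conditions_of_growth {c C : ℝ} (hc : 0 ≤ c) (hC : 0 < C) {μ V : ℝ → ℝ}
    (hV : ∀ β, 0 < β → 0 ≤ V β)
    (h : ∀ᶠ β in 𝓝[>] (0 : ℝ), ∃ T, 1 / β ≤ T ∧ T ≤ 2 / β ∧ T ^ (1 + 2 * c) ≤ C * μ β ∧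
      μ β ≤ C * T ^ (1 + 2 * c) ∧ V β ≤ C * T ^ (2 + 2 * c)) :
    Tendsto μ (𝓝[>] 0) atTop ∧
      (fun β : ℝ => β ^ (1 + 2 * c) * μ β) =O[𝓝[>] 0] (fun _ => (1 : ℝ)) ∧
      (fun β : ℝ => β * V β / μ β) =O[𝓝[>] 0] fun _ => (1 : ℝ) := by
  refine ⟨?_, ?_, ?_⟩
  · have h1 : ∀ᶠ β in 𝓝[>] (0 : ℝ), C⁻¹ * β⁻¹ ≤ μ β := by
      have hβ1 : ∀ᶠ β in 𝓝[>] (0 : ℝ), β < 1 :=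
        (eventually_lt_nhds one_pos).filter_mono nhdsWithin_le_nhds
      filter_upwards [h, hβ1, self_mem_nhdsWithin] with β ⟨T, hT1, _, hT3, _⟩ hβ h0
      have h0 : 0 < β := h0
      have hT : 1 ≤ T := by
        refine le_trans ?_ hT1
        rw [le_div_iff₀ h0]
        linarith
      have hTa : T ≤ T ^ (1 + 2 * c) := by
        conv_lhs => rw [← Real.rpow_one T]
        exact Real.rpow_le_rpow_of_exponent_le hT (by linarith)
      rw [inv_mul_le_iff₀ hC, ← one_div]
      linarith
    exact tendsto_atTop_mono' _ h1 (tendsto_inv_nhdsGT_zero.const_mul_atTop (by positivity))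
  · refine IsBigO.of_bound (C * 2 ^ (1 + 2 * c)) ?_
    filter_upwards [h, self_mem_nhdsWithin] with β ⟨T, hT1, hT2, hT3, hT4, _⟩ h0
    have h0 : 0 < β := h0
    have hT0 : 0 < T := lt_of_lt_of_le (by positivity) hT1
    have hμ : 0 ≤ μ β := by
      have : 0 < C * μ β := lt_of_lt_of_le (by positivity) hT3
      exact (pos_of_mul_pos_right this hC.le).le
    rw [norm_one, mul_one, Real.norm_eq_abs, abs_of_nonneg (by positivity)]
    rw [le_div_iff₀ h0] at hT2
    calc β ^ (1 + 2 * c) * μ β ≤ β ^ (1 + 2 * c) * (C * T ^ (1 + 2 * c)) := by gcongr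
      _ = C * (T * β) ^ (1 + 2 * c) := by
        rw [Real.mul_rpow hT0.le h0.le]
        ring
      _ ≤ _ := by gcongr
  · refine IsBigO.of_bound (2 * C ^ 2) ?_
    filter_upwards [h, self_mem_nhdsWithin] with β ⟨T, hT1, hT2, hT3, _, hT5⟩ h0
    have h0 : 0 < β := h0
    have hT0 : 0 < T := lt_of_lt_of_le (by positivity) hT1
    have hμ : 0 < μ β := by
      have : 0 < C * μ β := lt_of_lt_of_le (by positivity) hT3
      exact pos_of_mul_pos_right this hC.le
    have hVβ := hV β h0
    rw [norm_one, mul_one, Real.norm_eq_abs, abs_of_nonneg (by positivity), div_le_iff₀ hμ]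
    rw [le_div_iff₀ h0] at hT2
    have e : T ^ (2 + 2 * c) = T * T ^ (1 + 2 * c) := by
      rw [← Real.rpow_one_add' hT0.le (by linarith)]
      congr 1
      ring
    calc β * V β ≤ β * (C * T ^ (2 + 2 * c)) := by gcongr
      _ = C * (T * β) * T ^ (1 + 2 * c) := by
        rw [e]
        ring
      _ ≤ C * 2 * (C * μ β) := by gcongr
      _ = _ := by ring

variable {t D x w : ℕ → ℝ} {ρ M : ℝ}

/-- The first moment dominates along the resonant scales. -/
theorem SparseSpectrum.le_abs_tsum_one (S : SparseSpectrum t D x w ρ M) {L : ℝ} {N : ℕ}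
    (hN : 0 < x N - L) (hN4 : 4 * |x 0 - L| ≤ x N - L) {Λ : ℝ} (hΛ0 : 0 < Λ)
    (hΛ : Λ ^ 2 = 2 * (x N - L) * t N) (m : ℝ) :
    |m| / 8 * (1 / t N) ^ 1 * gaussSum w x L Λ ≤
      |∑' n, w n * (Real.exp (-(x n - L) ^ 2 / (2 * Λ ^ 2)) * ((x n - L) / Λ ^ 2 * m))| := by
  have ht := S.t_pos N
  have h1 := S.gauss_moment_one hN hN4 hΛ0 hΛ
  have e : ∀ n, w n * (Real.exp (-(x n - L) ^ 2 / (2 * Λ ^ 2)) * ((x n - L) / Λ ^ 2 * m)) =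
      m / Λ ^ 2 * (w n * (Real.exp (-(x n - L) ^ 2 / (2 * Λ ^ 2)) * (x n - L))) :=
    fun n => by ring
  rw [tsum_congr e, tsum_mul_left, abs_mul, abs_div, abs_of_pos (by positivity : 0 < Λ ^ 2)]
  calc _ = |m| / Λ ^ 2 * ((x N - L) / 4 * gaussSum w x L Λ) := by
        rw [hΛ]
        field_simp
        ring
    _ ≤ |m| / Λ ^ 2 * _ := mul_le_mul_of_nonneg_left (h1.trans (le_abs_self _)) (by positivity)

/-- The second moment dominates along the resonant scales. -/
theorem SparseSpectrum.le_abs_tsum_two (S : SparseSpectrum t D x w ρ M) {L : ℝ} {N : ℕ}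
    (hN : 8 * t N ≤ x N - L) {Λ : ℝ} (hΛ0 : 0 < Λ)
    (hΛ : Λ ^ 2 = 2 * (x N - L) * t N) (m : ℝ) :
    |m| / 32 * (1 / t N) ^ 2 * gaussSum w x L Λ ≤
      |∑' n, w n * (Real.exp (-(x n - L) ^ 2 / (2 * Λ ^ 2)) *
        ((((x n - L) / Λ ^ 2) ^ 2 - (1 / Λ) ^ 2) / 2 * m))| := by
  have ht := S.t_pos N
  have hy : 0 < x N - L := by linarith
  have h1 := S.gauss_moment_two hy hΛ0 hΛ
  have s0 := S.summable_gauss_mul_pow L hΛ0 0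
  have s2 := S.summable_gauss_mul_pow L hΛ0 2
  simp only [pow_zero, mul_one] at s0
  have hG : 0 ≤ gaussSum w x L Λ := gaussSum_nonneg (fun n => (S.w_pos n).le) L Λ
  have e : ∀ n, w n * (Real.exp (-(x n - L) ^ 2 / (2 * Λ ^ 2)) *
        ((((x n - L) / Λ ^ 2) ^ 2 - (1 / Λ) ^ 2) / 2 * m)) =
      m / 2 * (1 / (Λ ^ 2) ^ 2 * (w n * (Real.exp (-(x n - L) ^ 2 / (2 * Λ ^ 2)) *
        (x n - L) ^ 2)) - 1 / Λ ^ 2 * (w n * Real.exp (-(x n - L) ^ 2 / (2 * Λ ^ 2)))) :=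
    fun n => by ring
  rw [tsum_congr e, tsum_mul_left, (s2.mul_left _).tsum_sub (s0.mul_left _), tsum_mul_left,
    tsum_mul_left, abs_mul, abs_div, abs_two]
  have h2 : 1 / (8 * t N ^ 2) * gaussSum w x L Λ ≤ 1 / (Λ ^ 2) ^ 2 *
      ∑' n, w n * (Real.exp (-(x n - L) ^ 2 / (2 * Λ ^ 2)) * (x n - L) ^ 2) := by
    calc _ = 1 / (Λ ^ 2) ^ 2 * ((x N - L) ^ 2 / 2 * gaussSum w x L Λ) := by
          rw [hΛ]
          field_simp
          ring
      _ ≤ _ := by gcongr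
  -- The subtracted term is at most half of the main term, because `x N - L ≥ 8 t N`.
  have h3 : 1 / Λ ^ 2 * gaussSum w x L Λ ≤ 1 / (16 * t N ^ 2) * gaussSum w x L Λ := by
    refine mul_le_mul_of_nonneg_right ?_ hG
    rw [hΛ]
    refine one_div_le_one_div_of_le (by positivity) ?_
    nlinarith
  have h4 : |m| / 32 * (1 / t N) ^ 2 * gaussSum w x L Λ = |m| / 2 *
      (1 / (8 * t N ^ 2) * gaussSum w x L Λ - 1 / (16 * t N ^ 2) * gaussSum w x L Λ) := by
    field_simp
    ring
  rw [h4]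
  refine mul_le_mul_of_nonneg_left (le_trans ?_ (le_abs_self _)) (by positivity)
  rw [← gaussSum]
  linarith

variable {g : ℝ ≃o ℝ} {F : ℝ → ℝ}

/-- For other parameters the rates at `β₋ = 0` are optimal, under the growth conditions with
constant `c`. -/
theorem exists_system_not_approxLittleO (hg' : ContDiff ℝ ∞ g.symm) (hF : IsSmoothDensity F)
    {βp : EReal} (hβp : 0 < βp) (hdecay : ∀ β : ℝ, (β : EReal) < βp →
      IsRapidlyDecreasing fun x => Real.exp (β * x) * F (g.symm x)) {c : ℝ} (hc : 0 ≤ c)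
    {L v : ℝ} (hv : 0 ≤ v) :
    ∃ (H A : HilbertSeq →ₗ.[ℂ] HilbertSeq) (b : EnergyEigenbasis H ℕ),
      IsSystem b A F ∧ (∀ β : ℝ, 0 < β → GBounded b A g β) ∧
      (∀ β : ℝ, β < 0 → ¬ GBounded b A g β) ∧
      GConditions b A g F c ∧ BelowGbarZero b A g L ∧
      (L ≠ mean g F 0 → ¬ ApproxLittleO b A g F L v (1 / (1 + c))) ∧
      (L = mean g F 0 → v ≠ variance g F 0 → ¬ ApproxLittleO b A g F L v (2 / (1 + c))) := by
  obtain ⟨δ, D⟩ := exists_expDecay hg' hF hβp hdecay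
  have h0 : ∀ L, 0 < moment (fun z => F (g.symm z)) L 0 := moment_zero_pos hg' hF D
  obtain ⟨p, hp⟩ := exists_pos (g := g) hF
  obtain ⟨M, hM1, hM, hM'⟩ : ∃ M : ℝ, 1 ≤ M ∧ 8 * ((2 : ℝ) ^ (1 + c)) ^ 2 ≤ Real.exp (M / 2) ∧
      16 * ((1 + 2 * c) * 2 ^ (2 * c)) ≤ M := by
    have hexp : Tendsto (fun M : ℝ => Real.exp (M / 2)) atTop atTop :=
      Real.tendsto_exp_atTop.comp (tendsto_id.atTop_div_const two_pos)
    exact ((eventually_ge_atTop 1).and ((hexp.eventually_ge_atTop _).and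
      (eventually_ge_atTop _))).exists
  have S := sparseSpectrum hc hM1 hM p
  obtain ⟨C, hC, hgrowth⟩ := exists_canonical_growth hc hM1 hM hM' p
  have hlow := le_sparseLevel hc hM' p
  set t := levelScale c with ht
  set x := sparseLevel c M p with hx
  set w := sparseWeight c M with hwdef
  have hw : ∀ n, 0 ≤ w n := fun n => (S.w_pos n).le
  have hZ : ∀ β : ℝ, 0 < β → Summable fun n => w n * Real.exp (-β * x n) :=
    fun β hβ => S.summable_canonWeight hβ
  have hx0 : x 0 = p := rfl
  have hxn : ∀ n : ℕ, p + n ≤ x n := fun n => by simpa [hx0] using S.add_le_x n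
  have hposw : ∃ i, 0 < w i := ⟨0, S.w_pos 0⟩
  obtain ⟨hmean, hG2, hG3⟩ := conditions_of_growth hc hC
    (fun β hβ => canonVar_nonneg hw hZ hposw hβ) hgrowth
  set a : ℕ → ℝ := fun n => g.symm (x n) with hadef
  have ha : Tendsto a atTop atTop := tendsto_symm_comp hxn
  set b := diagEigenbasis a ha with hb
  have hA : IsPositiveObservable (diagOp w) := isPositiveObservable_diagOp hw
  have hd := diagEigenbasis_mem_domain a w ha
  have hwt : b.weight (diagOp w) = w := funext fun n => diagEigenbasis_weight a w ha n
  have hE : (fun n => g (b.E n)) = x := funext fun n => g.apply_symm_apply _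
  have hE' : ∀ n, g (b.E n) = x n := fun n => g.apply_symm_apply _
  have hsys : IsSystem b (diagOp w) F :=
    isSystem_diag ha hw hF.nonneg (summable_density_comp hF hβp hdecay hxn) hp
  have hGB : ∀ β : ℝ, 0 < β → GBounded b (diagOp w) g β := by
    intro β hβ
    rw [gBounded_iff b hA hd, hwt]
    simp_rw [hE']
    exact hZ β hβ
  have hNGB : ∀ β : ℝ, β < 0 → ¬ GBounded b (diagOp w) g β := by
    intro β hβ
    rw [gBounded_iff b hA hd, hwt]
    simp_rw [hE']
    intro hs
    -- For negative `β` the terms are bounded below, since the weights are at least `1` and the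
    -- levels at least `p`.
    have h1 := ge_of_tendsto' hs.tendsto_atTop_zero fun n => show
      Real.exp (-β * p) ≤ w n * Real.exp (-β * x n) from by
        refine le_trans ?_ (le_mul_of_one_le_left (Real.exp_pos _).le (S.one_le_w n))
        rw [Real.exp_le_exp]
        have := hxn n
        have := (Nat.cast_nonneg n : (0 : ℝ) ≤ n)
        nlinarith
    exact absurd h1 (not_le.mpr (Real.exp_pos _))
  have hgbar : gbar b (diagOp w) g = canonMean w x := by rw [gbar_eq b hA hd, hwt, hE]
  have hsig : sigmaSq b (diagOp w) g = canonVar w x := by rw [sigmaSq_eq b hA hd, hwt, hE]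
  have hbelow : ∀ L : ℝ, BelowGbarZero b (diagOp w) g L := by
    intro L
    refine ⟨⊤, ?_, EReal.coe_lt_top L⟩
    rw [EReal.tendsto_coe_nhds_top_iff, hgbar]
    exact hmean
  have hcond : GConditions b (diagOp w) g F c :=
    ⟨hbelow _, by rw [hgbar]; exact hG2, by rw [hgbar, hsig]; exact hG3⟩
  refine ⟨diagOp a, diagOp w, b, hsys, hGB, hNGB, hcond, hbelow L, ?_⟩
  have hSO : ∀ {k : ℕ} {R : ℝ → ℝ → ℝ}, RelOrder δ k R →
      SumOrder (b.weight (diagOp w)) (fun i => g (b.E i)) L (k / (1 + c)) R := by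
    intro k R hR
    rw [hwt, hE]
    exact sumOrder_of_conditions hw hZ hc D.pos
      ⟨1, one_pos, hmean.eventually_ge_atTop _⟩ hG2 hG3 hR
  have hW := hSO (relOrder_widened_one D.pos hv)
  rw [Nat.cast_one] at hW
  have hZδ := (gBounded_iff b hA hd δ).mp (hGB δ D.pos)
  -- The resonant scales: at level `n` the expansion parameter `(x n - L) / Λ²` equals `1 / (2 t
  -- n)`.
  set Λs : ℕ → ℝ := fun n => Real.sqrt (2 * (x n - L) * t n) with hΛs
  have hbig : ∀ᶠ n in atTop, 2 + |p - L| ≤ t n := S.t_tendsto.eventually_ge_atTop _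
  have hyn : ∀ᶠ n in atTop, 8 * t n ^ (1 + 2 * c) ≤ x n - L ∧ 8 * t n ≤ x n - L ∧
      4 * |x 0 - L| ≤ x n - L := by
    filter_upwards [hbig] with n hn
    have h1 := S.one_le_t n
    have h2 : t n ≤ t n ^ (1 + 2 * c) := by
      conv_lhs => rw [← Real.rpow_one (t n)]
      exact Real.rpow_le_rpow_of_exponent_le h1 (by linarith)
    have h3 := hlow n
    have h4 := neg_abs_le (p - L)
    have h5 := abs_nonneg (p - L)
    rw [hx0]
    refine ⟨?_, ?_, ?_⟩ <;> linarith
  have hΛsq : ∀ᶠ n in atTop, 0 < Λs n ∧ Λs n ^ 2 = 2 * (x n - L) * t n ∧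
      t n ^ (1 + c) ≤ Λs n := by
    filter_upwards [hyn] with n hn
    have h1 := S.t_pos n
    have h2 : 0 < x n - L := by linarith [hn.2.1]
    refine ⟨Real.sqrt_pos.mpr (by positivity), Real.sq_sqrt (by positivity),
      Real.le_sqrt_of_sq_le ?_⟩
    have e : (t n ^ (1 + c)) ^ 2 = t n ^ (1 + 2 * c) * t n := by
      rw [← Real.rpow_natCast, ← Real.rpow_mul h1.le, ← Real.rpow_add_one h1.ne']
      congr 1
      push_cast
      ring
    rw [e]
    refine mul_le_mul_of_nonneg_right ?_ h1.le
    have : 0 < t n ^ (1 + 2 * c) := by positivity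
    linarith [hn.1]
  have hΛt : Tendsto Λs atTop atTop := by
    refine tendsto_atTop_mono' _ ?_ S.t_tendsto
    filter_upwards [hΛsq] with n hn
    refine le_trans ?_ hn.2.2
    conv_lhs => rw [← Real.rpow_one (t n)]
    exact Real.rpow_le_rpow_of_exponent_le (S.one_le_t n) (by linarith)
  have hB0 : Tendsto (fun n => 1 / t n) atTop (𝓝 0) := by
    simp only [one_div]
    exact S.t_tendsto.inv_tendsto_atTop
  -- Equivalent to `t n ^ (1 + c) ≤ Λs n`, which rests on the lower bound for the levels; it makes
  -- `1 / t n` an admissible `B`.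
  have hεB : ∀ᶠ n in atTop, Λs n ^ (-(1 / (1 + c))) ≤ 1 / t n := by
    filter_upwards [hΛsq] with n hn
    have h1 := S.t_pos n
    rw [Real.rpow_neg hn.1.le, ← one_div]
    refine one_div_le_one_div_of_le h1 ?_
    have h2 := Real.rpow_le_rpow (by positivity) hn.2.2 (by positivity : 0 ≤ 1 / (1 + c))
    rwa [← Real.rpow_mul h1.le, mul_one_div_cancel (by positivity), Real.rpow_one] at h2
  have hposw' : ∃ i, 0 < b.weight (diagOp w) i := by rwa [hwt]
  constructor
  · intro hL
    set m₁ := moment (fun z => F (g.symm z)) L 1 with hm₁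
    have hm : m₁ ≠ 0 := by
      rw [hm₁, moment_one D h0]
      exact mul_ne_zero (h0 L).ne' (sub_ne_zero.mpr hL.symm)
    have hres := not_approxLittleO b hA hd D hZδ h0 hv hc 1
      (P := fun Λ y => y / Λ ^ 2 * m₁) (κ := |m₁| / 8) hW (by
        have := hSO (D.relOrder_deviation_two L hv)
        norm_num at this ⊢
        exact this) hΛt hB0 hεB (by positivity) hposw' (by
        filter_upwards [hyn, hΛsq] with n h1 h2
        rw [hwt, hE]
        simp_rw [hE']
        exact S.le_abs_tsum_one (by linarith [S.t_pos n, h1.2.1]) h1.2.2 h2.1 h2.2.1 m₁)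
    simpa using hres
  · intro hL hne
    set m₂ := moment (fun z => F (g.symm z)) L 2 - v * moment (fun z => F (g.symm z)) L 0 with hm₂
    have hm : m₂ ≠ 0 := by
      rw [hm₂, hL, moment_two h0, ← sub_mul]
      exact mul_ne_zero (sub_ne_zero.mpr hne.symm) (h0 _).ne'
    have hm₁ : moment (fun z => F (g.symm z)) L 1 = 0 := by
      rw [moment_one D h0, hL, sub_self, mul_zero]
    have hres := not_approxLittleO b hA hd D hZδ h0 hv hc 2
      (P := fun Λ y => ((y / Λ ^ 2) ^ 2 - (1 / Λ) ^ 2) / 2 * m₂) (κ := |m₂| / 32) hW (by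
        have := hSO (D.relOrder_deviation L hv)
        simp only [hm₁, mul_zero, zero_add] at this
        norm_num at this ⊢
        exact this) hΛt hB0 hεB (by positivity) hposw' (by
        filter_upwards [hyn, hΛsq] with n h1 h2
        rw [hwt, hE]
        simp_rw [hE']
        exact S.le_abs_tsum_two h1.2.1 h2.1 h2.2.1 m₂)
    simpa using hres

end SparseSystem

end GaussConv

end
-- Guaranteed rates and their optimality
open GaussConv in
theorem theorem1
    -- an orientation preserving diffeomorphism of the real line
    (g : ℝ ≃o ℝ) (hg : ContDiff ℝ ∞ g) (hg' : ContDiff ℝ ∞ g.symm)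
    -- a smooth probability density with reparametrized exponential decay
    (F : ℝ → ℝ) (hF : IsSmoothDensity F)
    (βp : EReal) (hβp : 0 < βp)
    (hdecay : ∀ β : ℝ, (β : EReal) < βp →
      IsRapidlyDecreasing fun x => Real.exp (β * x) * F (g.symm x)) :
    -- the guaranteed rates, for every system
    (∀ (𝓗 : Type*) [NormedAddCommGroup 𝓗] [InnerProductSpace ℂ 𝓗] [CompleteSpace 𝓗]
        (ι : Type*) (H A : 𝓗 →ₗ.[ℂ] 𝓗) (b : EnergyEigenbasis H ι),
      IsSelfAdjoint H → IsPositiveObservable A →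
      ∀ βm : EReal, βm ≤ 0 → (∀ β : ℝ, βm < (β : EReal) → GBounded b A g β) →
        -- all the traces are finite
        (∀ Λ : ℝ, 0 < Λ → b.FiniteTr A (coarse g F Λ) ∧
          ∀ L v : ℝ, 0 ≤ v → b.FiniteTr A (gaussEnsemble g L v Λ)) ∧
        (βm < 0 →
          ApproxBigO b A g F (mean g F 0) (variance g F 0) 3 ∧
          (∀ v : ℝ, 0 ≤ v → ApproxBigO b A g F (mean g F 0) v 2) ∧
          (∀ L v : ℝ, 0 ≤ v → ApproxBigO b A g F L v 1)) ∧
        (∀ c : ℝ, 0 ≤ c → GConditions b A g F c →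
          ApproxBigO b A g F (mean g F 0) (variance g F 0) (3 / (1 + c)) ∧
          (∀ v : ℝ, 0 ≤ v → ApproxBigO b A g F (mean g F 0) v (2 / (1 + c))) ∧
          (∀ L v : ℝ, 0 ≤ v → BelowGbarZero b A g L →
            ApproxBigO b A g F L v (1 / (1 + c))))) ∧
    -- for other parameters no better rate can be guaranteed under the conditions as `β → 0⁺`
    (∀ c : ℝ, 0 ≤ c → ∀ L v : ℝ, 0 ≤ v →
      ∃ (H A : HilbertSeq →ₗ.[ℂ] HilbertSeq) (b : EnergyEigenbasis H ℕ),
        IsSystem b A F ∧ (∀ β : ℝ, 0 < β → GBounded b A g β) ∧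
        (∀ β : ℝ, β < 0 → ¬ GBounded b A g β) ∧
        GConditions b A g F c ∧ BelowGbarZero b A g L ∧
        (L ≠ mean g F 0 → ¬ ApproxLittleO b A g F L v (1 / (1 + c))) ∧
        (L = mean g F 0 → v ≠ variance g F 0 →
          ¬ ApproxLittleO b A g F L v (2 / (1 + c)))) ∧
    -- for other parameters only a slower rate can be guaranteed when `β₋ < 0`
    (∀ L v : ℝ, 0 ≤ v → (L ≠ mean g F 0 ∨ v ≠ variance g F 0) →
      ∃ (H A : HilbertSeq →ₗ.[ℂ] HilbertSeq) (b : EnergyEigenbasis H ℕ) (βm : ℝ),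
        IsSystem b A F ∧ βm < 0 ∧ (∀ β : ℝ, βm < β → GBounded b A g β) ∧
        ¬ ApproxLittleO b A g F L v 2) := by
  refine ⟨fun 𝓗 _ _ _ ι H A b _ hA βm hβm hB =>
    guaranteed_rates hg' hF hβp hdecay b hA hβm hB, fun c hc L v hv =>
      exists_system_not_approxLittleO hg' hF hβp hdecay hc hv, fun L v hv hne =>
      exists_system_not_approxLittleO_two hg' hF hβp hdecay hv hne⟩
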